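/- Let $F$ be a field. Running times are worst-case numbers of steps of deterministic algebraic computation trees over $F$: a step loads a constant of $F$, performs one of $+,-,\times,\div$, or branches on whether a value is zero; a tree must be correct for inputs from every extension field of $F$. There is one tree for each input format. For $k\ge 0$ let $\omega(k)$ be the infimum of all $\tau$ such that an $n\times\lceil n^k\rceil$ matrix can be multiplied by a $\lceil n^k\rceil\times n$ matrix in time $O(n^\tau)$, let $\omega=\omega(1)$, let $\beta=\sup\{k\ge 0:\omega(k)=2\}$ be the dual exponent of matrix multiplication, and for $1\le s\le n$ put $\omega_s=\omega(\log_n s)$ (for $n=1$ read $\log_n s$ as $0$), so that $n^{\omega_s}$ is, up to factors $n^{o(1)}$, the time for multiplying an $n\times s$ by an $s\times n$ matrix. We write $f=\hat O(g)$ if for every $\varepsilon>0$ there is a constant $C$ with $f\le C\,n^{\varepsilon}g$ for all block sizes $s\ge1$ and numbers of blocks $m\ge1$, where $n=ms$. Let $Z_0$ be the $n\times n$ block down-shift matrix, with $m\times m$ blocks of size $s\times s$, which has identity blocks just below the block diagonal and zero blocks elsewhere. Let $(P,Q)$ be one of $(Z_0,Z_0^T)$, $(Z_0^T,Z_0)$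 (block Toeplitz-like structure, in its two orientations) or $(Z_0^T,Z_0^T)$, $(Z_0,Z_0)$ (block Hankel-like structure, in its two orientations). A pair of matrices $X,Y$ of size $n\times\alpha s$ is called a pair of generators of length $\alpha$ of an $n\times n$ matrix $A$ if $A-PAQ=XY^T$; such a pair exists if and only if $\operatorname{rank}(A-PAQ)\le \alpha s$, that is, if $A$ has block displacement rank at most $\alpha$. Let $\alpha=\alpha(n)$ be a function of $n$ with $\alpha(n)\le n^{o(1)}$. Then there is an algorithm, that is, a family of computation trees, one for each pair $(m,s)$, which, given the entries of a pair of generators $X,Y$ of length $\alpha(n)$ of a nonsingular $n\times n$ block matrix $A$ with block size $s=n/m$, outputs all $n^2$ entries of $A^{-1}$, in time $$\hat O\big(s^{\omega}m+n^{\omega_s}+n^2\big)=\hat O\big(n^{\omega_s}\big),$$ where the equality means that $s^{\omega}m+n^{\omega_s}+n^2=\hat O(n^{\omega_s})$ and conversely. Moreover, restricted to the pairs $(m,s)$ with $s<n^{\beta}$, the running time of this algorithm is $n^{2+o(1)}$: for every $\varepsilon>0$ there is a constant $C$ such that it is at most $C\,n^{2+\varepsilon}$ for all such $(m,s)$. 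-/

import Mathlib

open Filter

universe u

noncomputable section

/-! ### Algebraic computation trees and their cost -/

/-- The arithmetic operations of a field. -/
inductive ArithOp where
  | add | sub | mul | div

/-- The value of an arithmetic operation; division by zero is undefined. -/
def ArithOp.eval {K : Type*} [Field K] (op : ArithOp) (x y : K) : Option K :=
  open Classical in
  match op with
  | .add => some (x + y)
  | .sub => some (x - y)
  | .mul => some (x * y)
  | .div => if y = 0 then none else some (x / y)

/-- Algebraic computation trees over the field `F`, with inputs indexed by `ι` and outputs indexed
by `κ`. An operand is an input (`Sum.inl i`, read-only) or a work register (`Sum.inr k`).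
A tree may load a constant of `F`, perform one arithmetic operation, branch on whether an operand
is zero, or halt and name the operands that hold the outputs. -/
inductive CompTree (F : Type u) (ι κ : Type) : Type u where
  | halt (out : κ → ι ⊕ ℕ) : CompTree F ι κ
  | const (dst : ℕ) (c : F) (next : CompTree F ι κ) : CompTree F ι κ
  | arith (dst : ℕ) (op : ArithOp) (x y : ι ⊕ ℕ) (next : CompTree F ι κ) : CompTree F ι κ
  | ifZero (x : ι ⊕ ℕ) (yes no : CompTree F ι κ) : CompTree F ι κ

namespace CompTree

variable {F : Type u} {ι κ : Type}

/-- Running a tree on inputs from an extension field `K` of `F`, from given contents of the work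
registers. The result is `none` if a division by zero occurs. -/
def runFrom {K : Type*} [Field F] [Field K] [Algebra F K] (inp : ι → K) :
    CompTree F ι κ → (ℕ → K) → Option (κ → K)
  | halt out, reg => some fun k => Sum.elim inp reg (out k)
  | const dst c next, reg => runFrom inp next (Function.update reg dst (algebraMap F K c))
  | arith dst op x y next, reg =>
      (op.eval (Sum.elim inp reg x) (Sum.elim inp reg y)).bind fun v =>
        runFrom inp next (Function.update reg dst v)
  | ifZero x yes no, reg =>
      open Classical in
      if Sum.elim inp reg x = 0 then runFrom inp yes reg else runFrom inp no reg

/-- Running a tree, with all work registers initially zero. -/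
def run {K : Type*} [Field F] [Field K] [Algebra F K] (T : CompTree F ι κ) (inp : ι → K) :
    Option (κ → K) :=
  T.runFrom inp fun _ => 0

/-- The worst-case number of steps (loading a constant, an arithmetic operation, a zero test). -/
def cost : CompTree F ι κ → ℕ
  | halt _ => 0
  | const _ _ next => cost next + 1
  | arith _ _ _ _ next => cost next + 1
  | ifZero _ yes no => max (cost yes) (cost no) + 1

end CompTree

/-! ### Exponents of matrix multiplication -/

/-- The tree multiplies `a × b` by `b × c` matrices. Its validity over every extension field `K`
of `F` means that it is an algebraic algorithm also when `F` is finite, so that a tree cannot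
just tabulate the finitely many inputs over `F`. -/
def MultipliesMatrices (F : Type u) [Field F] (a b c : ℕ)
    (T : CompTree F ((Fin a × Fin b) ⊕ (Fin b × Fin c)) (Fin a × Fin c)) : Prop :=
  ∀ (K : Type u) [Field K] [Algebra F K]
    (A : Matrix (Fin a) (Fin b) K) (B : Matrix (Fin b) (Fin c) K),
    T.run (Sum.elim (fun p => A p.1 p.2) (fun p => B p.1 p.2)) = some fun p => (A * B) p.1 p.2

/-- `ω(k)`: the infimum of the exponents `τ` such that `n × ⌈n ^ k⌉` by `⌈n ^ k⌉ × n` matrices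
over `F` can be multiplied in `O(n ^ τ)` steps. -/
def omegaRect (F : Type u) [Field F] (k : ℝ) : ℝ :=
  sInf {τ : ℝ | ∃ C : ℝ, ∀ n : ℕ, 0 < n →
    ∃ T : CompTree F ((Fin n × Fin ⌈(n : ℝ) ^ k⌉₊) ⊕ (Fin ⌈(n : ℝ) ^ k⌉₊ × Fin n))
        (Fin n × Fin n),
      MultipliesMatrices F n ⌈(n : ℝ) ^ k⌉₊ n T ∧ (T.cost : ℝ) ≤ C * (n : ℝ) ^ τ}

/-- The exponent `ω` of square matrix multiplication. -/
def omega (F : Type u) [Field F] : ℝ := omegaRect F 1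

/-- `ω_s` (for given `n`): the exponent of multiplying an `n × s` by an `s × n` matrix, that is
`ω(k)` with `n ^ k = s`. -/
def omegaSub (F : Type u) [Field F] (n s : ℕ) : ℝ := omegaRect F (Real.logb n s)

/-- The dual exponent `β` of matrix multiplication. -/
def dualExponent (F : Type u) [Field F] : ℝ := sSup {k : ℝ | 0 ≤ k ∧ omegaRect F k = 2}

/-! ### Block displacement structure

Matrices with `m × m` blocks of size `s × s` are indexed by `Fin m × Fin s`; the first component
is the number of the block, and the order of the matrix is `n = m * s`. -/

/-- The block shift `Z₀`: identity blocks just below the block diagonal, zero blocks elsewhere. -/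
def blockShift (K : Type*) [Field K] (m s : ℕ) :
    Matrix (Fin m × Fin s) (Fin m × Fin s) K :=
  Matrix.of fun p q => if (p.1 : ℕ) = (q.1 : ℕ) + 1 ∧ p.2 = q.2 then 1 else 0

/-- The types of structure: Toeplitz and Hankel, each with its two orientations. -/
inductive StructType where
  | toeplitz | toeplitzRev | hankel | hankelRev

/-- The left operator matrix `P`. -/
def StructType.leftOp (t : StructType) (K : Type*) [Field K] (m s : ℕ) :
    Matrix (Fin m × Fin s) (Fin m × Fin s) K :=
  match t with
  | .toeplitz => blockShift K m s
  | .toeplitzRev => (blockShift K m s).transpose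
  | .hankel => (blockShift K m s).transpose
  | .hankelRev => blockShift K m s

/-- The right operator matrix `Q`. -/
def StructType.rightOp (t : StructType) (K : Type*) [Field K] (m s : ℕ) :
    Matrix (Fin m × Fin s) (Fin m × Fin s) K :=
  match t with
  | .toeplitz => (blockShift K m s).transpose
  | .toeplitzRev => blockShift K m s
  | .hankel => (blockShift K m s).transpose
  | .hankelRev => blockShift K m s

/-- The displacement `A - P * A * Q`. -/
def displacement (t : StructType) {K : Type*} [Field K] {m s : ℕ}
    (A : Matrix (Fin m × Fin s) (Fin m × Fin s) K) :
    Matrix (Fin m × Fin s) (Fin m × Fin s) K :=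
  A - t.leftOp K m s * A * t.rightOp K m s

/-- Input format: the entries of two rectangular generators `X`, `Y`, each of size
`n × (a * s)`, that is, `a` blocks of `s` columns. -/
abbrev GenInput (m s a : ℕ) : Type :=
  ((Fin m × Fin s) × (Fin a × Fin s)) ⊕ ((Fin m × Fin s) × (Fin a × Fin s))

/-- The tree inverts explicitly every nonsingular block matrix `A` of structure type `t`, given by
generators `X`, `Y` of length `a` (so `A` has block displacement rank at most `a`): it outputs
all the entries of `A⁻¹`. -/
def InvertsStructured (F : Type u) [Field F] (t : StructType) (m s a : ℕ)
    (T : CompTree F (GenInput m s a) ((Fin m × Fin s) × (Fin m × Fin s))) : Prop :=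
  ∀ (K : Type u) [Field K] [Algebra F K]
    (A : Matrix (Fin m × Fin s) (Fin m × Fin s) K)
    (X Y : Matrix (Fin m × Fin s) (Fin a × Fin s) K),
    IsUnit A.det → displacement t A = X * Y.transpose →
    T.run (Sum.elim (fun p => X p.1 p.2) (fun p => Y p.1 p.2)) = some fun p => A⁻¹ p.1 p.2

/-! ### The notation `Ô` -/

/-- `f = Ô(g)` for functions of the number `m` and the size `s` of the blocks, on the pairs
`(m, s)` in `D`: factors `n ^ o(1)` with `n = m * s` are suppressed, uniformly in `m` and `s`. -/
def HatO (D : ℕ → ℕ → Prop) (f g : ℕ → ℕ → ℝ) : Prop :=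
  ∀ ε : ℝ, 0 < ε → ∃ C : ℝ, ∀ m s : ℕ, 0 < m → 0 < s → D m s →
    f m s ≤ C * ((m * s : ℕ) : ℝ) ^ ε * g m s

/-- The bound `s ^ ω * m + n ^ ω_s + n ^ 2` with `n = m * s`. -/
def threeTermBound (F : Type u) [Field F] (m s : ℕ) : ℝ :=
  (s : ℝ) ^ omega F * m + ((m * s : ℕ) : ℝ) ^ omegaSub F (m * s) s + ((m * s : ℕ) : ℝ) ^ 2

/-- The bound `n ^ ω_s` with `n = m * s`. -/
def rectBound (F : Type u) [Field F] (m s : ℕ) : ℝ :=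
  ((m * s : ℕ) : ℝ) ^ omegaSub F (m * s) s

end

/-!
Why structured inversion reduces to products of the format `n × s` by `s × n`.

*Model.* A computation tree only sees its inputs through zero tests. `Prog` describes its work over
all inputs at once: a value is a function of the input, a zero test splits the set of inputs, and
whatever has been found by testing (a set of pivots, a list of degrees) is a constant on the part
that remains. `Prog.exists_tree` and `Prog.of_tree` translate between programs and trees, so that
a tree for a matrix product can be used as a subroutine; this is what `MulCost` records.

*Exponents.* `ω(k)` is at least `2`, nondecreasing, and satisfies `ω(k') ≤ ω(k) + k' - k` for
`k ≤ k'`, because the inner dimension can be cut into parts. Hence the constants in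
`exists_mulCost_omegaSub` can be chosen independently of `s`, the time `(d * s) ^ ω_s` for `d`
blocks is superadditive in `d` (`rpow_omegaSub_mul_le`), and `s ^ ω * m ≤ n ^ ω_s`
(`rpow_omega_mul_le_rectBound`).

*Linear systems.* Let `A - Z * A * Zᵀ = X * Yᵀ` for the block down-shift `Z`. Then the rows `w` with
`w * A = B` for a few right-hand sides are coefficients of the polynomial vectors of low degree that
are annihilated modulo `X ^ (2 * m)` by a polynomial matrix with `O(α * s)` rows and columns
(`systemPoly`). All of these vectors are combinations of the rows of an order basis
(`IsOrderBasis`), which is found by divide and conquer on the order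
(`Prog.exists_isOrderBasis`): each level costs two products of polynomial matrices, and a product of
polynomial matrices of degree `d` and size `r` is read off a single product of matrices of the
formats `d * r × r` and `r × d * r` (`Prog.polyMul`). This is where the rectangular products come
from. The base case, of order one, is elimination on a matrix of constants with pivots chosen in
the order of the degrees (`Prog.exists_isProfile`); it costs about `s ^ ω`, and there are `m` of
them. The method does not require the leading minors of `A` to be nonsingular and does not use
randomization, so it is valid over every field.

*Inversion.* The matrix `Z * A⁻¹ - A⁻¹ * Z` is a product of an `n × r` by an `r × n` matrix with
`r = O(α * s)` whose factors are solutions of such systems (`blockShift_mul_inv_sub`), so one more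
rectangular product and summation along the block diagonals give all entries of `A⁻¹`
(`Prog.inv_toeplitz`). The other types of structure differ from this one by reversing the order of
the block rows or columns. Finally, a tree of least cost for each format meets the bounds for all
`ε` at once.
-/

universe v

noncomputable section

namespace StructInv

/-! ### Programs over families of values -/

section

variable {F : Type u} [Field F] {I : Type v} {K : I → Type u} [∀ p, Field (K p)]
  [∀ p, Algebra F (K p)]

/-- The value `v`, a function on the set of all inputs, is zero or agrees with a member of `S` on
the set `D` of inputs. -/
def Avail (D : Set I) (S : Set (∀ p, K p)) (v : ∀ p, K p) : Prop :=
  (∀ p ∈ D, v p = 0) ∨ ∃ w ∈ S, ∀ p ∈ D, w p = v p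

variable (F) in
/-- `Prog F goal D S c`: for inputs in `D`, starting from the values in `S`, at most `c` steps of a
computation tree reach a leaf at which the set of inputs that lead there and the set of values
computed so far satisfy `goal`. Values are functions of the input, and a zero test splits `D`;
so discrete information found by branching, such as the position of a pivot, may be used as a
constant after the test. -/
inductive Prog (goal : Set I → Set (∀ p, K p) → Prop) :
    Set I → Set (∀ p, K p) → ℝ → Prop
  | halt {D S c} : goal D S → 0 ≤ c → Prog goal D S c
  | const {D S c} (a : F) : Prog goal D (insert (fun p => algebraMap F (K p) a) S) c →
      Prog goal D S (c + 1)
  | arith {D S c} (op : ArithOp) (x y v : ∀ p, K p) : Avail D S x → Avail D S y →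
      (∀ p ∈ D, op.eval (x p) (y p) = some (v p)) → Prog goal D (insert v S) c →
      Prog goal D S (c + 1)
  | ifZero {D S c} (x : ∀ p, K p) : Avail D S x → Prog goal {p ∈ D | x p = 0} S c →
      Prog goal {p ∈ D | x p ≠ 0} S c → Prog goal D S (c + 1)

theorem Avail.mono {D D' : Set I} {S S' : Set (∀ p, K p)} {v : ∀ p, K p} (h : Avail D S v)
    (hD : D' ⊆ D) (hS : S ⊆ S') : Avail D' S' v := by
  rcases h with h | ⟨w, hw, h⟩
  · exact Or.inl fun p hp => h p (hD hp)
  · exact Or.inr ⟨w, hS hw, fun p hp => h p (hD hp)⟩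

theorem Avail.congr {D : Set I} {S : Set (∀ p, K p)} {v v' : ∀ p, K p} (h : Avail D S v)
    (hv : ∀ p ∈ D, v p = v' p) : Avail D S v' := by
  rcases h with h | ⟨w, hw, h⟩
  · exact Or.inl fun p hp => by rw [← hv p hp, h p hp]
  · exact Or.inr ⟨w, hw, fun p hp => by rw [h p hp, hv p hp]⟩

theorem Avail.zero {D : Set I} {S : Set (∀ p, K p)} : Avail D S fun _ => 0 :=
  Or.inl fun _ _ => rfl

theorem Avail.of_mem {D : Set I} {S : Set (∀ p, K p)} {v : ∀ p, K p} (h : v ∈ S) :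
    Avail D S v :=
  Or.inr ⟨v, h, fun _ _ => rfl⟩

namespace Prog

variable {goal goal' : Set I → Set (∀ p, K p) → Prop} {D : Set I} {S : Set (∀ p, K p)} {c c' : ℝ}

theorem nonneg (h : Prog F goal D S c) : 0 ≤ c := by
  induction h <;> linarith

theorem bind (h : Prog F goal D S c)
    (h' : ∀ D' S', D' ⊆ D → S ⊆ S' → goal D' S' → Prog F goal' D' S' c') :
    Prog F goal' D S (c + c') := by
  have mono : ∀ {D S c}, Prog F goal' D S c → ∀ c₂, c ≤ c₂ → Prog F goal' D S c₂ := by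
    intro D S c h
    induction h with
    | halt hg hc => exact fun c₂ h => .halt hg (hc.trans h)
    | const a _ ih =>
      intro c₂ h
      have := Prog.const (c := c₂ - 1) a (ih _ (by linarith))
      simpa using this
    | arith op x y v hx hy hv _ ih =>
      intro c₂ h
      have := Prog.arith (c := c₂ - 1) op x y v hx hy hv (ih _ (by linarith))
      simpa using this
    | ifZero x hx _ _ ih1 ih2 =>
      intro c₂ h
      have := Prog.ifZero (c := c₂ - 1) x hx (ih1 _ (by linarith)) (ih2 _ (by linarith))
      simpa using this
  induction h with
  | halt hg hc => exact mono (h' _ _ subset_rfl subset_rfl hg) _ (by linarith)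
  | const a _ ih =>
    rw [add_right_comm]
    exact .const a (ih fun D' S' hD hS => h' D' S' hD ((Set.subset_insert _ _).trans hS))
  | arith op x y v hx hy hv _ ih =>
    rw [add_right_comm]
    exact .arith op x y v hx hy hv
      (ih fun D' S' hD hS => h' D' S' hD ((Set.subset_insert _ _).trans hS))
  | ifZero x hx _ _ ih1 ih2 =>
    rw [add_right_comm]
    exact .ifZero x hx
      (ih1 fun D' S' hD hS => h' D' S' (hD.trans (Set.sep_subset _ _)) hS)
      (ih2 fun D' S' hD hS => h' D' S' (hD.trans (Set.sep_subset _ _)) hS)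

/-- Sequential composition, with the total cost left free. -/
theorem seq (h : Prog F goal D S c) {c₂ : ℝ} (hc : c + c' ≤ c₂)
    (h' : ∀ D' S', D' ⊆ D → S ⊆ S' → goal D' S' → Prog F goal' D' S' c') :
    Prog F goal' D S c₂ := by
  have h1 : Prog F goal' D S (c + (c₂ - c)) := by
    refine h.bind fun D' S' hD hS hg => ?_
    have h2 := bind (goal' := goal') (c := c') (c' := c₂ - c - c') (h' D' S' hD hS hg)
      fun D' S' _ _ hg => .halt hg (by linarith)
    simpa using h2
  simpa using h1

theorem mono (h : Prog F goal D S c) (hc : c ≤ c') : Prog F goal D S c' :=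
  h.seq (c' := 0) (by linarith) fun _ _ _ _ hg => .halt hg le_rfl

/-- Strengthening of the goal by what is known at the leaf. -/
theorem imp (h : Prog F goal D S c) (hc : c ≤ c')
    (h' : ∀ D' S', D' ⊆ D → S ⊆ S' → goal D' S' → goal' D' S') : Prog F goal' D S c' :=
  h.seq (c' := 0) (by linarith) fun _ _ hD hS hg => .halt (h' _ _ hD hS hg) le_rfl

theorem of_forall_finset {ι : Type*} (s : Finset ι)
    (g : ι → Set I → Set (∀ p, K p) → Prop)
    (hg : ∀ i D S D' S', g i D S → D' ⊆ D → S ⊆ S' → g i D' S')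
    (h : ∀ i ∈ s, ∀ D' S', D' ⊆ D → S ⊆ S' → Prog F (g i) D' S' c) :
    Prog F (fun D S => ∀ i ∈ s, g i D S) D S (s.card * c) := by
  classical
  induction s using Finset.induction_on with
  | empty => exact .halt (by simp) (by simp)
  | insert a s ha ih =>
    refine (ih fun i hi => h i (Finset.mem_insert_of_mem hi)).seq (c' := c) ?_ ?_
    · rw [Finset.card_insert_of_notMem ha]; push_cast; linarith
    · intro D' S' hD hS hgs
      refine (h a (Finset.mem_insert_self _ _) D' S' hD hS).imp le_rfl ?_
      intro D'' S'' hD' hS' hga i hi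
      rcases Finset.mem_insert.1 hi with rfl | hi
      · exact hga
      · exact hg _ _ _ _ _ (hgs i hi) hD' hS'

/-- A finite family of tasks, each of cost `c`. -/
theorem of_forall {ι : Type*} [Fintype ι] (g : ι → Set I → Set (∀ p, K p) → Prop)
    (hg : ∀ i D S D' S', g i D S → D' ⊆ D → S ⊆ S' → g i D' S')
    (h : ∀ i D' S', D' ⊆ D → S ⊆ S' → Prog F (g i) D' S' c) :
    Prog F (fun D S => ∀ i, g i D S) D S (Fintype.card ι * c) := by
  refine (of_forall_finset (F := F) Finset.univ g hg fun i _ => h i).imp le_rfl ?_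
  exact fun _ _ _ _ h i => h i (Finset.mem_univ i)

theorem avail_family {ι : Type*} [Fintype ι] (v : ι → ∀ p, K p)
    (h : ∀ i D' S', D' ⊆ D → S ⊆ S' → Prog F (fun D S => Avail D S (v i)) D' S' c) :
    Prog F (fun D S => ∀ i, Avail D S (v i)) D S (Fintype.card ι * c) :=
  of_forall (F := F) _ (fun _ _ _ _ _ h hD hS => h.mono hD hS) h

theorem op_avail (op : ArithOp) {x y v : ∀ p, K p} (hx : Avail D S x) (hy : Avail D S y)
    (hv : ∀ p ∈ D, op.eval (x p) (y p) = some (v p)) :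
    Prog F (fun D S => Avail D S v) D S 1 := by
  have := Prog.arith (F := F) (goal := fun D S => Avail D S v) op x y v hx hy hv
    (.halt (c := 0) (Avail.of_mem (Set.mem_insert _ _)) le_rfl)
  simpa using this

theorem add_avail {x y : ∀ p, K p} (hx : Avail D S x) (hy : Avail D S y) :
    Prog F (fun D S => Avail D S (fun p => x p + y p)) D S 1 :=
  op_avail .add hx hy fun _ _ => rfl

theorem sub_avail {x y : ∀ p, K p} (hx : Avail D S x) (hy : Avail D S y) :
    Prog F (fun D S => Avail D S (fun p => x p - y p)) D S 1 :=
  op_avail .sub hx hy fun _ _ => rfl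

theorem mul_avail {x y : ∀ p, K p} (hx : Avail D S x) (hy : Avail D S y) :
    Prog F (fun D S => Avail D S (fun p => x p * y p)) D S 1 :=
  op_avail .mul hx hy fun _ _ => rfl

theorem inv_avail {x : ∀ p, K p} (hx : Avail D S x) (h0 : ∀ p ∈ D, x p ≠ 0) :
    Prog F (fun D S => Avail D S (fun p => (x p)⁻¹)) D S 2 := by
  have : Prog F (fun D S => Avail D S (fun p => (x p)⁻¹)) D S (1 + 1) := by
    refine .const 1 (op_avail .div (Avail.of_mem (Set.mem_insert _ _))
      (hx.mono subset_rfl (Set.subset_insert _ _)) fun p hp => ?_)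
    simp [ArithOp.eval, h0 p hp]
  exact this.mono (by norm_num)

theorem sum_avail {ι : Type*} (s : Finset ι) (v : ι → ∀ p, K p)
    (hv : ∀ i ∈ s, Avail D S (v i)) :
    Prog F (fun D S => Avail D S (fun p => ∑ i ∈ s, v i p)) D S s.card := by
  classical
  induction s using Finset.induction_on with
  | empty => exact .halt (Or.inl (by simp)) (by simp)
  | insert a s ha ih =>
    refine (ih fun i hi => hv i (Finset.mem_insert_of_mem hi)).seq (c' := 1) ?_ ?_
    · rw [Finset.card_insert_of_notMem ha]; push_cast; linarith
    · intro D' S' hD hS h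
      refine (add_avail ((hv a (Finset.mem_insert_self _ _)).mono hD hS) h).imp le_rfl ?_
      intro D'' S'' _ _ h
      simpa [Finset.sum_insert ha] using h

/-- A program whose goal is to have the values `y` is a computation tree with outputs `y`. The
registers below `r` are in use. -/
theorem exists_tree_runFrom {ι κ : Type} (x : ι → ∀ p, K p) (y : κ → ∀ p, K p)
    (h : Prog F (fun D S => ∀ k, Avail D S (y k)) D S c) :
    ∀ (r : ℕ) (reg : ∀ p, ℕ → K p),
      (∀ v ∈ S, (∃ i, ∀ p ∈ D, v p = x i p) ∨ ∃ k < r, ∀ p ∈ D, v p = reg p k) →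
      (∀ p k, r ≤ k → reg p k = 0) →
      ∃ T : CompTree F ι κ, (T.cost : ℝ) ≤ c ∧
        ∀ p ∈ D, T.runFrom (fun i => x i p) (reg p) = some fun k => y k p := by
  classical
  have operand : ∀ {D : Set I} {S : Set (∀ p, K p)} {v : ∀ p, K p} {r : ℕ} {reg : ∀ p, ℕ → K p},
      (∀ v ∈ S, (∃ i, ∀ p ∈ D, v p = x i p) ∨ ∃ k < r, ∀ p ∈ D, v p = reg p k) →
      (∀ p k, r ≤ k → reg p k = 0) → Avail D S v →
      ∃ o : ι ⊕ ℕ, ∀ p ∈ D, Sum.elim (fun i => x i p) (reg p) o = v p := by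
    intro D S v r reg hS h0 hv
    rcases hv with hv | ⟨w, hw, hv⟩
    -- a zero is read from register `r`, which has not been written yet
    · exact ⟨Sum.inr r, fun p hp => by simp [hv p hp, h0]⟩
    · rcases hS w hw with ⟨i, hi⟩ | ⟨k, _, hk⟩
      · exact ⟨Sum.inl i, fun p hp => by simp [← hv p hp, hi p hp]⟩
      · exact ⟨Sum.inr k, fun p hp => by simp [← hv p hp, hk p hp]⟩
  have upd : ∀ {D : Set I} {S : Set (∀ p, K p)} (v : ∀ p, K p) {r : ℕ} {reg : ∀ p, ℕ → K p},
      (∀ v ∈ S, (∃ i, ∀ p ∈ D, v p = x i p) ∨ ∃ k < r, ∀ p ∈ D, v p = reg p k) →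
      (∀ p k, r ≤ k → reg p k = 0) →
      (∀ w ∈ insert v S, (∃ i, ∀ p ∈ D, w p = x i p) ∨
        ∃ k < r + 1, ∀ p ∈ D, w p = Function.update (reg p) r (v p) k) ∧
      (∀ p k, r + 1 ≤ k → Function.update (reg p) r (v p) k = 0) := by
    intro D S v r reg hS h0
    refine ⟨fun w hw => ?_, fun p k hk => ?_⟩
    · rcases Set.mem_insert_iff.1 hw with rfl | hw
      · exact Or.inr ⟨r, by omega, fun p _ => by simp⟩
      · rcases hS w hw with h | ⟨k, hk, h⟩
        · exact Or.inl h
        · exact Or.inr ⟨k, by omega, fun p hp => by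
            rw [Function.update_of_ne (by omega), h p hp]⟩
    · rw [Function.update_of_ne (by omega), h0 p k (by omega)]
  induction h with
  | halt hg hc =>
    intro r reg hS h0
    choose o ho using fun k => operand hS h0 (hg k)
    refine ⟨.halt o, by simpa [CompTree.cost] using hc, fun p hp => ?_⟩
    simp only [CompTree.runFrom]
    congr 1
    funext k
    exact ho k p hp
  | const a _ ih =>
    intro r reg hS h0
    obtain ⟨h1, h2⟩ := upd (fun p => algebraMap F (K p) a) hS h0
    obtain ⟨T, hT, hr⟩ := ih (r + 1) _ h1 h2
    refine ⟨.const r a T, by simpa [CompTree.cost] using hT, fun p hp => ?_⟩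
    simpa only [CompTree.runFrom] using hr p hp
  | arith op x' y' v hx hy hv _ ih =>
    intro r reg hS h0
    obtain ⟨ox, hox⟩ := operand hS h0 hx
    obtain ⟨oy, hoy⟩ := operand hS h0 hy
    obtain ⟨h1, h2⟩ := upd v hS h0
    obtain ⟨T, hT, hr⟩ := ih (r + 1) _ h1 h2
    refine ⟨.arith r op ox oy T, by simpa [CompTree.cost] using hT, fun p hp => ?_⟩
    simpa only [CompTree.runFrom, hox p hp, hoy p hp, hv p hp, Option.bind_some] using hr p hp
  | @ifZero D S c x' hx _ _ ih1 ih2 =>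
    intro r reg hS h0
    obtain ⟨o, ho⟩ := operand hS h0 hx
    have hS' : ∀ D' : Set I, D' ⊆ D → ∀ v ∈ S, (∃ i, ∀ p ∈ D', v p = x i p) ∨
        ∃ k < r, ∀ p ∈ D', v p = reg p k := fun D' hD' v hv =>
      (hS v hv).imp (fun ⟨i, h⟩ => ⟨i, fun p hp => h p (hD' hp)⟩)
        (fun ⟨k, hk, h⟩ => ⟨k, hk, fun p hp => h p (hD' hp)⟩)
    obtain ⟨T1, hT1, hr1⟩ := ih1 r reg (hS' _ (Set.sep_subset _ _)) h0
    obtain ⟨T2, hT2, hr2⟩ := ih2 r reg (hS' _ (Set.sep_subset _ _)) h0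
    refine ⟨.ifZero o T1 T2, ?_, fun p hp => ?_⟩
    · simp only [CompTree.cost, Nat.cast_add, Nat.cast_max, Nat.cast_one]
      gcongr
      exact max_le hT1 hT2
    · simp only [CompTree.runFrom, ho p hp]
      split_ifs with h
      · exact hr1 p ⟨hp, h⟩
      · exact hr2 p ⟨hp, h⟩

theorem exists_tree {ι κ : Type} (x : ι → ∀ p, K p) (y : κ → ∀ p, K p)
    (h : Prog F (fun D S => ∀ k, Avail D S (y k)) D (Set.range x) c) :
    ∃ T : CompTree F ι κ, (T.cost : ℝ) ≤ c ∧
      ∀ p ∈ D, T.run (fun i => x i p) = some fun k => y k p := by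
  refine exists_tree_runFrom x y h 0 (fun _ _ => 0) ?_ fun _ _ _ => rfl
  rintro v ⟨i, rfl⟩
  exact Or.inl ⟨i, fun _ _ => rfl⟩

/-- A computation tree can be run as a program. -/
theorem of_tree_runFrom {ι κ : Type} (x : ι → ∀ p, K p) (y : κ → ∀ p, K p) (T : CompTree F ι κ) :
    ∀ (D : Set I) (S : Set (∀ p, K p)) (reg : ℕ → ∀ p, K p), (∀ i, Avail D S (x i)) →
      (∀ k, Avail D S (reg k)) →
      (∀ p ∈ D, T.runFrom (fun i => x i p) (fun k => reg k p) = some fun k => y k p) →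
      Prog F (fun D S => ∀ k, Avail D S (y k)) D S T.cost := by
  classical
  have operand : ∀ {D : Set I} {S : Set (∀ p, K p)} {reg : ℕ → ∀ p, K p},
      (∀ i, Avail D S (x i)) → (∀ k, Avail D S (reg k)) → ∀ o : ι ⊕ ℕ,
      Avail D S fun p => Sum.elim (fun i => x i p) (fun k => reg k p) o := by
    intro D S reg hx hreg o
    cases o with
    | inl i => exact hx i
    | inr k => exact hreg k
  induction T with
  | halt out =>
    intro D S reg hx hreg hr
    refine .halt (fun k => (operand hx hreg (out k)).congr fun p hp => ?_) (by simp)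
    have := hr p hp
    simp only [CompTree.runFrom, Option.some.injEq] at this
    exact congrFun this k
  | const dst a next ih =>
    intro D S reg hx hreg hr
    simp only [CompTree.cost, Nat.cast_add, Nat.cast_one]
    refine .const a (ih D _ (Function.update reg dst fun p => algebraMap F (K p) a)
      (fun i => (hx i).mono subset_rfl (Set.subset_insert _ _)) (fun k => ?_) fun p hp => ?_)
    · by_cases hk : k = dst
      · subst hk
        simpa using Avail.of_mem (Set.mem_insert _ _)
      · simpa [hk] using (hreg k).mono subset_rfl (Set.subset_insert _ _)
    · rw [← hr p hp]
      simp only [CompTree.runFrom]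
      congr 1
      funext k
      by_cases hk : k = dst
      · subst hk; simp
      · simp [hk]
  | arith dst op a b next ih =>
    intro D S reg hx hreg hr
    simp only [CompTree.cost, Nat.cast_add, Nat.cast_one]
    have hv : ∀ p : D, ∃ v, op.eval (Sum.elim (fun i => x i p) (fun k => reg k p) a)
        (Sum.elim (fun i => x i p) (fun k => reg k p) b) = some v := by
      rintro ⟨p, hp⟩
      have := hr p hp
      simp only [CompTree.runFrom] at this
      obtain ⟨v, hv, -⟩ := Option.bind_eq_some_iff.1 this
      exact ⟨v, hv⟩
    choose v hv using hv
    set w : ∀ p, K p := fun p => if h : p ∈ D then v ⟨p, h⟩ else 0 with hw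
    have hwv : ∀ p (hp : p ∈ D), op.eval (Sum.elim (fun i => x i p) (fun k => reg k p) a)
        (Sum.elim (fun i => x i p) (fun k => reg k p) b) = some (w p) := by
      intro p hp
      rw [hv ⟨p, hp⟩, hw]
      simp [hp]
    refine .arith op _ _ w (operand hx hreg a) (operand hx hreg b) hwv
      (ih D _ (Function.update reg dst w)
      (fun i => (hx i).mono subset_rfl (Set.subset_insert _ _)) (fun k => ?_) fun p hp => ?_)
    · by_cases hk : k = dst
      · subst hk
        simpa using Avail.of_mem (Set.mem_insert _ _)
      · simpa [hk] using (hreg k).mono subset_rfl (Set.subset_insert _ _)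
    · rw [← hr p hp]
      simp only [CompTree.runFrom, hwv p hp, Option.bind_some]
      congr 1
      funext k
      by_cases hk : k = dst
      · subst hk; simp
      · simp [hk]
  | ifZero a yes no ih1 ih2 =>
    intro D S reg hx hreg hr
    have hsub : ∀ q : I → Prop, {p ∈ D | q p} ⊆ D := fun q => Set.sep_subset _ _
    have hr' := hr
    simp only [CompTree.runFrom] at hr'
    simp only [CompTree.cost, Nat.cast_add, Nat.cast_one]
    refine .ifZero _ (operand hx hreg a) ?_ ?_
    · refine (ih1 _ S reg (fun i => (hx i).mono (hsub _) subset_rfl)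
        (fun k => (hreg k).mono (hsub _) subset_rfl) fun p hp => ?_).mono
        (by simp)
      have := hr' p hp.1
      rwa [if_pos hp.2] at this
    · refine (ih2 _ S reg (fun i => (hx i).mono (hsub _) subset_rfl)
        (fun k => (hreg k).mono (hsub _) subset_rfl) fun p hp => ?_).mono
        (by simp)
      have := hr' p hp.1
      rwa [if_neg hp.2] at this

theorem of_tree {ι κ : Type} (x : ι → ∀ p, K p) (y : κ → ∀ p, K p) (T : CompTree F ι κ)
    (hx : ∀ i, Avail D S (x i)) (hT : ∀ p ∈ D, T.run (fun i => x i p) = some fun k => y k p) :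
    Prog F (fun D S => ∀ k, Avail D S (y k)) D S T.cost :=
  of_tree_runFrom x y T D S (fun _ _ => 0) hx (fun _ => Avail.zero) hT

end Prog

end

/-! ### The cost of matrix products -/

section Matrices

variable {F : Type u} [Field F] {I : Type v} {K : I → Type u} [∀ p, Field (K p)]
  [∀ p, Algebra F (K p)]

/-- All entries of a matrix of values are available. -/
def AvailM {ι₁ ι₂ : Type} (D : Set I) (S : Set (∀ p, K p)) (A : ∀ p, Matrix ι₁ ι₂ (K p)) : Prop :=
  ∀ i j, Avail D S fun p => A p i j

theorem AvailM.mono {ι₁ ι₂ : Type} {D D' : Set I} {S S' : Set (∀ p, K p)}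
    {A : ∀ p, Matrix ι₁ ι₂ (K p)} (h : AvailM D S A) (hD : D' ⊆ D) (hS : S ⊆ S') :
    AvailM D' S' A :=
  fun i j => (h i j).mono hD hS

theorem AvailM.congr {ι₁ ι₂ : Type} {D : Set I} {S : Set (∀ p, K p)}
    {A B : ∀ p, Matrix ι₁ ι₂ (K p)} (h : AvailM D S A) (hAB : ∀ p ∈ D, A p = B p) :
    AvailM D S B :=
  fun i j => (h i j).congr fun p hp => by rw [hAB p hp]

theorem AvailM.submatrix {ι₁ ι₂ κ₁ κ₂ : Type} {D : Set I} {S : Set (∀ p, K p)}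
    {A : ∀ p, Matrix ι₁ ι₂ (K p)} (h : AvailM D S A) (f : κ₁ → ι₁) (g : κ₂ → ι₂) :
    AvailM D S fun p => (A p).submatrix f g :=
  fun i j => h (f i) (g j)

theorem AvailM.transpose {ι₁ ι₂ : Type} {D : Set I} {S : Set (∀ p, K p)}
    {A : ∀ p, Matrix ι₁ ι₂ (K p)} (h : AvailM D S A) : AvailM D S fun p => (A p).transpose :=
  fun i j => h j i

theorem AvailM.fromBlocks_zero {ι₁ ι₂ κ₁ κ₂ : Type} {D : Set I} {S : Set (∀ p, K p)}
    {A : ∀ p, Matrix ι₁ ι₂ (K p)} (h : AvailM D S A) :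
    AvailM D S fun p => (Matrix.fromBlocks (A p) 0 0 0 : Matrix (ι₁ ⊕ κ₁) (ι₂ ⊕ κ₂) (K p)) := by
  rintro (i | i) (j | j)
  · exact h i j
  all_goals exact Avail.zero

namespace Prog

variable {D : Set I} {S : Set (∀ p, K p)}

theorem availM_family {ι₁ ι₂ : Type} [Fintype ι₁] [Fintype ι₂] (A : ∀ p, Matrix ι₁ ι₂ (K p))
    {c : ℝ} (h : ∀ i j D' S', D' ⊆ D → S ⊆ S' →
      Prog F (fun D S => Avail D S fun p => A p i j) D' S' c) :
    Prog F (fun D S => AvailM D S A) D S (Fintype.card ι₁ * Fintype.card ι₂ * c) := by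
  refine (avail_family (F := F) (fun (q : ι₁ × ι₂) p => A p q.1 q.2)
    fun q => h q.1 q.2).imp (le_of_eq ?_) fun _ _ _ _ h i j => h (i, j)
  rw [Fintype.card_prod]; push_cast; rfl

theorem subM {ι₁ ι₂ : Type} [Fintype ι₁] [Fintype ι₂] {A B : ∀ p, Matrix ι₁ ι₂ (K p)}
    (hA : AvailM D S A) (hB : AvailM D S B) :
    Prog F (fun D S => AvailM D S fun p => A p - B p) D S
      (Fintype.card ι₁ * Fintype.card ι₂) := by
  have := availM_family (F := F) (fun p => A p - B p) (D := D) (S := S) (c := 1)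
    fun i j D' S' hD hS => sub_avail ((hA i j).mono hD hS) ((hB i j).mono hD hS)
  rwa [mul_one] at this

end Prog

end Matrices

/-- Matrices of formats at most `a × b` and `b × c` can be multiplied in `κ` steps, within any
program. -/
def MulCost (F : Type u) [Field F] (a b c : ℕ) (κ : ℝ) : Prop :=
  ∀ (I : Type (u + 1)) (K : I → Type u) [∀ p, Field (K p)] [∀ p, Algebra F (K p)]
    (D : Set I) (S : Set (∀ p, K p)) (ι₁ ι₂ ι₃ : Type) [Fintype ι₁] [Fintype ι₂] [Fintype ι₃]
    (A : ∀ p, Matrix ι₁ ι₂ (K p)) (B : ∀ p, Matrix ι₂ ι₃ (K p)),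
    Fintype.card ι₁ ≤ a → Fintype.card ι₂ ≤ b → Fintype.card ι₃ ≤ c →
    AvailM D S A → AvailM D S B → Prog F (fun D S => AvailM D S fun p => A p * B p) D S κ

theorem exists_fiber_card_le {ι : Type} [Fintype ι] {g b : ℕ} (h : Fintype.card ι ≤ g * b) :
    ∃ f : ι → Fin g, ∀ t, Fintype.card {i // f i = t} ≤ b := by
  classical
  have hlt : ∀ i : ι, (Fintype.equivFin ι i : ℕ) / b < g := fun i =>
    Nat.div_lt_of_lt_mul (by rw [mul_comm]; exact (Fintype.equivFin ι i).2.trans_le h)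
  refine ⟨fun i => ⟨_, hlt i⟩, fun t => ?_⟩
  rcases Nat.eq_zero_or_pos b with rfl | hb
  · have : IsEmpty ι := Fintype.card_eq_zero_iff.1 (by omega)
    simp
  have := Fintype.card_le_of_injective
    (fun i : {i // (⟨_, hlt i⟩ : Fin g) = t} =>
      (⟨(Fintype.equivFin ι i.1 : ℕ) % b, Nat.mod_lt _ hb⟩ : Fin b)) ?_
  · simpa using this
  · rintro ⟨i, hi⟩ ⟨j, hj⟩ hij
    have h1 : (Fintype.equivFin ι i : ℕ) / b = (Fintype.equivFin ι j : ℕ) / b :=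
      congrArg Fin.val (hi.trans hj.symm)
    have h2 : (Fintype.equivFin ι i : ℕ) % b = (Fintype.equivFin ι j : ℕ) % b := by
      simpa using hij
    have h3 : (Fintype.equivFin ι i : ℕ) = Fintype.equivFin ι j := by
      rw [← Nat.div_add_mod (Fintype.equivFin ι i : ℕ) b, h1, h2, Nat.div_add_mod]
    exact Subtype.ext ((Fintype.equivFin ι).injective (Fin.ext h3))

namespace MulCost

variable {F : Type u} [Field F] {a b c : ℕ} {κ : ℝ}

theorem mono (h : MulCost F a b c κ) {a' b' c' : ℕ} {κ' : ℝ} (ha : a' ≤ a) (hb : b' ≤ b)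
    (hc : c' ≤ c) (hκ : κ ≤ κ') : MulCost F a' b' c' κ' :=
  fun I K _ _ D S _ _ _ _ _ _ A B h1 h2 h3 hA hB =>
    (h I K D S _ _ _ A B (h1.trans ha) (h2.trans hb) (h3.trans hc) hA hB).mono hκ

theorem of_tree {T : CompTree F ((Fin a × Fin b) ⊕ (Fin b × Fin c)) (Fin a × Fin c)}
    (hT : MultipliesMatrices F a b c T) : MulCost F a b c T.cost := by
  intro I K _ _ D S ι₁ ι₂ ι₃ _ _ _ A B h1 h2 h3 hA hB
  have key : ∀ {ι : Type} [Fintype ι] {n : ℕ}, Fintype.card ι ≤ n →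
      Nonempty (Fin n ≃ ι ⊕ Fin (n - Fintype.card ι)) := fun {ι} _ {n} h =>
    ⟨Fintype.equivOfCardEq (by simp; omega)⟩
  obtain ⟨e1⟩ := key h1
  obtain ⟨e2⟩ := key h2
  obtain ⟨e3⟩ := key h3
  have hA' := (hA.fromBlocks_zero (κ₁ := Fin (a - Fintype.card ι₁))
    (κ₂ := Fin (b - Fintype.card ι₂))).submatrix e1 e2
  have hB' := (hB.fromBlocks_zero (κ₁ := Fin (b - Fintype.card ι₂))
    (κ₂ := Fin (c - Fintype.card ι₃))).submatrix e2 e3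
  let A' : ∀ p, Matrix (Fin a) (Fin b) (K p) := fun p =>
    (Matrix.fromBlocks (A p) 0 0 0).submatrix e1 e2
  let B' : ∀ p, Matrix (Fin b) (Fin c) (K p) := fun p =>
    (Matrix.fromBlocks (B p) 0 0 0).submatrix e2 e3
  refine (Prog.of_tree (F := F) (Sum.elim (fun q p => A' p q.1 q.2) (fun q p => B' p q.1 q.2))
    (fun q p => (A' p * B' p) q.1 q.2) T ?_ fun p _ => ?_).imp le_rfl ?_
  · rintro (⟨i, j⟩ | ⟨i, j⟩)
    · exact hA' i j
    · exact hB' i j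
  · rw [← hT (K p)]
    congr 1
    funext q
    rcases q with q | q <;> rfl
  · intro D' S' _ _ h i j
    refine (h (e1.symm (Sum.inl i), e3.symm (Sum.inl j))).congr fun p _ => ?_
    simp [A', B', Matrix.submatrix_mul_equiv, Matrix.fromBlocks_multiply]

/-- Inputs of a matrix product over an extension field. -/
structure Point (F : Type u) [Field F] (a b c : ℕ) where
  /-- The extension field. -/
  K : Type u
  [field : Field K]
  [algebra : Algebra F K]
  /-- The left factor. -/
  A : Matrix (Fin a) (Fin b) K
  /-- The right factor. -/
  B : Matrix (Fin b) (Fin c) K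

attribute [instance] Point.field Point.algebra

theorem exists_tree (h : MulCost F a b c κ) :
    ∃ T : CompTree F ((Fin a × Fin b) ⊕ (Fin b × Fin c)) (Fin a × Fin c),
      MultipliesMatrices F a b c T ∧ (T.cost : ℝ) ≤ κ := by
  let x : (Fin a × Fin b) ⊕ (Fin b × Fin c) → ∀ p : Point F a b c, p.K :=
    Sum.elim (fun q p => p.A q.1 q.2) (fun q p => p.B q.1 q.2)
  have := h (Point F a b c) (fun p => p.K) Set.univ (Set.range x) (Fin a) (Fin b) (Fin c)
    (fun p => p.A) (fun p => p.B) (by simp) (by simp) (by simp)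
    (fun i j => Avail.of_mem ⟨Sum.inl (i, j), rfl⟩) (fun i j => Avail.of_mem ⟨Sum.inr (i, j), rfl⟩)
  obtain ⟨T, hT, hr⟩ := Prog.exists_tree x (fun (q : Fin a × Fin c) p => (p.A * p.B) q.1 q.2)
    (this.imp le_rfl fun _ _ _ _ h q => h q.1 q.2)
  refine ⟨T, fun K _ _ A B => ?_, hT⟩
  rw [← hr ⟨K, A, B⟩ (Set.mem_univ _)]
  congr 1
  funext q
  rcases q with q | q <;> rfl

theorem naive (a b c : ℕ) : MulCost F a b c (a * c * (2 * b)) := by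
  intro I K _ _ D S ι₁ ι₂ ι₃ _ _ _ A B h1 h2 h3 hA hB
  refine (Prog.availM_family (F := F) (fun p => A p * B p) (c := 2 * b)
    fun i j D' S' hD hS => ?_).mono (by gcongr)
  refine (Prog.avail_family (F := F) (fun k p => A p i k * B p k j) fun k D'' S'' hD' hS' =>
    Prog.mul_avail ((hA i k).mono (hD'.trans hD) (hS.trans hS'))
      ((hB k j).mono (hD'.trans hD) (hS.trans hS'))).seq (c' := b) ?_ ?_
  · have : (Fintype.card ι₂ : ℝ) ≤ b := by exact_mod_cast h2
    linarith
  · intro D'' S'' _ _ h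
    have := Prog.sum_avail (F := F) Finset.univ (fun k p => A p i k * B p k j) fun k _ => h k
    refine this.imp (by simpa using h2) fun _ _ _ _ h => ?_
    simpa [Matrix.mul_apply] using h

/-- Cutting the inner index set into `g` parts. -/
theorem inner (h : MulCost F a b c κ) (g : ℕ) : MulCost F a (g * b) c (g * (κ + a * c)) := by
  classical
  intro I K _ _ D S ι₁ ι₂ ι₃ _ _ _ A B h1 h2 h3 hA hB
  obtain ⟨f, hf⟩ := exists_fiber_card_le h2
  let C : Fin g → ∀ p, Matrix ι₁ ι₃ (K p) := fun t p =>
    (A p).submatrix id (Subtype.val : {k // f k = t} → ι₂) *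
      (B p).submatrix (Subtype.val : {k // f k = t} → ι₂) id
  refine (Prog.of_forall (F := F) (fun t D S => AvailM D S (C t))
    (fun _ _ _ _ _ h hD hS => h.mono hD hS) (c := κ) fun t D' S' hD hS =>
      h I K D' S' _ _ _ _ _ h1 (hf t) h3
        ((hA.mono hD hS).submatrix _ _) ((hB.mono hD hS).submatrix _ _)).seq
        (c' := a * c * g) (by simp; linarith) ?_
  intro D' S' hD hS hC
  refine (Prog.availM_family (F := F) (fun p => A p * B p) (c := g)
    fun i j D' S' hD hS => ?_).mono (by gcongr)
  have := Prog.sum_avail (F := F) Finset.univ (fun t p => C t p i j)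
    fun t _ => (hC t i j).mono hD hS
  refine this.imp (by simp) fun _ _ _ _ h => h.congr fun p _ => ?_
  simp only [C, Matrix.mul_apply, Matrix.submatrix_apply, id]
  rw [← (Equiv.sigmaFiberEquiv f).sum_comp, Fintype.sum_sigma]
  rfl

/-- Cutting the set of rows of the left factor into `g` parts. -/
theorem rows (h : MulCost F a b c κ) (g : ℕ) : MulCost F (g * a) b c (g * κ) := by
  classical
  intro I K _ _ D S ι₁ ι₂ ι₃ _ _ _ A B h1 h2 h3 hA hB
  obtain ⟨f, hf⟩ := exists_fiber_card_le h1
  refine (Prog.of_forall (F := F) (fun t D S => AvailM D S fun p =>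
    (A p).submatrix (Subtype.val : {k // f k = t} → ι₁) id * B p)
    (fun _ _ _ _ _ h hD hS => h.mono hD hS) (c := κ) fun t D' S' hD hS =>
      h I K D' S' _ _ _ _ _ (hf t) h2 h3
        ((hA.mono hD hS).submatrix _ _) (hB.mono hD hS)).imp (by simp) ?_
  exact fun D' S' _ _ h i j => h (f i) ⟨i, rfl⟩ j

theorem transpose (h : MulCost F a b c κ) : MulCost F c b a κ := by
  intro I K _ _ D S ι₁ ι₂ ι₃ _ _ _ A B h1 h2 h3 hA hB
  refine (h I K D S _ _ _ _ _ h3 h2 h1 hB.transpose hA.transpose).imp le_rfl ?_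
  intro D' S' _ _ h
  simpa [← Matrix.transpose_mul] using h.transpose

/-- Cutting the set of columns of the right factor into `g` parts. -/
theorem cols (h : MulCost F a b c κ) (g : ℕ) : MulCost F a b (g * c) (g * κ) :=
  (h.transpose.rows g).transpose

theorem nonneg (h : MulCost F a b c κ) : 0 ≤ κ := by
  obtain ⟨T, -, hT⟩ := h.exists_tree
  exact (Nat.cast_nonneg _).trans hT

end MulCost

/-! ### Exponents of rectangular matrix multiplication -/

section

section LowerBound

variable {F : Type u} [Field F]

/-- On one run, every output is an input, an initial content of a register, or one of at most
`T.cost` computed values. -/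
theorem exists_values_card_le_cost {ι κ : Type} {K : Type*} [Field K] [Algebra F K] (inp : ι → K)
    (T : CompTree F ι κ) : ∀ (reg : ℕ → K) (out : κ → K), T.runFrom inp reg = some out →
      ∃ W : Finset K, W.card ≤ T.cost ∧
        ∀ k, (∃ i, out k = inp i) ∨ (∃ r, out k = reg r) ∨ out k ∈ W := by
  classical
  have step : ∀ {n : ℕ} {reg : ℕ → K} {out : κ → K} {dst : ℕ} {v : K},
      (∃ W : Finset K, W.card ≤ n ∧ ∀ k, (∃ i, out k = inp i) ∨
        (∃ r, out k = Function.update reg dst v r) ∨ out k ∈ W) →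
      ∃ W : Finset K, W.card ≤ n + 1 ∧
        ∀ k, (∃ i, out k = inp i) ∨ (∃ r, out k = reg r) ∨ out k ∈ W := by
    rintro n reg out dst v ⟨W, hW, h⟩
    refine ⟨insert v W, (Finset.card_insert_le _ _).trans (by omega), fun k => ?_⟩
    rcases h k with h | ⟨r, hr⟩ | h
    · exact Or.inl h
    · by_cases hrd : r = dst
      · subst hrd
        exact Or.inr (Or.inr (by simp [hr]))
      · exact Or.inr (Or.inl ⟨r, by simpa [hrd] using hr⟩)
    · exact Or.inr (Or.inr (Finset.mem_insert_of_mem h))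
  induction T with
  | halt o =>
    intro reg out h
    refine ⟨∅, by simp, fun k => ?_⟩
    simp only [CompTree.runFrom, Option.some.injEq] at h
    have hk := congrFun h k
    cases ho : o k with
    | inl i => exact Or.inl ⟨i, by simpa [ho] using hk.symm⟩
    | inr r => exact Or.inr (Or.inl ⟨r, by simpa [ho] using hk.symm⟩)
  | const dst a next ih =>
    intro reg out h
    exact step (ih _ _ h)
  | arith dst op a b next ih =>
    intro reg out h
    obtain ⟨v, -, h⟩ := Option.bind_eq_some_iff.1 h
    exact step (ih _ _ h)
  | ifZero a yes no ih1 ih2 =>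
    intro reg out h
    simp only [CompTree.runFrom] at h
    simp only [CompTree.cost]
    split_ifs at h
    · obtain ⟨W, hW, h⟩ := ih1 _ _ h
      exact ⟨W, by omega, h⟩
    · obtain ⟨W, hW, h⟩ := ih2 _ _ h
      exact ⟨W, by omega, h⟩

/-- A product of an `n × b` by a `b × n` matrix takes at least `n ^ 2` steps: over the rational
functions there is one whose `n ^ 2` entries are distinct from each other and from all inputs. -/
theorem sq_le_cost_of_multipliesMatrices {n b : ℕ} (hb : 0 < b)
    {T : CompTree F ((Fin n × Fin b) ⊕ (Fin b × Fin n)) (Fin n × Fin n)}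
    (hT : MultipliesMatrices F n b n T) : n ^ 2 ≤ T.cost := by
  classical
  have hinj : Function.Injective fun e : ℕ => (RatFunc.X : RatFunc F) ^ e := by
    intro a b h
    have h' : algebraMap (Polynomial F) (RatFunc F) (Polynomial.X ^ a) =
        algebraMap (Polynomial F) (RatFunc F) (Polynomial.X ^ b) := by
      simpa [RatFunc.algebraMap_X] using h
    have := congrArg Polynomial.natDegree (RatFunc.algebraMap_injective F h')
    simpa using this
  let N := n ^ 2 + n
  let A : Matrix (Fin n) (Fin b) (RatFunc F) := fun i k =>
    if k = ⟨0, hb⟩ then RatFunc.X ^ (N + i) else 0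
  let B : Matrix (Fin b) (Fin n) (RatFunc F) := fun k j =>
    if k = ⟨0, hb⟩ then RatFunc.X ^ (N + n * j) else 0
  have hAB : ∀ q : Fin n × Fin n, (A * B) q.1 q.2 = RatFunc.X ^ (2 * N + (q.1 + n * q.2)) := by
    intro q
    rw [Matrix.mul_apply, Finset.sum_eq_single ⟨0, hb⟩]
    · simp only [A, B, if_true, ← pow_add]
      congr 1
      omega
    · intro k _ hk
      simp [A, hk]
    · simp
  obtain ⟨W, hW, h⟩ := exists_values_card_le_cost _ T _ _ (hT (RatFunc F) A B)
  have hX0 : ∀ e : ℕ, (RatFunc.X : RatFunc F) ^ e ≠ 0 := fun e => pow_ne_zero _ RatFunc.X_ne_zero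
  have hmem : ∀ q : Fin n × Fin n, (A * B) q.1 q.2 ∈ W := by
    intro q
    have hlt : ∀ j : Fin n, n * (j : ℕ) < n ^ 2 := fun j => by
      rw [pow_two]; exact Nat.mul_lt_mul_of_pos_left j.2 (by have := j.2; omega)
    rcases h q with ⟨i, hi⟩ | ⟨r, hr⟩ | h
    · rw [hAB] at hi
      rcases i with ⟨i, k⟩ | ⟨k, j⟩
      · simp only [Sum.elim_inl, A] at hi
        split_ifs at hi
        · have := hinj hi
          have := i.2
          omega
        · exact absurd hi (hX0 _)
      · simp only [Sum.elim_inr, B] at hi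
        split_ifs at hi
        · have := hinj hi
          have := hlt j
          omega
        · exact absurd hi (hX0 _)
    · rw [hAB] at hr
      exact absurd hr (hX0 _)
    · exact h
  have hcard : Fintype.card (Fin n × Fin n) ≤ W.card := by
    rw [← Fintype.card_coe]
    refine Fintype.card_le_of_injective (fun q => (⟨_, hmem q⟩ : W)) fun q q' hq => ?_
    have hq' : (A * B) q.1 q.2 = (A * B) q'.1 q'.2 := congrArg Subtype.val hq
    rw [hAB, hAB] at hq'
    have h1 : (q.1 : ℕ) + n * q.2 = q'.1 + n * q'.2 := by
      have := hinj hq'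
      simpa using this
    have h2 : (q.1 : ℕ) = q'.1 := by
      have := congrArg (· % n) h1
      simpa [Nat.add_mul_mod_self_left, Nat.mod_eq_of_lt] using this
    have hn : 0 < n := Fin.pos q.1
    have h3 : (q.2 : ℕ) = q'.2 := by
      rw [h2] at h1
      exact Nat.eq_of_mul_eq_mul_left hn (by omega)
    exact Prod.ext (Fin.ext h2) (Fin.ext h3)
  rw [Fintype.card_prod, Fintype.card_fin, ← pow_two] at hcard
  exact hcard.trans hW

end LowerBound

variable (F : Type u) [Field F]

/-- The exponents `τ` such that `n × ⌈n ^ k⌉` by `⌈n ^ k⌉ × n` products take time `O(n ^ τ)`. -/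
def expSet (k : ℝ) : Set ℝ :=
  {τ | ∃ C : ℝ, ∀ n : ℕ, 0 < n → MulCost F n ⌈(n : ℝ) ^ k⌉₊ n (C * (n : ℝ) ^ τ)}

theorem omegaRect_eq (k : ℝ) : omegaRect F k = sInf (expSet F k) := by
  unfold omegaRect expSet
  congr 1
  ext τ
  refine exists_congr fun C => forall_congr' fun n => forall_congr' fun _ => ?_
  exact ⟨fun ⟨T, hT, hc⟩ => (MulCost.of_tree hT).mono le_rfl le_rfl le_rfl hc,
    fun h => h.exists_tree⟩

variable {F}

theorem two_le_of_mem_expSet {k τ : ℝ} (h : τ ∈ expSet F k) : 2 ≤ τ := by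
  obtain ⟨C, hC⟩ := h
  by_contra! hτ
  obtain ⟨x, hx⟩ := ((tendsto_rpow_atTop (sub_pos.2 hτ)).eventually_gt_atTop C).exists_forall_of_atTop
  obtain ⟨n, hn⟩ := exists_nat_ge (max x 1)
  have hn1 : (1 : ℝ) ≤ n := (le_max_right _ _).trans hn
  have hn0 : (0 : ℝ) < n := by linarith
  have hx' := hx n ((le_max_left _ _).trans hn)
  obtain ⟨T, hT, hc⟩ := (hC n (by exact_mod_cast hn0)).exists_tree
  have h1 := sq_le_cost_of_multipliesMatrices
    (Nat.ceil_pos.2 (Real.rpow_pos_of_pos hn0 k)) hT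
  have h2 : (n : ℝ) ^ (2 : ℝ) ≤ C * (n : ℝ) ^ τ := by
    rw [Real.rpow_two]
    exact le_trans (by exact_mod_cast h1) hc
  have h3 : (n : ℝ) ^ (2 : ℝ) = (n : ℝ) ^ (2 - τ) * (n : ℝ) ^ τ := by
    rw [← Real.rpow_add hn0]; congr 1; ring
  rw [h3] at h2
  exact absurd (le_of_mul_le_mul_right h2 (Real.rpow_pos_of_pos hn0 _)) (not_le.2 hx')

theorem bddBelow_expSet (k : ℝ) : BddBelow (expSet F k) :=
  ⟨2, fun _ => two_le_of_mem_expSet⟩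

theorem natCeil_le_two_mul {x : ℝ} (hx : 1 ≤ x) : (⌈x⌉₊ : ℝ) ≤ 2 * x := by
  have := (Nat.ceil_lt_add_one (by linarith : 0 ≤ x)).le
  linarith

theorem two_add_mem_expSet {k : ℝ} (hk : 0 ≤ k) : 2 + k ∈ expSet F k := by
  refine ⟨4, fun n hn => (MulCost.naive n _ n).mono le_rfl le_rfl le_rfl ?_⟩
  have hn1 : (1 : ℝ) ≤ n := by exact_mod_cast hn
  have := natCeil_le_two_mul (Real.one_le_rpow hn1 hk)
  rw [Real.rpow_add (by linarith), Real.rpow_two]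
  nlinarith [sq_nonneg (n : ℝ)]

theorem coeff_nonneg_of_mulCost {k τ C : ℝ}
    (h : ∀ n : ℕ, 0 < n → MulCost F n ⌈(n : ℝ) ^ k⌉₊ n (C * (n : ℝ) ^ τ)) : 0 ≤ C := by
  simpa using (h 1 one_pos).nonneg

theorem mem_expSet_of_le {k τ τ' : ℝ} (h : τ ∈ expSet F k) (hτ : τ ≤ τ') : τ' ∈ expSet F k := by
  obtain ⟨C, hC⟩ := h
  refine ⟨C, fun n hn => (hC n hn).mono le_rfl le_rfl le_rfl ?_⟩
  have hn1 : (1 : ℝ) ≤ n := by exact_mod_cast hn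
  exact mul_le_mul_of_nonneg_left (Real.rpow_le_rpow_of_exponent_le hn1 hτ)
    (coeff_nonneg_of_mulCost hC)

theorem mem_expSet_of_lt {k τ : ℝ} (hk : 0 ≤ k) (h : omegaRect F k < τ) : τ ∈ expSet F k := by
  rw [omegaRect_eq, csInf_lt_iff (bddBelow_expSet k) ⟨_, two_add_mem_expSet hk⟩] at h
  obtain ⟨τ', hτ', hlt⟩ := h
  exact mem_expSet_of_le hτ' hlt.le

theorem omegaRect_le {k τ : ℝ} (h : τ ∈ expSet F k) : omegaRect F k ≤ τ := by
  rw [omegaRect_eq]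
  exact csInf_le (bddBelow_expSet k) h

theorem two_le_omegaRect {k : ℝ} (hk : 0 ≤ k) : 2 ≤ omegaRect F k := by
  rw [omegaRect_eq]
  exact le_csInf ⟨_, two_add_mem_expSet hk⟩ fun _ => two_le_of_mem_expSet

theorem omegaRect_le_two_add {k : ℝ} (hk : 0 ≤ k) : omegaRect F k ≤ 2 + k :=
  omegaRect_le (two_add_mem_expSet hk)

theorem omegaRect_mono {k k' : ℝ} (hk : 0 ≤ k) (h : k ≤ k') :
    omegaRect F k ≤ omegaRect F k' := by
  refine le_of_forall_gt_imp_ge_of_dense fun τ hτ => ?_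
  obtain ⟨C, hC⟩ := mem_expSet_of_lt (hk.trans h) hτ
  refine omegaRect_le ⟨C, fun n hn => (hC n hn).mono le_rfl (Nat.ceil_mono ?_) le_rfl le_rfl⟩
  exact Real.rpow_le_rpow_of_exponent_le (by exact_mod_cast hn) h

/-- Cutting the inner dimension into `n ^ (k' - k)` parts: `ω` is Lipschitz. -/
theorem omegaRect_le_add {k k' : ℝ} (hk : 0 ≤ k) (h : k ≤ k') :
    omegaRect F k' ≤ omegaRect F k + (k' - k) := by
  rw [← sub_le_iff_le_add]
  refine le_of_forall_gt_imp_ge_of_dense fun τ hτ => ?_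
  rw [sub_le_iff_le_add]
  have hmem := mem_expSet_of_lt hk hτ
  have h2 := two_le_of_mem_expSet hmem
  obtain ⟨C, hC⟩ := hmem
  have hC0 := coeff_nonneg_of_mulCost hC
  refine omegaRect_le ⟨2 * (C + 1), fun n hn => ?_⟩
  have hn1 : (1 : ℝ) ≤ n := by exact_mod_cast hn
  have hn0 : (0 : ℝ) < n := by linarith
  refine ((hC n hn).inner ⌈(n : ℝ) ^ (k' - k)⌉₊).mono le_rfl ?_ le_rfl ?_
  · rw [Nat.ceil_le]
    push_cast
    calc (n : ℝ) ^ k' = (n : ℝ) ^ (k' - k) * (n : ℝ) ^ k := by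
          rw [← Real.rpow_add hn0]; congr 1; ring
      _ ≤ _ := mul_le_mul (Nat.le_ceil _) (Nat.le_ceil _) (by positivity) (by positivity)
  · have h3 : (n : ℝ) * n ≤ (n : ℝ) ^ τ := by
      rw [← pow_two, ← Real.rpow_two]
      exact Real.rpow_le_rpow_of_exponent_le hn1 h2
    calc (⌈(n : ℝ) ^ (k' - k)⌉₊ : ℝ) * (C * (n : ℝ) ^ τ + n * n)
        ≤ (2 * (n : ℝ) ^ (k' - k)) * (C * (n : ℝ) ^ τ + (n : ℝ) ^ τ) := by
          gcongr
          exact natCeil_le_two_mul (Real.one_le_rpow hn1 (by linarith))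
      _ = 2 * (C + 1) * (n : ℝ) ^ (τ + (k' - k)) := by
          rw [Real.rpow_add hn0]; ring

/-! #### The exponent `ω_s` -/

theorem logb_mem_Icc {n s : ℕ} (hs : 1 ≤ s) (hsn : s ≤ n) :
    0 ≤ Real.logb n s ∧ Real.logb n s ≤ 1 := by
  have hs' : (1 : ℝ) ≤ s := by exact_mod_cast hs
  have hsn' : (s : ℝ) ≤ n := by exact_mod_cast hsn
  rw [Real.logb]
  have h0 := Real.log_nonneg hs'
  have h1 := Real.log_le_log (by linarith) hsn'
  exact ⟨div_nonneg h0 (h0.trans h1), div_le_one_of_le₀ h1 (h0.trans h1)⟩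

theorem logb_mul_log {n s : ℕ} (hs : 1 ≤ s) (hsn : s ≤ n) :
    Real.logb n s * Real.log n = Real.log s := by
  rcases Nat.lt_or_ge 1 n with hn | hn
  · have : Real.log n ≠ 0 := (Real.log_pos (by exact_mod_cast hn)).ne'
    rw [Real.logb, div_mul_cancel₀ _ this]
  · obtain rfl : n = 1 := by omega
    obtain rfl : s = 1 := by omega
    simp

theorem rpow_logb_eq {n s : ℕ} (hs : 1 ≤ s) (hsn : s ≤ n) : (n : ℝ) ^ Real.logb n s = s := by
  have hn : (0 : ℝ) < n := by exact_mod_cast hs.trans hsn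
  rw [Real.rpow_def_of_pos hn, mul_comm, logb_mul_log hs hsn,
    Real.exp_log (by exact_mod_cast hs)]

theorem two_le_omegaSub {n s : ℕ} (hs : 1 ≤ s) (hsn : s ≤ n) : 2 ≤ omegaSub F n s :=
  two_le_omegaRect (logb_mem_Icc hs hsn).1

theorem omegaSub_le_three {n s : ℕ} (hs : 1 ≤ s) (hsn : s ≤ n) : omegaSub F n s ≤ 3 := by
  have := logb_mem_Icc hs hsn
  exact (omegaRect_le_two_add this.1).trans (by linarith)

theorem two_le_omega : 2 ≤ omega F := two_le_omegaRect zero_le_one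

theorem omega_le_three : omega F ≤ 3 := (omegaRect_le_two_add zero_le_one).trans (by norm_num)

/-- `n × s` by `s × n` products in time `n ^ (ω_s + ε)`, with a constant that does not depend
on `s`. By monotonicity and the Lipschitz property of `ω` it suffices to treat the finitely many
exponents `i / L`. -/
theorem exists_mulCost_omegaSub {ε : ℝ} (hε : 0 < ε) : ∃ C : ℝ, 1 ≤ C ∧ ∀ n s : ℕ, 1 ≤ s → s ≤ n →
    MulCost F n s n (C * (n : ℝ) ^ (omegaSub F n s + ε)) := by
  obtain ⟨L, hL⟩ := exists_nat_gt (2 / ε)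
  have hL0 : (0 : ℝ) < L := lt_trans (by positivity) hL
  have hmem : ∀ i : ℕ, omegaRect F (i / L) + ε / 2 ∈ expSet F (i / L) := fun i =>
    mem_expSet_of_lt (by positivity) (by linarith)
  choose C hC using hmem
  have hC0 := fun i => coeff_nonneg_of_mulCost (hC i)
  refine ⟨1 + ∑ i ∈ Finset.range (L + 1), C i,
    by linarith [Finset.sum_nonneg fun i (_ : i ∈ Finset.range (L + 1)) => hC0 i],
    fun n s hs hsn => ?_⟩
  have hn1 : (1 : ℝ) ≤ n := by exact_mod_cast hs.trans hsn
  obtain ⟨hk0, hk1⟩ := logb_mem_Icc hs hsn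
  set k := Real.logb n s with hk
  set i := ⌈k * L⌉₊ with hi
  have hiL : i ≤ L := Nat.ceil_le.2 (by nlinarith)
  have hki : k ≤ i / L := by
    rw [le_div_iff₀ hL0]; exact Nat.le_ceil _
  have hik : (i : ℝ) / L ≤ k + ε / 2 := by
    rw [div_le_iff₀ hL0]
    have h1 := (Nat.ceil_lt_add_one (by positivity : 0 ≤ k * L)).le
    have h2 : 1 ≤ ε / 2 * L := by
      rw [div_lt_iff₀ hε] at hL; linarith
    rw [← hi] at h1
    linarith
  refine (hC i n (hs.trans hsn)).mono le_rfl ?_ le_rfl ?_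
  · have h1 : (s : ℝ) ≤ ⌈(n : ℝ) ^ ((i : ℝ) / L)⌉₊ := by
      refine le_trans ?_ (Nat.le_ceil _)
      calc (s : ℝ) = (n : ℝ) ^ k := (rpow_logb_eq hs hsn).symm
        _ ≤ _ := Real.rpow_le_rpow_of_exponent_le hn1 hki
    exact_mod_cast h1
  · refine mul_le_mul ?_ (Real.rpow_le_rpow_of_exponent_le hn1 ?_) (by positivity)
      (by linarith [Finset.sum_nonneg fun i (_ : i ∈ Finset.range (L + 1)) => hC0 i])
    · have := Finset.single_le_sum (fun i _ => hC0 i) (Finset.mem_range.2 (Nat.lt_succ_of_le hiL))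
      linarith
    · have := omegaRect_le_add (F := F) hk0 hki
      change _ ≤ omegaRect F k + ε
      linarith

/-- `(d * s) ^ (ω_s + ε) / d` is nondecreasing in the number `d` of blocks. -/
theorem rpow_omegaSub_mul_le {ε : ℝ} (hε : 0 ≤ ε) {s d d' : ℕ} (hs : 1 ≤ s) (hd : 1 ≤ d)
    (hdd' : d ≤ d') :
    ((d * s : ℕ) : ℝ) ^ (omegaSub F (d * s) s + ε) * d' ≤
      ((d' * s : ℕ) : ℝ) ^ (omegaSub F (d' * s) s + ε) * d := by
  have hsn : s ≤ d * s := Nat.le_mul_of_pos_left s hd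
  have hsn' : s ≤ d' * s := hsn.trans (Nat.mul_le_mul_right s hdd')
  have hs0 : (0 : ℝ) < s := by exact_mod_cast hs
  have hn0 : (0 : ℝ) < (d * s : ℕ) := by exact_mod_cast hs.trans hsn
  have hn0' : (0 : ℝ) < (d' * s : ℕ) := by exact_mod_cast hs.trans hsn'
  suffices h : ((d * s : ℕ) : ℝ) ^ (omegaSub F (d * s) s + ε) * (d' * s : ℕ) ≤
      ((d' * s : ℕ) : ℝ) ^ (omegaSub F (d' * s) s + ε) * (d * s : ℕ) by
    push_cast at h ⊢
    refine le_of_mul_le_mul_right ?_ hs0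
    linarith
  have hk := logb_mem_Icc hs hsn
  have hk' := logb_mem_Icc hs hsn'
  have e1 := logb_mul_log hs hsn
  have e2 := logb_mul_log hs hsn'
  have hL0 : 0 ≤ Real.log (d * s : ℕ) := Real.log_natCast_nonneg _
  have hLL : Real.log (d * s : ℕ) ≤ Real.log (d' * s : ℕ) :=
    Real.log_le_log hn0 (by exact_mod_cast Nat.mul_le_mul_right s hdd')
  have hw' := two_le_omegaSub (F := F) hs hsn'
  have key : omegaSub F (d * s) s * Real.log (d * s : ℕ) ≤
      omegaSub F (d' * s) s * Real.log (d * s : ℕ) +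
        Real.logb (d' * s : ℕ) s * (Real.log (d' * s : ℕ) - Real.log (d * s : ℕ)) := by
    rcases hL0.eq_or_lt with h0 | h0
    · rw [← h0]
      simp only [mul_zero, zero_add, sub_zero]
      exact mul_nonneg hk'.1 (h0.trans_le hLL)
    · have hkk : Real.logb (d' * s : ℕ) s ≤ Real.logb (d * s : ℕ) s := by
        rw [Real.logb, Real.logb]
        exact div_le_div_of_nonneg_left (Real.log_natCast_nonneg _) h0 hLL
      have := omegaRect_le_add (F := F) hk'.1 hkk
      have h1 := mul_le_mul_of_nonneg_right this hL0
      unfold omegaSub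
      nlinarith
  have hexp : ∀ {x y : ℝ} (t : ℝ), 0 < x → 0 < y →
      x ^ t * y = Real.exp (Real.log x * t + Real.log y) := fun t hx hy => by
    rw [Real.exp_add, Real.exp_log hy, Real.rpow_def_of_pos hx]
  rw [hexp _ hn0 hn0', hexp _ hn0' hn0, Real.exp_le_exp]
  nlinarith [mul_nonneg (sub_nonneg.2 hLL) (by linarith [hk'.2] :
    0 ≤ omegaSub F (d' * s) s - Real.logb (d' * s : ℕ) s - 1 + ε)]

/-- Doubling the number of blocks costs a constant factor: for fixed `s`, the exponent `ω_s` does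
not increase with `n`. -/
theorem rpow_omegaSub_two_mul_le {ε : ℝ} {s d : ℕ} (hs : 1 ≤ s) (hd : 1 ≤ d) :
    ((2 * d * s : ℕ) : ℝ) ^ (omegaSub F (2 * d * s) s + ε) ≤
      2 ^ (3 + ε) * ((d * s : ℕ) : ℝ) ^ (omegaSub F (d * s) s + ε) := by
  have hsn : s ≤ d * s := Nat.le_mul_of_pos_left s hd
  have hn1 : (1 : ℝ) ≤ (d * s : ℕ) := by exact_mod_cast hs.trans hsn
  have hsn' : s ≤ 2 * d * s := by rw [mul_assoc]; omega
  have hk' := logb_mem_Icc hs hsn'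
  have hle : omegaSub F (2 * d * s) s ≤ omegaSub F (d * s) s := by
    refine omegaRect_mono hk'.1 ?_
    rcases hn1.eq_or_lt with h | h
    · have h' : d * s = 1 := by exact_mod_cast h.symm
      obtain rfl : s = 1 := Nat.eq_one_of_mul_eq_one_left h'
      simp
    · rw [Real.logb, Real.logb]
      refine div_le_div_of_nonneg_left (Real.log_natCast_nonneg _) (Real.log_pos h)
        (Real.log_le_log (by linarith) ?_)
      have : d * s ≤ 2 * d * s := by rw [mul_assoc]; omega
      exact_mod_cast this
  have h3 := omegaSub_le_three (F := F) hs hsn'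
  rw [mul_assoc, Nat.cast_mul, Real.mul_rpow (by norm_num) (by positivity)]
  rw [mul_assoc] at h3 hle
  refine mul_le_mul ?_ (Real.rpow_le_rpow_of_exponent_le hn1 (by linarith)) (by positivity)
    (by positivity)
  rw [Nat.cast_ofNat]
  exact Real.rpow_le_rpow_of_exponent_le (by norm_num) (by linarith)

/-- `s ^ ω * m ≤ n ^ ω_s`, since `ω ≤ ω(k) + 1 - k` and `ω ≥ 2`. -/
theorem rpow_omega_mul_le_rectBound {m s : ℕ} (hm : 1 ≤ m) (hs : 1 ≤ s) :
    (s : ℝ) ^ omega F * m ≤ rectBound F m s := by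
  have hsn : s ≤ m * s := Nat.le_mul_of_pos_left s hm
  have hn1 : (1 : ℝ) ≤ (m * s : ℕ) := by exact_mod_cast hs.trans hsn
  have hn0 : (0 : ℝ) < (m * s : ℕ) := by linarith
  obtain ⟨hk0, hk1⟩ := logb_mem_Icc hs hsn
  have hsk := rpow_logb_eq hs hsn
  unfold rectBound omegaSub
  set k := Real.logb (m * s : ℕ) s
  have hmk : (m : ℝ) = ((m * s : ℕ) : ℝ) ^ (1 - k) := by
    rw [Real.rpow_sub hn0, Real.rpow_one, hsk]
    push_cast
    rw [mul_div_cancel_right₀]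
    have : (0 : ℝ) < s := by exact_mod_cast hs
    exact this.ne'
  nth_rewrite 1 [← hsk]
  nth_rewrite 1 [hmk]
  rw [← Real.rpow_mul hn0.le, ← Real.rpow_add hn0]
  refine Real.rpow_le_rpow_of_exponent_le hn1 ?_
  have h1 : omega F ≤ omegaRect F k + (1 - k) := omegaRect_le_add hk0 hk1
  have h2 := two_le_omega (F := F)
  nlinarith

theorem sq_le_rectBound {m s : ℕ} (hm : 1 ≤ m) (hs : 1 ≤ s) :
    ((m * s : ℕ) : ℝ) ^ 2 ≤ rectBound F m s := by
  have hsn : s ≤ m * s := Nat.le_mul_of_pos_left s hm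
  rw [← Real.rpow_two]
  exact Real.rpow_le_rpow_of_exponent_le (by exact_mod_cast hs.trans hsn)
    (two_le_omegaSub hs hsn)

/-- For `s` below `n ^ β`, the exponent `ω_s` is `2`. -/
theorem omegaSub_eq_two {m s : ℕ} (hm : 1 ≤ m) (hs : 1 ≤ s)
    (h : (s : ℝ) < ((m * s : ℕ) : ℝ) ^ dualExponent F) : omegaSub F (m * s) s = 2 := by
  have hsn : s ≤ m * s := Nat.le_mul_of_pos_left s hm
  have hn1 : (1 : ℝ) ≤ (m * s : ℕ) := by exact_mod_cast hs.trans hsn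
  refine le_antisymm ?_ (two_le_omegaSub hs hsn)
  have hlt : Real.logb (m * s : ℕ) s < dualExponent F := by
    by_contra! hle
    have := Real.rpow_le_rpow_of_exponent_le hn1 hle
    rw [rpow_logb_eq hs hsn] at this
    linarith
  have hk := logb_mem_Icc hs hsn
  have hne : {k : ℝ | 0 ≤ k ∧ omegaRect F k = 2}.Nonempty := by
    by_contra hne
    rw [dualExponent, Set.not_nonempty_iff_eq_empty.1 hne, Real.sSup_empty] at hlt
    linarith [hk.1]
  obtain ⟨k, hk', hkk⟩ := exists_lt_of_lt_csSup hne hlt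
  exact (omegaRect_mono hk.1 hkk.le).trans hk'.2.le

end

/-! ### Generalized inverses with a prescribed order of pivots -/

section Profile

variable {R T k : Type*} [Fintype R] [Fintype T] [DecidableEq R] [Field k]

/-- `H` is a generalized inverse of `C` that expresses every row of `C` by pivot rows that do not
come later with respect to `ord`; `piv` is the set of pivot rows. -/
structure IsProfile (ord : R → ℕ) (piv : Set R) (C : Matrix R T k) (H : Matrix T R k) : Prop where
  mul_mul : C * H * C = C
  col_eq_zero : ∀ j ∉ piv, ∀ t, H t j = 0
  row_eq : ∀ i ∈ piv, ∀ j, (C * H) i j = if i = j then 1 else 0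
  ord_le : ∀ i j, (C * H) i j ≠ 0 → ord j ≤ ord i

theorem IsProfile.reindex {R' : Type*} [Fintype R'] [DecidableEq R'] (σ : R' ≃ R) {ord : R' → ℕ}
    {piv : Set R'} {C : Matrix R' T k} {H : Matrix T R' k} (h : IsProfile ord piv C H) :
    IsProfile (ord ∘ σ.symm) (σ.symm ⁻¹' piv) (C.submatrix σ.symm id) (H.submatrix id σ.symm) where
  mul_mul := by
    have h1 : C.submatrix σ.symm id * H.submatrix id σ.symm =
      (C * H).submatrix σ.symm σ.symm := rfl
    rw [h1, Matrix.submatrix_mul_equiv, h.mul_mul]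
  col_eq_zero j hj t := h.col_eq_zero _ hj t
  row_eq i hi j := by
    refine (h.row_eq _ hi (σ.symm j)).trans ?_
    simp
  ord_le i j hij := h.ord_le _ _ hij

/-- Elimination: the rows of `C₁` are treated first, then what remains of the rows of `C₂` after
subtracting their expression by pivot rows of `C₁`. The order of the pivots survives because all
rows of `C₁` precede those of `C₂`. -/
theorem IsProfile.fromRows {R₁ R₂ : Type*} [Fintype R₁] [Fintype R₂] [DecidableEq R₁]
    [DecidableEq R₂] {ord : R₁ ⊕ R₂ → ℕ} {piv₁ : Set R₁} {piv₂ : Set R₂}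
    {C₁ : Matrix R₁ T k} {C₂ : Matrix R₂ T k} {H₁ : Matrix T R₁ k} {H₂ : Matrix T R₂ k}
    (h₁ : IsProfile (ord ∘ Sum.inl) piv₁ C₁ H₁)
    (h₂ : IsProfile (ord ∘ Sum.inr) piv₂ (C₂ - C₂ * H₁ * C₁) H₂)
    (hord : ∀ a b, ord (Sum.inl a) ≤ ord (Sum.inr b)) :
    IsProfile ord (Sum.elim piv₁ piv₂ : Set (R₁ ⊕ R₂)) (Matrix.fromRows C₁ C₂)
      (Matrix.fromCols (H₁ - (H₂ - H₁ * (C₁ * H₂)) * (C₂ * H₁)) (H₂ - H₁ * (C₁ * H₂))) := by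
  classical
  have e1 : C₁ * (H₂ - H₁ * (C₁ * H₂)) = 0 := by
    rw [Matrix.mul_sub, ← Matrix.mul_assoc, ← Matrix.mul_assoc, h₁.mul_mul, sub_self]
  have e2 : C₂ * (H₂ - H₁ * (C₁ * H₂)) = (C₂ - C₂ * H₁ * C₁) * H₂ := by
    simp only [Matrix.mul_sub, Matrix.sub_mul, Matrix.mul_assoc]
  have hL : Matrix.fromRows C₁ C₂ *
      Matrix.fromCols (H₁ - (H₂ - H₁ * (C₁ * H₂)) * (C₂ * H₁)) (H₂ - H₁ * (C₁ * H₂)) =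
      Matrix.fromBlocks (C₁ * H₁) 0 (C₂ * H₁ - (C₂ - C₂ * H₁ * C₁) * H₂ * (C₂ * H₁))
        ((C₂ - C₂ * H₁ * C₁) * H₂) := by
    rw [Matrix.fromRows_mul_fromCols, e1, e2, Matrix.mul_sub C₁ H₁, Matrix.mul_sub C₂ H₁,
      ← Matrix.mul_assoc C₁ (H₂ - H₁ * (C₁ * H₂)), ← Matrix.mul_assoc C₂ (H₂ - H₁ * (C₁ * H₂)),
      e1, e2, Matrix.zero_mul, sub_zero]
  refine ⟨?_, ?_, ?_, ?_⟩
  · rw [hL, ← Matrix.fromRows_fromCols_eq_fromBlocks, Matrix.fromRows_mul,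
      Matrix.fromCols_mul_fromRows, Matrix.fromCols_mul_fromRows, h₁.mul_mul, Matrix.zero_mul,
      add_zero]
    congr 1
    have := h₂.mul_mul
    generalize (C₂ - C₂ * H₁ * C₁) * H₂ = L at this ⊢
    rw [Matrix.mul_sub] at this
    calc (C₂ * H₁ - L * (C₂ * H₁)) * C₁ + L * C₂
        = C₂ * H₁ * C₁ + (L * C₂ - L * (C₂ * H₁ * C₁)) := by
          rw [Matrix.sub_mul, Matrix.mul_assoc L]; abel
      _ = C₂ := by rw [this]; abel
  · rintro (j | j) hj t
    · have hz : ∀ t', H₁ t' j = 0 := h₁.col_eq_zero j hj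
      simp [Matrix.mul_apply, hz]
    · have hz : ∀ t', H₂ t' j = 0 := h₂.col_eq_zero j hj
      simp [Matrix.mul_apply, hz]
  · rw [hL]
    rintro (i | i) hi (j | j)
    · simpa using h₁.row_eq i hi j
    · simp
    · have hi' := h₂.row_eq i hi
      simp only [Matrix.fromBlocks_apply₂₁, Matrix.sub_apply]
      rw [Matrix.mul_apply (N := C₂ * H₁)]
      simp [hi']
    · simpa using h₂.row_eq i hi j
  · rw [hL]
    rintro (i | i) (j | j) hij
    · exact h₁.ord_le i j (by simpa using hij)
    · simp at hij
    · exact hord j i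
    · exact h₂.ord_le i j (by simpa using hij)

theorem IsProfile.zero (ord : R → ℕ) : IsProfile ord ∅ (0 : Matrix R T k) 0 where
  mul_mul := by simp
  col_eq_zero := by simp
  row_eq := by simp
  ord_le := by simp

theorem IsProfile.of_subsingleton [DecidableEq T] [Subsingleton R] (ord : R → ℕ)
    {C : Matrix R T k} {r : R} {t : T} (h : C r t ≠ 0) :
    IsProfile ord Set.univ C (Matrix.of fun t' _ => if t' = t then (C r t)⁻¹ else 0) := by
  have hCH : C * (Matrix.of fun t' _ => if t' = t then (C r t)⁻¹ else 0 : Matrix T R k) = 1 := by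
    ext i j
    obtain rfl := Subsingleton.elim i r
    obtain rfl := Subsingleton.elim i j
    simp [Matrix.mul_apply, h]
  refine ⟨by rw [hCH, Matrix.one_mul], by simp, fun i _ j => by rw [hCH, Matrix.one_apply],
    fun i j _ => ?_⟩
  rw [Subsingleton.elim i j]

end Profile

/-- The index set, sorted by `ord`, cut into a lower and an upper half. -/
theorem exists_lower_split {R : Type} [Fintype R] (ord : R → ℕ) {q : ℕ}
    (h : Fintype.card R ≤ q + q) : ∃ p : R → Prop, Nat.card {r // p r} ≤ q ∧
      Nat.card {r // ¬ p r} ≤ q ∧ ∀ a b, p a → ¬ p b → ord a ≤ ord b := by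
  classical
  let e := Fintype.equivFin R
  let σ := (Tuple.sort (ord ∘ e.symm))
  have hmono : Monotone ((ord ∘ e.symm) ∘ σ) := Tuple.monotone_sort _
  let idx : R ≃ Fin (Fintype.card R) := e.trans σ.symm
  have hord : ∀ a b, idx a ≤ idx b → ord a ≤ ord b := fun a b hab => by
    simpa [idx] using hmono hab
  refine ⟨fun r => (idx r : ℕ) < q, ?_, ?_, fun a b ha hb => hord a b ?_⟩
  · have := Nat.card_le_card_of_injective
      (fun r : {r // (idx r : ℕ) < q} => (⟨idx r.1, r.2⟩ : Fin q)) fun a b hab => by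
        have : idx a.1 = idx b.1 := Fin.ext (by simpa using hab)
        exact Subtype.ext (idx.injective this)
    simpa using this
  · have := Nat.card_le_card_of_injective
      (fun r : {r // ¬ (idx r : ℕ) < q} => (⟨idx r.1 - q, by have := (idx r.1).2; omega⟩ : Fin q))
      fun a b hab => by
        have h1 : (idx a.1 : ℕ) - q = idx b.1 - q := by simpa using hab
        have : idx a.1 = idx b.1 := Fin.ext (by have := a.2; have := b.2; omega)
        exact Subtype.ext (idx.injective this)
    simpa using this
  · rw [Fin.le_iff_val_le_val]; omega

section

variable {F : Type u} [Field F] {I : Type (u + 1)} {K : I → Type u} [∀ p, Field (K p)]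
  [∀ p, Algebra F (K p)] {D : Set I} {S : Set (∀ p, K p)}

/-- Search for a nonzero value: wherever the search ends, one index `i` serves all the inputs that
lead there, or all the values vanish. -/
theorem Prog.exists_ne_zero {ι : Type*} (x : ι → ∀ p, K p) (s : Finset ι) :
    ∀ (D : Set I) (S : Set (∀ p, K p)), (∀ i, Avail D S (x i)) →
      Prog F (fun D _ => (∃ i, ∀ p ∈ D, x i p ≠ 0) ∨ ∀ i ∈ s, ∀ p ∈ D, x i p = 0) D S s.card := by
  classical
  induction s using Finset.induction_on with
  | empty => exact fun D S _ => .halt (Or.inr (by simp)) (by simp)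
  | insert a s ha ih =>
    intro D S hx
    rw [Finset.card_insert_of_notMem ha, Nat.cast_add, Nat.cast_one]
    refine .ifZero (x a) (hx a) ?_ ?_
    · refine (ih _ S fun i => (hx i).mono (Set.sep_subset _ _) subset_rfl).imp le_rfl ?_
      rintro D' S' hD - (h | h)
      · exact Or.inl h
      · refine Or.inr fun i hi p hp => ?_
        rcases Finset.mem_insert.1 hi with rfl | hi
        · exact (hD hp).2
        · exact h i hi p hp
    · exact .halt (Or.inl ⟨a, fun p hp => hp.2⟩) (by positivity)

/-- Divide and conquer on the rows, taken in the order `ord`; `N = 2 ^ E` bounds the number of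
columns. The costs of the two halves and of the products that combine them are balanced as in
`2 * q ^ (τ - 1) ≤ (2 * q) ^ (τ - 1)`. -/
theorem Prog.exists_isProfile {κ τ : ℝ} (hκ : 1 ≤ κ) (hτ : 2 ≤ τ)
    (hM : ∀ e : ℕ, MulCost F (2 ^ e) (2 ^ e) (2 ^ e) (κ * (2 ^ e) ^ τ)) {E : ℕ}
    {T : Type} [Fintype T] (hT : Fintype.card T ≤ 2 ^ E) : ∀ (e : ℕ), e ≤ E →
    ∀ (R : Type) [Fintype R] [DecidableEq R] (ord : R → ℕ), Fintype.card R ≤ 2 ^ e →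
    ∀ (D : Set I) (S : Set (∀ p, K p)) (C : ∀ p, Matrix R T (K p)), AvailM D S C →
    Prog F (fun D S => ∃ (piv : Set R) (H : ∀ p, Matrix T R (K p)),
      (∀ p ∈ D, IsProfile ord piv (C p) (H p)) ∧ AvailM D S H) D S
      ((10 * e + 3) * (κ * 2 ^ (E - e) * (2 ^ e) ^ τ)) := by
  classical
  intro e
  induction e with
  | zero =>
    intro _ R _ _ ord hR D S C hC
    have hsub : Subsingleton R := Fintype.card_le_one_iff_subsingleton.1 (by simpa using hR)
    have hT' : (Fintype.card T : ℝ) ≤ 2 ^ E := by exact_mod_cast hT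
    have h1 : (1 : ℝ) ≤ 2 ^ E := one_le_pow₀ (by norm_num)
    have hb : (2 ^ E : ℝ) ≤ κ * 2 ^ E := by nlinarith
    rcases isEmpty_or_nonempty R with hR0 | ⟨⟨r⟩⟩
    · refine .halt ⟨∅, fun _ => 0, fun p _ => ?_, fun i j => Avail.zero⟩ (by positivity)
      rw [Subsingleton.elim (C p) 0]
      exact IsProfile.zero ord
    · refine (Prog.exists_ne_zero (F := F) (fun t p => C p r t) Finset.univ D S
        fun t => hC r t).seq (c' := 2) ?_ ?_
      · simp only [Finset.card_univ, pow_zero, Real.one_rpow, Nat.cast_zero, mul_zero, zero_add,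
          mul_one, Nat.sub_zero]
        linarith
      rintro D' S' hD hS (⟨t, ht⟩ | h0)
      · refine (Prog.inv_avail ((hC r t).mono hD hS) ht).imp le_rfl fun D'' S'' hD' hS' h => ?_
        refine ⟨Set.univ, fun p => Matrix.of fun t' _ => if t' = t then (C p r t)⁻¹ else 0,
          fun p hp => IsProfile.of_subsingleton ord (ht p (hD' hp)), fun t' r' => ?_⟩
        by_cases htt : t' = t
        · simpa [htt] using h
        · simpa [htt] using Avail.zero
      · refine .halt ⟨∅, fun _ => 0, fun p hp => ?_, fun i j => Avail.zero⟩ (by norm_num)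
        have : C p = 0 := by
          ext i j
          rw [Subsingleton.elim i r]
          exact h0 j (Finset.mem_univ j) p hp
        rw [this]
        exact IsProfile.zero ord
  | succ e ih =>
    intro he R _ _ ord hR D S C hC
    have he' : e ≤ E := by omega
    set W : ℝ := κ * 2 ^ (E - e) * (2 ^ e) ^ τ with hW
    have hgq : (2 : ℕ) ^ (E - e) * 2 ^ e = 2 ^ E := by rw [← pow_add]; congr 1; omega
    have hgq' : (2 : ℝ) ^ (E - e) * 2 ^ e = 2 ^ E := by exact_mod_cast hgq
    have hq2 : ((2 : ℝ) ^ e) * 2 ^ e ≤ (2 ^ e) ^ τ := by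
      rw [← pow_two, ← Real.rpow_two]
      exact Real.rpow_le_rpow_of_exponent_le (one_le_pow₀ (by norm_num)) hτ
    have hg0 : (0 : ℝ) < 2 ^ (E - e) := by positivity
    have hqt0 : (0 : ℝ) < (2 ^ e) ^ τ := by positivity
    have hqN : (2 : ℝ) ^ e * 2 ^ E ≤ W := by
      rw [hW, ← hgq']
      calc (2 : ℝ) ^ e * (2 ^ (E - e) * 2 ^ e) = 2 ^ (E - e) * (2 ^ e * 2 ^ e) := by ring
        _ ≤ 2 ^ (E - e) * (2 ^ e) ^ τ := by gcongr
        _ ≤ κ * (2 ^ (E - e) * (2 ^ e) ^ τ) := le_mul_of_one_le_left (by positivity) hκ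
        _ = _ := by ring
    have hW0 : 0 ≤ W := le_trans (by positivity) hqN
    have m1 : MulCost F (2 ^ e) (2 ^ E) (2 ^ e) (2 * W) := by
      refine ((hM e).inner (2 ^ (E - e))).mono le_rfl hgq.ge le_rfl ?_
      push_cast
      have : (2 : ℝ) ^ e * 2 ^ e ≤ κ * (2 ^ e) ^ τ :=
        hq2.trans (le_mul_of_one_le_left (by positivity) hκ)
      calc (2 : ℝ) ^ (E - e) * (κ * (2 ^ e) ^ τ + 2 ^ e * 2 ^ e)
          ≤ 2 ^ (E - e) * (κ * (2 ^ e) ^ τ + κ * (2 ^ e) ^ τ) := by gcongr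
        _ = 2 * W := by rw [hW]; ring
    have m2 : MulCost F (2 ^ e) (2 ^ e) (2 ^ E) W := by
      refine ((hM e).cols (2 ^ (E - e))).mono le_rfl le_rfl hgq.ge (le_of_eq ?_)
      push_cast
      rw [hW]; ring
    have m3 : MulCost F (2 ^ E) (2 ^ e) (2 ^ e) W := m2.transpose
    have hW' : 2 * W ≤ κ * 2 ^ (E - (e + 1)) * (2 ^ (e + 1)) ^ τ := by
      have h1 : (2 : ℝ) ^ (E - e) = 2 * 2 ^ (E - (e + 1)) := by
        rw [← pow_succ']; congr 1; omega
      have h2 : ((2 : ℝ) ^ (e + 1)) ^ τ = 2 ^ τ * (2 ^ e) ^ τ := by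
        rw [pow_succ', Real.mul_rpow (by norm_num) (by positivity)]
      have h3 : (4 : ℝ) ≤ 2 ^ τ := by
        calc (4 : ℝ) = 2 ^ (2 : ℝ) := by norm_num
          _ ≤ _ := Real.rpow_le_rpow_of_exponent_le (by norm_num) hτ
      rw [hW, h1, h2]
      have h4 : 0 ≤ κ * 2 ^ (E - (e + 1)) * (2 ^ e) ^ τ := by positivity
      nlinarith
    obtain ⟨P, hP1, hP2, hP⟩ := exists_lower_split ord (q := 2 ^ e) (by rw [← two_mul, ← pow_succ']; exact hR)
    rw [Nat.card_eq_fintype_card] at hP1 hP2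
    have hP1' : (Fintype.card {r // P r} : ℝ) ≤ 2 ^ e := by exact_mod_cast hP1
    have hP2' : (Fintype.card {r // ¬ P r} : ℝ) ≤ 2 ^ e := by exact_mod_cast hP2
    have hT' : (Fintype.card T : ℝ) ≤ 2 ^ E := by exact_mod_cast hT
    let C₁ : ∀ p, Matrix {r // P r} T (K p) := fun p => (C p).submatrix Subtype.val id
    let C₂ : ∀ p, Matrix {r // ¬ P r} T (K p) := fun p => (C p).submatrix Subtype.val id
    have hC₁ : AvailM D S C₁ := hC.submatrix _ _
    have hC₂ : AvailM D S C₂ := hC.submatrix _ _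
    refine (ih he' _ (fun r => ord r.1) hP1 D S C₁ hC₁).seq
      (c' := 10 * W + (10 * e + 3) * W) ?_ ?_
    · push_cast
      nlinarith [mul_le_mul_of_nonneg_left hW' (by positivity : (0 : ℝ) ≤ 10 * (e + 1) + 3)]
    rintro D S hD hS ⟨piv₁, H₁, hH₁, hH₁a⟩
    replace hC₁ := hC₁.mono hD hS
    replace hC₂ := hC₂.mono hD hS
    refine (m1 I K D S _ _ _ C₂ H₁ hP2 hT hP1 hC₂ hH₁a).seq
      (c' := 8 * W + (10 * e + 3) * W) (by linarith) fun D S hD hS hKa => ?_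
    replace hC₁ := hC₁.mono hD hS
    replace hC₂ := hC₂.mono hD hS
    replace hH₁a := hH₁a.mono hD hS
    replace hH₁ := fun p (hp : p ∈ D) => hH₁ p (hD hp)
    refine (m2 I K D S _ _ _ _ C₁ hP2 hP1 hT hKa hC₁).seq
      (c' := 7 * W + (10 * e + 3) * W) (by linarith) fun D S hD hS hKC => ?_
    replace hC₁ := hC₁.mono hD hS
    replace hC₂ := hC₂.mono hD hS
    replace hH₁a := hH₁a.mono hD hS
    replace hKa := hKa.mono hD hS
    replace hH₁ := fun p (hp : p ∈ D) => hH₁ p (hD hp)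
    refine (Prog.subM hC₂ hKC).seq
      (c' := 6 * W + (10 * e + 3) * W) ?_ fun D S hD hS hC₂' => ?_
    · have : (Fintype.card {r // ¬ P r} : ℝ) * Fintype.card T ≤ W := le_trans (by gcongr) hqN
      linarith
    replace hC₁ := hC₁.mono hD hS
    replace hH₁a := hH₁a.mono hD hS
    replace hKa := hKa.mono hD hS
    replace hH₁ := fun p (hp : p ∈ D) => hH₁ p (hD hp)
    refine (ih he' _ (fun r => ord r.1) hP2 D S _ hC₂').seq (c' := 6 * W) (by linarith) ?_
    rintro D S hD hS ⟨piv₂, H₂, hH₂, hH₂a⟩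
    replace hC₁ := hC₁.mono hD hS
    replace hH₁a := hH₁a.mono hD hS
    replace hKa := hKa.mono hD hS
    replace hH₁ := fun p (hp : p ∈ D) => hH₁ p (hD hp)
    refine (m1 I K D S _ _ _ C₁ H₂ hP1 hT hP2 hC₁ hH₂a).seq
      (c' := 4 * W) (by linarith) fun D S hD hS h1 => ?_
    replace hH₁a := hH₁a.mono hD hS
    replace hH₂a := hH₂a.mono hD hS
    replace hKa := hKa.mono hD hS
    replace hH₁ := fun p (hp : p ∈ D) => hH₁ p (hD hp)
    replace hH₂ := fun p (hp : p ∈ D) => hH₂ p (hD hp)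
    refine (m3 I K D S _ _ _ H₁ _ hT hP1 hP2 hH₁a h1).seq
      (c' := 3 * W) (by linarith) fun D S hD hS h2 => ?_
    replace hH₁a := hH₁a.mono hD hS
    replace hH₂a := hH₂a.mono hD hS
    replace hKa := hKa.mono hD hS
    replace hH₁ := fun p (hp : p ∈ D) => hH₁ p (hD hp)
    replace hH₂ := fun p (hp : p ∈ D) => hH₂ p (hD hp)
    refine (Prog.subM hH₂a h2).seq (c' := 2 * W) ?_ fun D S hD hS hHr => ?_
    · have : (Fintype.card T : ℝ) * Fintype.card {r // ¬ P r} ≤ W := by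
        rw [mul_comm]; exact le_trans (by gcongr) hqN
      linarith
    replace hH₁a := hH₁a.mono hD hS
    replace hKa := hKa.mono hD hS
    replace hH₁ := fun p (hp : p ∈ D) => hH₁ p (hD hp)
    replace hH₂ := fun p (hp : p ∈ D) => hH₂ p (hD hp)
    refine (m3 I K D S _ _ _ _ _ hT hP2 hP1 hHr hKa).seq
      (c' := W) (by linarith) fun D S hD hS h3 => ?_
    replace hH₁a := hH₁a.mono hD hS
    replace hHr := hHr.mono hD hS
    replace hH₁ := fun p (hp : p ∈ D) => hH₁ p (hD hp)
    replace hH₂ := fun p (hp : p ∈ D) => hH₂ p (hD hp)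
    refine (Prog.subM hH₁a h3).imp ?_ fun D S hD hS hHl => ?_
    · have : (Fintype.card T : ℝ) * Fintype.card {r // P r} ≤ W := by
        rw [mul_comm]; exact le_trans (by gcongr) hqN
      linarith
    replace hHr := hHr.mono hD hS
    replace hH₁ := fun p (hp : p ∈ D) => hH₁ p (hD hp)
    replace hH₂ := fun p (hp : p ∈ D) => hH₂ p (hD hp)
    let σ : {r // P r} ⊕ {r // ¬ P r} ≃ R := Equiv.sumCompl P
    have hσ : ∀ p, (Matrix.fromRows (C₁ p) (C₂ p)).submatrix σ.symm id = C p := by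
      intro p
      ext r t
      obtain ⟨r', rfl⟩ := σ.surjective r
      rw [Matrix.submatrix_apply, Equiv.symm_apply_apply]
      rcases r' with r' | r' <;> rfl
    refine ⟨σ.symm ⁻¹' (Sum.elim piv₁ piv₂ : Set ({r // P r} ⊕ {r // ¬ P r})),
      fun p => (Matrix.fromCols (H₁ p - (H₂ p - H₁ p * (C₁ p * H₂ p)) * (C₂ p * H₁ p))
        (H₂ p - H₁ p * (C₁ p * H₂ p))).submatrix id σ.symm, fun p hp => ?_, ?_⟩
    · rw [← hσ p]
      have := (IsProfile.fromRows (ord := ord ∘ σ) (hH₁ p hp) (hH₂ p hp)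
        fun a b => hP a.1 b.1 a.2 b.2).reindex σ
      have hord : (ord ∘ σ) ∘ σ.symm = ord := by ext; simp
      rw [hord] at this
      exact this
    · intro t r
      obtain ⟨r', rfl⟩ := σ.surjective r
      simp only [Matrix.submatrix_apply, Equiv.symm_apply_apply]
      rcases r' with r' | r'
      · exact hHl t r'
      · exact hHr t r'

end

/-! ### Order bases of polynomial matrices -/

section OrderBasis

open Polynomial

variable {R T k : Type*} [Fintype R] [DecidableEq R] [Fintype T] [Field k]

/-- All entries of `v` have degree at most `N`, where degrees in position `j` are counted with an
additional shift `δ j`. -/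
def ShiftedDegreeLE (δ : R → ℕ) (N : ℕ) (v : R → k[X]) : Prop :=
  ∀ j n, (v j).coeff n ≠ 0 → n + δ j ≤ N

/-- The rows of `P` generate the module of rows `v` with `v * A = 0` modulo `X ^ d`, and they do so
without cancellation of leading terms: a `v` of degree at most `N` with respect to the shift `δ₀`
is a combination of rows of `P` whose terms have degrees at most `N`, where row `i` of `P` counts as
degree `δ i`. Being a basis is not required. -/
structure IsOrderBasis (δ₀ : R → ℕ) (A : Matrix R T k[X]) (d : ℕ) (P : Matrix R R k[X])
    (δ : R → ℕ) : Prop where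
  dvd : ∀ i j, X ^ d ∣ (P * A) i j
  gen : ∀ (N : ℕ) (v : R → k[X]), (∀ j, X ^ d ∣ Matrix.vecMul v A j) → ShiftedDegreeLE δ₀ N v →
    ∃ c, v = Matrix.vecMul c P ∧ ShiftedDegreeLE δ N c
  row_le : ∀ i, ShiftedDegreeLE δ₀ (δ i) (P i)
  natDegree_le : ∀ i j, (P i j).natDegree ≤ d

theorem exists_coeff_mul_coeff_ne_zero {ι : Type*} {s : Finset ι} {f g : ι → k[X]} {n : ℕ}
    (h : (∑ i ∈ s, f i * g i).coeff n ≠ 0) :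
    ∃ i ∈ s, ∃ a b, a + b = n ∧ (f i).coeff a ≠ 0 ∧ (g i).coeff b ≠ 0 := by
  rw [finsetSum_coeff] at h
  obtain ⟨i, hi, h⟩ := Finset.exists_ne_zero_of_sum_ne_zero h
  rw [coeff_mul] at h
  obtain ⟨⟨a, b⟩, hab, h⟩ := Finset.exists_ne_zero_of_sum_ne_zero h
  exact ⟨i, hi, a, b, Finset.HasAntidiagonal.mem_antidiagonal.1 hab, left_ne_zero_of_mul h,
    right_ne_zero_of_mul h⟩

/-- Order bases compose: `P₂` is an order basis of the residual `A'` of `A` under `P₁`, with the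
degrees of the rows of `P₁` as its shift. -/
theorem IsOrderBasis.comp {R T k : Type*} [Fintype R] [Field k] {δ₀ δ₁ δ₂ : R → ℕ} {A A' : Matrix R T k[X]} {d₁ d₂ : ℕ}
    {P₁ P₂ : Matrix R R k[X]} (h₁ : IsOrderBasis δ₀ A d₁ P₁ δ₁) (hA : P₁ * A = (X ^ d₁ : k[X]) • A')
    (h₂ : IsOrderBasis δ₁ A' d₂ P₂ δ₂) : IsOrderBasis δ₀ A (d₁ + d₂) (P₂ * P₁) δ₂ where
  dvd i j := by
    rw [Matrix.mul_assoc, hA, Matrix.mul_smul, Matrix.smul_apply, pow_add, smul_eq_mul]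
    exact mul_dvd_mul_left _ (h₂.dvd i j)
  gen N v hv hN := by
    obtain ⟨c, rfl, hc⟩ := h₁.gen N v
      (fun j => (pow_dvd_pow X (Nat.le_add_right _ _)).trans (hv j)) hN
    have hc₂ : ∀ j, X ^ d₂ ∣ Matrix.vecMul c A' j := fun j => by
      have := hv j
      rw [Matrix.vecMul_vecMul, hA, Matrix.vecMul_smul, Pi.smul_apply, smul_eq_mul, pow_add] at this
      exact (mul_dvd_mul_iff_left (pow_ne_zero _ X_ne_zero)).1 this
    obtain ⟨c', rfl, hc'⟩ := h₂.gen N c hc₂ hc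
    exact ⟨c', by rw [Matrix.vecMul_vecMul], hc'⟩
  row_le i j n hn := by
    rw [Matrix.mul_apply] at hn
    obtain ⟨l, -, a, b, rfl, ha, hb⟩ := exists_coeff_mul_coeff_ne_zero hn
    have h1 := h₂.row_le i l a ha
    have h2 := h₁.row_le l j b hb
    omega
  natDegree_le i j := by
    rw [Matrix.mul_apply]
    refine natDegree_sum_le_of_forall_le _ _ fun l _ => natDegree_mul_le.trans ?_
    have h1 := h₂.natDegree_le i l
    have h2 := h₁.natDegree_le l j
    omega

open Classical in
/-- The order basis for order `1`: pivot rows are multiplied by `X`, the other rows of the constant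
coefficient are eliminated. -/
def orderOneBasis (piv : Set R) (L : Matrix R R k) : Matrix R R k[X] :=
  Matrix.of fun i j => if i ∈ piv then (if i = j then X else 0)
    else C ((if i = j then 1 else 0) - L i j)

open Classical in
/-- The pivots being first in the order `δ₀` is what keeps the degrees of the other rows unchanged:
eliminating row `i` only involves pivot rows `j` with `δ₀ j ≤ δ₀ i`. -/
theorem isOrderBasis_one {δ₀ : R → ℕ} {piv : Set R} {A : Matrix R T k[X]} {H : Matrix T R k}
    (h : IsProfile δ₀ piv (A.map fun f => f.coeff 0) H) :
    IsOrderBasis δ₀ A 1 (orderOneBasis piv ((A.map fun f => f.coeff 0) * H))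
      (fun i => if i ∈ piv then δ₀ i + 1 else δ₀ i) := by
  set A₀ : Matrix R T k := A.map fun f => f.coeff 0 with hA₀
  set L := A₀ * H with hL
  have hLcol : ∀ i, ∀ j ∉ piv, L i j = 0 := fun i j hj => by
    simp [hL, Matrix.mul_apply, h.col_eq_zero j hj]
  refine ⟨fun i j => ?_, fun N v hv hN => ?_, fun i j n hn => ?_, fun i j => ?_⟩
  · rw [pow_one, X_dvd_iff, Matrix.mul_apply, finsetSum_coeff]
    simp only [mul_coeff_zero]
    by_cases hi : i ∈ piv
    · refine Finset.sum_eq_zero fun l _ => ?_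
      by_cases hil : i = l
      · subst hil; simp [orderOneBasis, hi]
      · simp [orderOneBasis, hi, hil]
    · have h1 := congrFun (congrFun h.mul_mul i) j
      rw [← hL, Matrix.mul_apply] at h1
      simp only [orderOneBasis, Matrix.of_apply, if_neg hi, coeff_C_zero, sub_mul,
        Finset.sum_sub_distrib, ite_mul, one_mul, zero_mul, Finset.sum_ite_eq, Finset.mem_univ,
        if_true]
      rw [sub_eq_zero]
      simpa [hA₀] using h1.symm
  -- away from the pivots the coefficients of the combination are those of `v`; at a pivot `j` they
  -- make up for the elimination, `X * c j = v j + g j`, and this is solvable since `v * A` has no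
  -- constant term
  · set g : R → k[X] := fun j => ∑ i, if i ∈ piv then 0 else v i * C (L i j) with hg
    have hv0 : ∀ t, ∑ i, (v i).coeff 0 * A₀ i t = 0 := fun t => by
      have := hv t
      rw [pow_one, X_dvd_iff] at this
      simpa [Matrix.vecMul, dotProduct, finsetSum_coeff, mul_coeff_zero, hA₀] using this
    have hvL : ∀ j, ∑ i, (v i).coeff 0 * L i j = 0 := fun j => by
      simp only [hL, Matrix.mul_apply, Finset.mul_sum]
      rw [Finset.sum_comm]
      refine Finset.sum_eq_zero fun t _ => ?_
      rw [← zero_mul (H t j), ← hv0 t, Finset.sum_mul]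
      exact Finset.sum_congr rfl fun i _ => (mul_assoc _ _ _).symm
    have hcoeff : ∀ j ∈ piv, (v j + g j).coeff 0 = 0 := fun j hj => by
      have h1 : ∀ i, (v i).coeff 0 * L i j = (if j = i then (v i).coeff 0 else 0) +
          (if i ∈ piv then 0 else v i * C (L i j)).coeff 0 := fun i => by
        by_cases hi : i ∈ piv
        · rw [hL, h.row_eq i hi j]
          simp [hi, eq_comm]
        · have hji : j ≠ i := fun hji => hi (hji ▸ hj)
          simp [hi, hji]
      rw [← hvL j, Finset.sum_congr rfl fun i _ => h1 i, Finset.sum_add_distrib,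
        Finset.sum_ite_eq, if_pos (Finset.mem_univ j), coeff_add, hg, finsetSum_coeff]
    set c : R → k[X] := fun j => if j ∈ piv then divX (v j + g j) else v j with hc
    refine ⟨c, funext fun j => ?_, fun j n hn => ?_⟩
    · have h1 : ∀ i, c i * orderOneBasis piv L i j =
          (if j = i then (if j ∈ piv then divX (v j + g j) * X else v j) else 0) -
            (if i ∈ piv then 0 else v i * C (L i j)) := fun i => by
        by_cases hi : i ∈ piv
        · by_cases hij : i = j
          · subst hij
            simp [orderOneBasis, hc, hi]
          · simp [orderOneBasis, hi, hij, Ne.symm hij]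
        · by_cases hij : i = j
          · subst hij
            simp [orderOneBasis, hc, hi, mul_sub]
          · simp [orderOneBasis, hc, hi, hij, Ne.symm hij]
      rw [Matrix.vecMul, dotProduct, Finset.sum_congr rfl fun i _ => h1 i,
        Finset.sum_sub_distrib, Finset.sum_ite_eq, if_pos (Finset.mem_univ j)]
      by_cases hj : j ∈ piv
      · rw [if_pos hj]
        have h2 := divX_mul_X_add (v j + g j)
        rw [hcoeff j hj, C_0, add_zero] at h2
        rw [h2]
        exact (add_sub_cancel_right _ _).symm
      · rw [if_neg hj, eq_comm, sub_eq_self]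
        exact Finset.sum_eq_zero fun i _ => by simp [hLcol i j hj]
    · by_cases hj : j ∈ piv
      · simp only [hc, if_pos hj, coeff_divX] at hn
        simp only [if_pos hj]
        by_cases hvj : (v j).coeff (n + 1) = 0
        · rw [coeff_add, hvj, zero_add, hg, finsetSum_coeff] at hn
          obtain ⟨i, -, hi⟩ := Finset.exists_ne_zero_of_sum_ne_zero hn
          by_cases hip : i ∈ piv
          · simp [hip] at hi
          · rw [if_neg hip, coeff_mul_C] at hi
            have h1 := hN i _ (left_ne_zero_of_mul hi)
            have h2 := h.ord_le i j (right_ne_zero_of_mul hi)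
            omega
        · have := hN j _ hvj
          omega
      · simp only [hc, if_neg hj] at hn ⊢
        exact hN j n hn
  · by_cases hi : i ∈ piv
    · by_cases hij : i = j
      · subst hij
        simp only [orderOneBasis, Matrix.of_apply, if_pos hi, if_true, coeff_X] at hn
        have : 1 = n := by by_contra h1; simp [h1] at hn
        simp only [if_pos hi]
        omega
      · simp [orderOneBasis, hi, hij] at hn
    · simp only [orderOneBasis, Matrix.of_apply, if_neg hi, coeff_C] at hn
      simp only [if_neg hi]
      have hn0 : n = 0 := by by_contra h1; simp [h1] at hn
      by_cases hij : i = j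
      · subst hij; omega
      · rw [if_pos hn0, if_neg hij, zero_sub, neg_ne_zero] at hn
        have := h.ord_le i j hn
        omega
  · by_cases hi : i ∈ piv
    · by_cases hij : i = j
      · subst hij; simp [orderOneBasis, hi]
      · simp [orderOneBasis, hi, hij]
    · simp only [orderOneBasis, Matrix.of_apply, if_neg hi, natDegree_C]
      exact zero_le_one

end OrderBasis

section

open Polynomial

variable {F : Type u} [Field F] {I : Type (u + 1)} {K : I → Type u} [∀ p, Field (K p)]
  [∀ p, Algebra F (K p)] {D : Set I} {S : Set (∀ p, K p)}

/-- The coefficients of `X ^ n`, for `n < N`, of a polynomial matrix are available. -/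
def AvailPoly {ι₁ ι₂ : Type} (D : Set I) (S : Set (∀ p, K p)) (N : ℕ)
    (A : ∀ p, Matrix ι₁ ι₂ (K p)[X]) : Prop :=
  ∀ i j n, n < N → Avail D S fun p => (A p i j).coeff n

theorem AvailPoly.mono {ι₁ ι₂ : Type} {D D' : Set I} {S S' : Set (∀ p, K p)} {N : ℕ}
    {A : ∀ p, Matrix ι₁ ι₂ (K p)[X]} (h : AvailPoly D S N A) (hD : D' ⊆ D) (hS : S ⊆ S') :
    AvailPoly D' S' N A :=
  fun i j n hn => (h i j n hn).mono hD hS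

namespace Prog

/-- The product of polynomial matrices modulo `X ^ N`. All products of a coefficient of `A` with a
coefficient of `B` are obtained from a single product of matrices of constants. -/
theorem polyMul {R₁ R₂ R₃ : Type} [Fintype R₁] [Fintype R₂] [Fintype R₃] {e₁ e₂ N a b c : ℕ}
    {A : ∀ p, Matrix R₁ R₂ (K p)[X]} {B : ∀ p, Matrix R₂ R₃ (K p)[X]} {κ : ℝ}
    (hM : MulCost F a b c κ) (h1 : e₁ * Fintype.card R₁ ≤ a) (h2 : Fintype.card R₂ ≤ b)
    (h3 : e₂ * Fintype.card R₃ ≤ c) (hA : AvailPoly D S e₁ A) (hB : AvailPoly D S e₂ B)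
    (hA0 : ∀ p ∈ D, ∀ i j n, e₁ ≤ n → n < N → (A p i j).coeff n = 0)
    (hB0 : ∀ p ∈ D, ∀ i j n, e₂ ≤ n → n < N → (B p i j).coeff n = 0) :
    Prog F (fun D S => AvailPoly D S N fun p => A p * B p) D S
      (κ + N * (e₁ * Fintype.card R₁ * Fintype.card R₃)) := by
  classical
  let A' : ∀ p, Matrix (Fin e₁ × R₁) R₂ (K p) := fun p =>
    Matrix.of fun q j => (A p q.2 j).coeff q.1
  let B' : ∀ p, Matrix R₂ (Fin e₂ × R₃) (K p) := fun p =>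
    Matrix.of fun i q => (B p i q.2).coeff q.1
  refine (hM I K D S _ _ _ A' B' (by simpa using h1) h2 (by simpa using h3)
    (fun q j => hA q.2 j q.1 q.1.2) fun i q => hB i q.2 q.1 q.1.2).seq
    (c' := N * (e₁ * Fintype.card R₁ * Fintype.card R₃)) (by linarith) ?_
  intro D' S' hD hS hG
  let v : R₁ → R₃ → Fin N → Fin e₁ → ∀ p, K p := fun i j n l p =>
    if h : (l : ℕ) ≤ n ∧ (n : ℕ) - l < e₂ then (A' p * B' p) (l, i) (⟨n - l, h.2⟩, j) else 0
  refine (Prog.avail_family (F := F)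
    (fun (q : R₁ × R₃ × Fin N) p => ∑ l, v q.1 q.2.1 q.2.2 l p) (c := e₁)
    fun q D'' S'' hD' hS' => ?_).imp ?_ fun D'' S'' hD' hS' h i j n hn => ?_
  · refine (Prog.sum_avail (F := F) Finset.univ (v q.1 q.2.1 q.2.2) fun l _ => ?_).mono (by simp)
    by_cases h : (l : ℕ) ≤ q.2.2 ∧ (q.2.2 : ℕ) - l < e₂
    · refine ((hG (l, q.1) (⟨q.2.2 - l, h.2⟩, q.2.1)).mono hD' hS').congr fun p _ => ?_
      simp only [v, dif_pos h]
    · exact Or.inl fun p _ => by simp only [v, dif_neg h]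
  · simp only [Fintype.card_prod, Fintype.card_fin]
    push_cast
    exact le_of_eq (by ring)
  · refine (h (i, j, ⟨n, hn⟩)).congr fun p hp => ?_
    have hpD : p ∈ D := hD (hD' hp)
    have e1 : ∀ l : ℕ, l ≤ n → n - l < e₂ ∨ ∀ t, (B p t j).coeff (n - l) = 0 := fun l hl => by
      by_cases hlt : n - l < e₂
      · exact Or.inl hlt
      · exact Or.inr fun t => hB0 p hpD t j _ (by omega) (by omega)
    have e2 : ∀ l : Fin e₁, v i j ⟨n, hn⟩ l p =
        if (l : ℕ) ≤ n then ∑ t, (A p i t).coeff l * (B p t j).coeff (n - l) else 0 := fun l => by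
      by_cases hl : (l : ℕ) ≤ n
      · rcases e1 l hl with h | h
        · simp [v, hl, h, A', B', Matrix.mul_apply]
        · have : ∑ t, (A p i t).coeff l * (B p t j).coeff (n - l) = 0 :=
            Finset.sum_eq_zero fun t _ => by rw [h t, mul_zero]
          rw [if_pos hl, this]
          simp only [v]
          split_ifs with h'
          · simp [A', B', Matrix.mul_apply, h]
          · rfl
      · simp [v, hl]
    simp only [e2]
    rw [Fin.sum_univ_eq_sum_range (fun l : ℕ =>
      if l ≤ n then ∑ t, (A p i t).coeff l * (B p t j).coeff (n - l) else (0 : K p)) e₁,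
      ← Finset.sum_filter, Matrix.mul_apply, finsetSum_coeff]
    simp only [coeff_mul, Finset.Nat.sum_antidiagonal_eq_sum_range_succ_mk]
    rw [Finset.sum_comm (s := Finset.univ) (t := Finset.range n.succ)]
    refine Finset.sum_subset (fun l hl => ?_) fun l hl hl' => ?_
    · simp only [Finset.mem_filter, Finset.mem_range] at hl ⊢
      omega
    · simp only [Finset.mem_filter, Finset.mem_range] at hl hl'
      exact Finset.sum_eq_zero fun t _ => by
        rw [hA0 p hpD i t l (by omega) (by omega), zero_mul]

/-- Divide and conquer on the order: an order basis `P₁` for the first half, the residual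
`P₁ * A / X ^ d₁`, an order basis `P₂` of the residual for the second half; the result is
`P₂ * P₁`. -/
theorem exists_isOrderBasis {R T : Type} [Fintype R] [DecidableEq R] [Fintype T] {r : ℕ} {b : ℝ}
    {κ σ : ℕ → ℝ} (hR : Fintype.card R ≤ r) (hT : Fintype.card T ≤ r)
    (base : ∀ (D : Set I) (S : Set (∀ p, K p)) (A : ∀ p, Matrix R T (K p)[X]) (δ₀ : R → ℕ),
      AvailPoly D S 1 A → Prog F (fun D S => ∃ (P : ∀ p, Matrix R R (K p)[X]) (δ : R → ℕ),
        (∀ p ∈ D, IsOrderBasis δ₀ (A p) 1 (P p) δ) ∧ AvailPoly D S 2 P) D S b)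
    (hM : ∀ d, 1 ≤ d → MulCost F ((d + 1) * r) r ((d + 1) * r) (κ d))
    (hσ : ∀ d, 1 ≤ d → κ d + (d + 1) * ((d + 1) * r * r) ≤ σ d)
    (hσ2 : ∀ d₁ d₂, 1 ≤ d₁ → 1 ≤ d₂ → σ d₁ + σ d₂ ≤ σ (d₁ + d₂)) :
    ∀ (e d : ℕ), 1 ≤ d → d ≤ 2 ^ e →
    ∀ (D : Set I) (S : Set (∀ p, K p)) (A : ∀ p, Matrix R T (K p)[X]) (δ₀ : R → ℕ),
      AvailPoly D S d A → Prog F (fun D S => ∃ (P : ∀ p, Matrix R R (K p)[X]) (δ : R → ℕ),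
        (∀ p ∈ D, IsOrderBasis δ₀ (A p) d (P p) δ) ∧ AvailPoly D S (d + 1) P) D S
        (2 * e * σ d + d * b) := by
  intro e
  have hσ0 : ∀ d, 1 ≤ d → 0 ≤ σ d := fun d hd =>
    le_trans (add_nonneg (hM d hd).nonneg (by positivity)) (hσ d hd)
  have hR' : (Fintype.card R : ℝ) ≤ r := by exact_mod_cast hR
  have hT' : (Fintype.card T : ℝ) ≤ r := by exact_mod_cast hT
  induction e with
  | zero =>
    intro d hd hd' D S A δ₀ hA
    obtain rfl : d = 1 := by omega
    simpa using base D S A δ₀ hA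
  | succ e ih =>
    intro d hd hde D S A δ₀ hA
    rcases hd.eq_or_lt with rfl | hd1
    · refine (base D S A δ₀ hA).mono ?_
      have := hσ0 1 le_rfl
      push_cast
      rw [one_mul]
      exact le_add_of_nonneg_left (by positivity)
    obtain ⟨d₁, d₂, h1, h2, hs, h1e, h2e⟩ : ∃ d₁ d₂, 1 ≤ d₁ ∧ 1 ≤ d₂ ∧ d₁ + d₂ = d ∧
        d₁ ≤ 2 ^ e ∧ d₂ ≤ 2 ^ e :=
      ⟨d / 2, d - d / 2, by omega, by omega, by omega, by rw [pow_succ] at hde; omega,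
        by rw [pow_succ] at hde; omega⟩
    have hdr : (d₁ : ℝ) + d₂ = d := by exact_mod_cast hs
    have hsup := hσ2 d₁ d₂ h1 h2
    rw [hs] at hsup
    have hb2 := (ih d₂ h2 h2e ∅ S A δ₀ fun _ _ _ _ => Or.inl (by simp)).nonneg
    refine (ih d₁ h1 h1e D S A δ₀ fun i j n hn => hA i j n (by omega)).seq
      (c' := 2 * σ d + (2 * e * σ d₂ + d₂ * b)) ?_ ?_
    · rw [← hdr]
      push_cast
      nlinarith [mul_le_mul_of_nonneg_left hsup (by positivity : (0 : ℝ) ≤ 2 * e)]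
    rintro D S hD hS ⟨P₁, δ₁, hP₁, hP₁a⟩
    refine (polyMul (N := d) (hM d hd) (Nat.mul_le_mul (by omega : d₁ + 1 ≤ d + 1) hR) hR
      (Nat.mul_le_mul (by omega : d ≤ d + 1) hT) hP₁a (hA.mono hD hS) ?_ ?_).seq
      (c' := σ d + (2 * e * σ d₂ + d₂ * b)) ?_ ?_
    · intro p hp i j n hn _
      exact coeff_eq_zero_of_natDegree_lt
        (((hP₁ p hp).natDegree_le i j).trans_lt (by omega))
    · intro p hp i j n hn hn'
      omega
    · have h3 : (d : ℝ) * ((d₁ + 1 : ℕ) * Fintype.card R * Fintype.card T) ≤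
          (d + 1) * ((d + 1) * r * r) := by
        have : ((d₁ + 1 : ℕ) : ℝ) ≤ d + 1 := by push_cast; linarith
        gcongr
        linarith
      linarith [hσ d hd]
    intro D S hD hS hres
    let A' : ∀ p, Matrix R T (K p)[X] := fun p =>
      Matrix.of fun i j => (P₁ p * A p) i j /ₘ X ^ d₁
    replace hP₁ := fun p (hp : p ∈ D) => hP₁ p (hD hp)
    replace hP₁a := hP₁a.mono hD hS
    have hA' : ∀ p ∈ D, P₁ p * A p = (X ^ d₁ : (K p)[X]) • A' p := fun p hp => by
      ext1 i j
      have h := modByMonic_add_div ((P₁ p * A p) i j) (X ^ d₁)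
      rw [(modByMonic_eq_zero_iff_dvd (monic_X_pow d₁)).2 ((hP₁ p hp).dvd i j), zero_add] at h
      exact h.symm
    have hA'a : AvailPoly D S d₂ A' := fun i j n hn =>
      (hres i j (n + d₁) (by omega)).congr fun p hp => by
        change ((P₁ p * A p) i j).coeff (n + d₁) = _
        rw [hA' p hp, Matrix.smul_apply, smul_eq_mul, coeff_X_pow_mul]
    refine (ih d₂ h2 h2e D S A' δ₁ hA'a).seq (c' := σ d) (by linarith) ?_
    rintro D S hD hS ⟨P₂, δ₂, hP₂, hP₂a⟩
    replace hP₁ := fun p (hp : p ∈ D) => hP₁ p (hD hp)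
    replace hP₁a := hP₁a.mono hD hS
    refine (polyMul (N := d + 1) (hM d hd) (Nat.mul_le_mul (by omega : d₂ + 1 ≤ d + 1) hR) hR
      (Nat.mul_le_mul (by omega : d₁ + 1 ≤ d + 1) hR) hP₂a hP₁a ?_ ?_).imp ?_ ?_
    · intro p hp i j n hn _
      exact coeff_eq_zero_of_natDegree_lt
        (((hP₂ p hp).natDegree_le i j).trans_lt (by omega))
    · intro p hp i j n hn _
      exact coeff_eq_zero_of_natDegree_lt
        (((hP₁ p hp).natDegree_le i j).trans_lt (by omega))
    · have h3 : ((d + 1 : ℕ) : ℝ) * ((d₂ + 1 : ℕ) * Fintype.card R * Fintype.card R) ≤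
          (d + 1) * ((d + 1) * r * r) := by
        have : ((d₂ + 1 : ℕ) : ℝ) ≤ d + 1 := by push_cast; linarith
        push_cast at this ⊢
        gcongr
      linarith [hσ d hd]
    · intro D S hD' hS' hP
      refine ⟨_, δ₂, fun p hp => ?_, hP⟩
      rw [← hs]
      exact (hP₁ p (hD' hp)).comp (hA' p (hD (hD' hp))) (hP₂ p (hD' hp))

/-- The order basis for order `1`, from a profile of the constant coefficient. -/
theorem exists_isOrderBasis_one {κ τ : ℝ} (hκ : 1 ≤ κ) (hτ : 2 ≤ τ)
    (hM : ∀ e : ℕ, MulCost F (2 ^ e) (2 ^ e) (2 ^ e) (κ * (2 ^ e) ^ τ)) {E : ℕ}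
    {R T : Type} [Fintype R] [DecidableEq R] [Fintype T] (hR : Fintype.card R ≤ 2 ^ E)
    (hT : Fintype.card T ≤ 2 ^ E) (D : Set I) (S : Set (∀ p, K p))
    (A : ∀ p, Matrix R T (K p)[X]) (δ₀ : R → ℕ) (hA : AvailPoly D S 1 A) :
    Prog F (fun D S => ∃ (P : ∀ p, Matrix R R (K p)[X]) (δ : R → ℕ),
        (∀ p ∈ D, IsOrderBasis δ₀ (A p) 1 (P p) δ) ∧ AvailPoly D S 2 P) D S
      ((10 * E + 6) * (κ * (2 ^ E) ^ τ)) := by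
  classical
  have hq2 : ((2 : ℝ) ^ E) * 2 ^ E ≤ κ * (2 ^ E) ^ τ := by
    calc ((2 : ℝ) ^ E) * 2 ^ E ≤ (2 ^ E) ^ τ := by
          rw [← pow_two, ← Real.rpow_two]
          exact Real.rpow_le_rpow_of_exponent_le (one_le_pow₀ (by norm_num)) hτ
      _ ≤ _ := le_mul_of_one_le_left (by positivity) hκ
  have hR' : (Fintype.card R : ℝ) ≤ 2 ^ E := by exact_mod_cast hR
  have h1 : (1 : ℝ) ≤ κ * (2 ^ E) ^ τ :=
    le_trans (by nlinarith [one_le_pow₀ (n := E) (by norm_num : (1 : ℝ) ≤ 2)]) hq2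
  let A₀ : ∀ p, Matrix R T (K p) := fun p => (A p).map fun f => f.coeff 0
  have hA₀ : AvailM D S A₀ := fun i j => hA i j 0 one_pos
  refine (exists_isProfile hκ hτ hM hT E le_rfl R δ₀ hR D S A₀ hA₀).seq
    (c' := 3 * (κ * (2 ^ E) ^ τ)) (le_of_eq (by rw [Nat.sub_self]; ring)) ?_
  rintro D S hD hS ⟨piv, H, hH, hHa⟩
  refine (hM E I K D S _ _ _ A₀ H hR hT hR (hA₀.mono hD hS) hHa).seq
    (c' := 2 * (κ * (2 ^ E) ^ τ)) (by linarith) ?_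
  intro D S hD hS hL
  suffices h : Prog F (fun D S => ∃ (P : ∀ p, Matrix R R (K p)[X]) (δ : R → ℕ),
        (∀ p ∈ D, IsOrderBasis δ₀ (A p) 1 (P p) δ) ∧ AvailPoly D S 2 P) D S
      (κ * (2 ^ E) ^ τ + 1) from h.mono (by linarith)
  refine .const 1 ?_
  have hone : Avail D (insert (fun p => algebraMap F (K p) 1) S) fun p => (1 : K p) :=
    (Avail.of_mem (Set.mem_insert _ _)).congr fun p _ => map_one _
  have hid : AvailM D (insert (fun p => algebraMap F (K p) 1) S)
      fun p => (1 : Matrix R R (K p)) := fun i j => by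
    by_cases hij : i = j
    · exact hone.congr fun p _ => by subst hij; exact (Matrix.one_apply_eq i).symm
    · exact Or.inl fun p _ => Matrix.one_apply_ne hij
  refine (subM hid (hL.mono subset_rfl (Set.subset_insert _ _))).imp
    (le_trans (by gcongr) hq2) fun D' S' hD' hS' hP => ?_
  refine ⟨_, _, fun p hp => isOrderBasis_one (hH p (hD (hD' hp))), fun i j n hn => ?_⟩
  obtain rfl | rfl : n = 0 ∨ n = 1 := by omega
  all_goals by_cases hi : i ∈ piv
  · refine Or.inl fun p _ => ?_
    simp only [orderOneBasis, Matrix.of_apply, if_pos hi]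
    split_ifs <;> simp
  · refine (hP i j).congr fun p _ => ?_
    simp only [orderOneBasis, Matrix.of_apply, if_neg hi, coeff_C_zero, Matrix.sub_apply,
      Matrix.one_apply, A₀]
  · by_cases hij : i = j
    · subst hij
      exact (hone.mono hD' hS').congr fun p _ => by simp [orderOneBasis, hi]
    · exact Or.inl fun p _ => by simp [orderOneBasis, hi, hij]
  · refine Or.inl fun p _ => ?_
    simp only [orderOneBasis, Matrix.of_apply, if_neg hi, coeff_C_succ]

end Prog

end

/-! ### Linear systems with block Toeplitz-like structure -/

section Toeplitz

open Polynomial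

variable {m : ℕ} {J Q ρ k : Type*} [Field k]

/-- `A - Z * A * Zᵀ = X * Yᵀ` for the block down-shift `Z`, entry by entry. -/
def IsToeplitzGen [Fintype Q] (A : Matrix (Fin m × J) (Fin m × J) k)
    (X Y : Matrix (Fin m × J) Q k) : Prop :=
  ∀ (i j : Fin m) (a b : J), A (i, a) (j, b) =
    (if h : 0 < (i : ℕ) ∧ 0 < (j : ℕ) then
      A (⟨i - 1, by omega⟩, a) (⟨j - 1, by omega⟩, b) else 0) + (X * Y.transpose) (i, a) (j, b)

/-- The matrix is obtained from `X * Yᵀ` by summing along the block diagonals. -/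
theorem IsToeplitzGen.apply_eq_sum [Fintype Q] {A : Matrix (Fin m × J) (Fin m × J) k}
    {X Y : Matrix (Fin m × J) Q k} (h : IsToeplitzGen A X Y) (a b : J) :
    ∀ (j : ℕ) (hj : j < m) (i : Fin m), A (i, a) (⟨j, hj⟩, b) =
      ∑ i' : Fin m, ∑ j' : Fin m, if (j' : ℕ) ≤ j ∧ (i' : ℕ) + j = i + j' then
        (X * Y.transpose) (i', a) (j', b) else 0 := by
  have single : ∀ (G : Fin m → Fin m → k) (i j : Fin m),
      ∑ i' : Fin m, ∑ j' : Fin m, (if i' = i ∧ j' = j then G i' j' else 0) = G i j := by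
    intro G i j
    rw [Finset.sum_eq_single i, Finset.sum_eq_single j]
    · simp
    · intro j' _ hj'; simp [hj']
    · simp
    · intro i' _ hi'; simp [hi']
    · simp
  intro j
  induction j with
  | zero =>
    intro hj i
    rw [h, dif_neg (by simp), zero_add]
    rw [← single (fun i' j' => (X * Y.transpose) (i', a) (j', b)) i ⟨0, hj⟩]
    refine Finset.sum_congr rfl fun i' _ => Finset.sum_congr rfl fun j' _ => if_congr ?_ rfl rfl
    simp only [Fin.ext_iff]
    omega
  | succ j ih =>
    intro hj i
    rw [h]
    by_cases hi : 0 < (i : ℕ)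
    · rw [dif_pos ⟨hi, Nat.succ_pos j⟩]
      have := ih (by omega) ⟨i - 1, by omega⟩
      simp only [Nat.add_sub_cancel] at this ⊢
      rw [this, ← single (fun i' j' => (X * Y.transpose) (i', a) (j', b)) i ⟨j + 1, hj⟩,
        ← Finset.sum_add_distrib]
      refine Finset.sum_congr rfl fun i' _ => ?_
      rw [← Finset.sum_add_distrib]
      refine Finset.sum_congr rfl fun j' _ => ?_
      simp only [Fin.ext_iff]
      by_cases h1 : (j' : ℕ) ≤ j ∧ (i' : ℕ) + j = i - 1 + j'
      · rw [if_pos h1, if_neg (by omega), if_pos (by omega), add_zero]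
      · rw [if_neg h1, zero_add]
        exact if_congr (by omega) rfl rfl
    · rw [dif_neg (by tauto), zero_add]
      rw [← single (fun i' j' => (X * Y.transpose) (i', a) (j', b)) i ⟨j + 1, hj⟩]
      refine Finset.sum_congr rfl fun i' _ => Finset.sum_congr rfl fun j' _ => if_congr ?_ rfl rfl
      simp only [Fin.ext_iff]
      omega

/-- The polynomial with the coefficients `f 0, …, f (m - 1)`. -/
def seqPoly (f : Fin m → k) : k[X] := ∑ i, C (f i) * X ^ (i : ℕ)

/-- The polynomial with the coefficients `f 0, …, f (m - 1)` of `X ^ m, …, X`. -/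
def revPoly (f : Fin m → k) : k[X] := ∑ i, C (f i) * X ^ (m - i : ℕ)

theorem coeff_seqPoly (f : Fin m → k) (n : ℕ) :
    (seqPoly f).coeff n = if h : n < m then f ⟨n, h⟩ else 0 := by
  simp only [seqPoly, finsetSum_coeff, coeff_C_mul, coeff_X_pow, mul_ite, mul_one, mul_zero]
  split_ifs with h
  · rw [Finset.sum_eq_single ⟨n, h⟩]
    · simp
    · intro i _ hi
      rw [if_neg fun hn => hi (Fin.ext hn.symm)]
    · simp
  · exact Finset.sum_eq_zero fun i _ => if_neg fun hn => h (by have := i.2; omega)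

theorem coeff_revPoly (f : Fin m → k) (n : ℕ) :
    (revPoly f).coeff n = if h : 0 < n ∧ n ≤ m then f ⟨m - n, by omega⟩ else 0 := by
  simp only [revPoly, finsetSum_coeff, coeff_C_mul, coeff_X_pow, mul_ite, mul_one, mul_zero]
  split_ifs with h
  · rw [Finset.sum_eq_single ⟨m - n, by omega⟩]
    · rw [if_pos]; simp only; omega
    · intro i _ hi
      rw [if_neg fun hn => hi (Fin.ext (by simp only; omega))]
    · simp
  · exact Finset.sum_eq_zero fun i _ => if_neg fun hn => h (by omega)

variable [Fintype J] [Fintype Q]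

/-- The polynomial matrix of `X`, with reversed coefficients. -/
def leftPoly (X : Matrix (Fin m × J) Q k) : Matrix J Q k[X] :=
  Matrix.of fun a q => revPoly fun i => X (i, a) q

/-- The polynomial matrix of `Yᵀ`. -/
def rightPoly (Y : Matrix (Fin m × J) Q k) : Matrix Q J k[X] :=
  Matrix.of fun q b => seqPoly fun j => Y (j, b) q

/-- The polynomial form of `w * A`: the product of `w` and the reversed `X`, without its lower
half, times `Yᵀ`. -/
theorem IsToeplitzGen.coeff_vecMul {A : Matrix (Fin m × J) (Fin m × J) k}
    {X' Y : Matrix (Fin m × J) Q k} (h : IsToeplitzGen A X' Y) (w : Fin m × J → k)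
    {g u : Q → k[X]}
    (hg : g = Matrix.vecMul (fun a => seqPoly fun i => w (i, a)) (leftPoly X'))
    (hu : ∀ q n, (u q).coeff n = (g q).coeff (n + m)) (n : ℕ) (hn : n < m) (b : J) :
    (Matrix.vecMul u (rightPoly Y) b).coeff n = Matrix.vecMul w A (⟨n, hn⟩, b) := by
  have e1 : ∀ q l, (u q).coeff l = ∑ a, ∑ i : Fin m, ∑ i' : Fin m,
      if (i' : ℕ) + l = i then w (i, a) * X' (i', a) q else 0 := by
    intro q l
    rw [hu, hg]
    simp only [Matrix.vecMul, dotProduct, leftPoly, Matrix.of_apply, seqPoly, revPoly,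
      Finset.sum_mul_sum, finsetSum_coeff]
    refine Finset.sum_congr rfl fun a _ => Finset.sum_congr rfl fun i _ =>
      Finset.sum_congr rfl fun i' _ => ?_
    have : C (w (i, a)) * X ^ (i : ℕ) * (C (X' (i', a) q) * X ^ (m - i' : ℕ)) =
        C (w (i, a) * X' (i', a) q) * X ^ ((i : ℕ) + (m - i')) := by
      rw [C_mul, pow_add]; ring
    rw [this, coeff_C_mul, coeff_X_pow, mul_ite, mul_one, mul_zero]
    exact if_congr (by omega) rfl rfl
  have e2 : ∀ q, (u q * rightPoly Y q b).coeff n =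
      ∑ j : Fin m, if (j : ℕ) ≤ n then (u q).coeff (n - j) * Y (j, b) q else 0 := by
    intro q
    simp only [rightPoly, Matrix.of_apply, seqPoly, Finset.mul_sum, finsetSum_coeff]
    refine Finset.sum_congr rfl fun j _ => ?_
    rw [← mul_assoc, coeff_mul_X_pow', coeff_mul_C]
  simp only [Matrix.vecMul, dotProduct, finsetSum_coeff, e2, e1, Fintype.sum_prod_type,
    h.apply_eq_sum _ b n hn, Matrix.mul_apply, Matrix.transpose_apply]
  have e3 : ∀ q (j : Fin m), (if (j : ℕ) ≤ n then (∑ a, ∑ i : Fin m, ∑ i' : Fin m,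
        if (i' : ℕ) + (n - j) = i then w (i, a) * X' (i', a) q else 0) * Y (j, b) q else 0) =
      ∑ a, ∑ i : Fin m, ∑ i' : Fin m, if (j : ℕ) ≤ n ∧ (i' : ℕ) + n = i + j then
        w (i, a) * (X' (i', a) q * Y (j, b) q) else 0 := by
    intro q j
    by_cases hj : (j : ℕ) ≤ n
    · simp only [if_pos hj, Finset.sum_mul]
      refine Finset.sum_congr rfl fun a _ => Finset.sum_congr rfl fun i _ =>
        Finset.sum_congr rfl fun i' _ => ?_
      rw [ite_mul, zero_mul, mul_assoc]
      exact if_congr (by omega) rfl rfl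
    · simp [hj]
  have e4 : ∀ (i : Fin m) (a : J), w (i, a) * (∑ i' : Fin m, ∑ j : Fin m,
      if (j : ℕ) ≤ n ∧ (i' : ℕ) + n = i + j then ∑ q, X' (i', a) q * Y (j, b) q else 0) =
      ∑ i' : Fin m, ∑ j : Fin m, ∑ q, if (j : ℕ) ≤ n ∧ (i' : ℕ) + n = i + j then
        w (i, a) * (X' (i', a) q * Y (j, b) q) else 0 := by
    intro i a
    simp only [Finset.mul_sum, mul_ite, mul_zero]
    refine Finset.sum_congr rfl fun i' _ => Finset.sum_congr rfl fun j _ => ?_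
    split_ifs <;> simp
  simp only [e3, e4]
  calc _ = ∑ q, ∑ j : Fin m, ∑ i : Fin m, ∑ a, ∑ i' : Fin m,
        if (j : ℕ) ≤ n ∧ (i' : ℕ) + n = i + j then
          w (i, a) * (X' (i', a) q * Y (j, b) q) else 0 :=
        Finset.sum_congr rfl fun q _ => Finset.sum_congr rfl fun j _ => Finset.sum_comm
    _ = ∑ q, ∑ i : Fin m, ∑ j : Fin m, ∑ a, ∑ i' : Fin m,
        if (j : ℕ) ≤ n ∧ (i' : ℕ) + n = i + j then
          w (i, a) * (X' (i', a) q * Y (j, b) q) else 0 :=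
        Finset.sum_congr rfl fun q _ => Finset.sum_comm
    _ = ∑ i : Fin m, ∑ q, ∑ j : Fin m, ∑ a, ∑ i' : Fin m,
        if (j : ℕ) ≤ n ∧ (i' : ℕ) + n = i + j then
          w (i, a) * (X' (i', a) q * Y (j, b) q) else 0 := Finset.sum_comm
    _ = _ := by
      refine Finset.sum_congr rfl fun i _ => ?_
      calc _ = ∑ q, ∑ a, ∑ j : Fin m, ∑ i' : Fin m,
            if (j : ℕ) ≤ n ∧ (i' : ℕ) + n = i + j then
              w (i, a) * (X' (i', a) q * Y (j, b) q) else 0 :=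
            Finset.sum_congr rfl fun q _ => Finset.sum_comm
        _ = ∑ a, ∑ q, ∑ j : Fin m, ∑ i' : Fin m,
            if (j : ℕ) ≤ n ∧ (i' : ℕ) + n = i + j then
              w (i, a) * (X' (i', a) q * Y (j, b) q) else 0 := Finset.sum_comm
        _ = _ := by
          refine Finset.sum_congr rfl fun a _ => ?_
          calc _ = ∑ q, ∑ i' : Fin m, ∑ j : Fin m,
                if (j : ℕ) ≤ n ∧ (i' : ℕ) + n = i + j then
                  w (i, a) * (X' (i', a) q * Y (j, b) q) else 0 :=
                Finset.sum_congr rfl fun q _ => Finset.sum_comm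
            _ = ∑ i' : Fin m, ∑ q, ∑ j : Fin m,
                if (j : ℕ) ≤ n ∧ (i' : ℕ) + n = i + j then
                  w (i, a) * (X' (i', a) q * Y (j, b) q) else 0 := Finset.sum_comm
            _ = _ := Finset.sum_congr rfl fun i' _ => Finset.sum_comm

variable [DecidableEq Q] [Fintype ρ]

/-- Rows `(w, v, t)` with `(w, v, t) * A = 0` modulo `X ^ (2 * m)`, all of degree less than `m`
and with constant `t`, correspond to the solutions of the linear system `w * A = -t * B`: the
columns of the first kind say that `w` times the reversed `X` is `-v` modulo `X ^ m`, so that the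
upper half of the product is what multiplies `Yᵀ` in the columns of the second kind. -/
def systemPoly (X' Y : Matrix (Fin m × J) Q k) (B : Matrix ρ (Fin m × J) k) :
    Matrix (J ⊕ (Q ⊕ ρ)) (Q ⊕ J) k[X] :=
  Matrix.of fun i c => match i, c with
    | .inl a, .inl q => X ^ m * leftPoly X' a q
    | .inl a, .inr b => (leftPoly X' * rightPoly Y) a b
    | .inr (.inl q'), .inl q => if q' = q then X ^ m else 0
    | .inr (.inl q), .inr b => rightPoly Y q b
    | .inr (.inr _), .inl _ => 0
    | .inr (.inr r), .inr b => X ^ m * seqPoly fun j => B r (j, b)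

theorem vecMul_systemPoly_inl (X' Y : Matrix (Fin m × J) Q k) (B : Matrix ρ (Fin m × J) k)
    (z : J ⊕ (Q ⊕ ρ) → k[X]) (q : Q) : Matrix.vecMul z (systemPoly X' Y B) (.inl q) =
      X ^ m * (Matrix.vecMul (z ∘ Sum.inl) (leftPoly X') q + z (.inr (.inl q))) := by
  simp only [Matrix.vecMul, dotProduct, systemPoly, Matrix.of_apply, Fintype.sum_sum_type,
    mul_zero, Finset.sum_const_zero, add_zero, mul_ite, Finset.sum_ite_eq', Finset.mem_univ,
    if_true, mul_add, Finset.mul_sum, Function.comp]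
  congr 1
  · exact Finset.sum_congr rfl fun a _ => by ring
  · ring

theorem vecMul_systemPoly_inr (X' Y : Matrix (Fin m × J) Q k) (B : Matrix ρ (Fin m × J) k)
    (z : J ⊕ (Q ⊕ ρ) → k[X]) (b : J) : Matrix.vecMul z (systemPoly X' Y B) (.inr b) =
      Matrix.vecMul (fun q => Matrix.vecMul (z ∘ Sum.inl) (leftPoly X') q + z (.inr (.inl q)))
        (rightPoly Y) b + X ^ m * ∑ r, z (.inr (.inr r)) * seqPoly fun j => B r (j, b) := by
  have e : (fun q => Matrix.vecMul (z ∘ Sum.inl) (leftPoly X') q + z (.inr (.inl q))) =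
    Matrix.vecMul (z ∘ Sum.inl) (leftPoly X') + fun q => z (.inr (.inl q)) := rfl
  rw [e, Matrix.add_vecMul, Matrix.vecMul_vecMul]
  simp only [Matrix.vecMul, dotProduct, systemPoly, Matrix.of_apply, Fintype.sum_sum_type,
    Finset.mul_sum, Function.comp, Pi.add_apply]
  rw [add_assoc]
  congr 2
  exact Finset.sum_congr rfl fun r _ => by ring

/-- The shift that makes the three kinds of degree bounds equal to `m - 1`. -/
def systemShift (m : ℕ) : J ⊕ (Q ⊕ ρ) → ℕ :=
  Sum.elim (fun _ => 0) (Sum.elim (fun _ => 0) fun _ => m - 1)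

/-- Polynomial solutions give solutions of the linear system. -/
theorem IsToeplitzGen.vecMul_eq_of_dvd {A : Matrix (Fin m × J) (Fin m × J) k}
    {X' Y : Matrix (Fin m × J) Q k} (h : IsToeplitzGen A X' Y) (B : Matrix ρ (Fin m × J) k)
    {z : J ⊕ (Q ⊕ ρ) → k[X]} (hz : ∀ c, X ^ (2 * m) ∣ Matrix.vecMul z (systemPoly X' Y B) c)
    (hdeg : ShiftedDegreeLE (systemShift m) (m - 1) z) :
    Matrix.vecMul (fun p : Fin m × J => (z (.inl p.2)).coeff p.1) A =
      -Matrix.vecMul (fun r => (z (.inr (.inr r))).coeff 0) B := by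
  ext ⟨n, b⟩
  have hm : 0 < m := Fin.pos n
  have hw : ∀ a, z (.inl a) = seqPoly fun i : Fin m => (z (.inl a)).coeff i := fun a => by
    ext l
    rw [coeff_seqPoly]
    split_ifs with hl
    · rfl
    · by_contra hne
      have := hdeg _ _ hne
      simp only [systemShift, Sum.elim_inl] at this
      omega
  have ht : ∀ r, z (.inr (.inr r)) = C ((z (.inr (.inr r))).coeff 0) := fun r => by
    ext l
    rw [coeff_C]
    split_ifs with hl
    · rw [hl]
    · by_contra hne
      have := hdeg _ _ hne
      simp only [systemShift, Sum.elim_inr] at this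
      omega
  set g : Q → k[X] := Matrix.vecMul (z ∘ Sum.inl) (leftPoly X') with hg
  have hX : (X ^ m : k[X]) ≠ 0 := pow_ne_zero _ X_ne_zero
  have hd : ∀ q, X ^ m ∣ g q + z (.inr (.inl q)) := fun q => by
    have := hz (.inl q)
    rw [vecMul_systemPoly_inl, two_mul, pow_add] at this
    exact (mul_dvd_mul_iff_left hX).1 this
  choose u hu using hd
  have hu' : ∀ q l, (u q).coeff l = (g q).coeff (l + m) := fun q l => by
    have h1 := congrArg (fun f => f.coeff (l + m)) (hu q)
    simp only [coeff_X_pow_mul, coeff_add] at h1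
    rw [← h1, add_eq_left]
    by_contra hne
    have := hdeg _ _ hne
    simp only [systemShift, Sum.elim_inr, Sum.elim_inl] at this
    omega
  have hg' : g = Matrix.vecMul (fun a => seqPoly fun i : Fin m => (z (.inl a)).coeff i)
      (leftPoly X') := by
    rw [hg]
    congr 1
    exact funext hw
  have h1 := h.coeff_vecMul (fun p : Fin m × J => (z (.inl p.2)).coeff p.1) hg' hu' n n.2 b
  rw [← h1]
  have h2 := hz (.inr b)
  rw [vecMul_systemPoly_inr, ← hg] at h2
  have h3 : (fun q => g q + z (.inr (.inl q))) = (X ^ m : k[X]) • u :=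
    funext fun q => hu q
  rw [h3, Matrix.smul_vecMul, Pi.smul_apply, smul_eq_mul, ← mul_add, two_mul, pow_add] at h2
  have h4 := X_pow_dvd_iff.1 ((mul_dvd_mul_iff_left hX).1 h2) n n.2
  rw [coeff_add, add_eq_zero_iff_eq_neg] at h4
  rw [h4, Pi.neg_apply, finsetSum_coeff]
  congr 1
  refine Finset.sum_congr rfl fun r _ => ?_
  rw [ht r, coeff_C_mul, coeff_seqPoly, dif_pos n.2]

/-- Solutions of the linear system give polynomial solutions. -/
theorem IsToeplitzGen.exists_dvd_of_vecMul_eq {A : Matrix (Fin m × J) (Fin m × J) k}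
    {X' Y : Matrix (Fin m × J) Q k} (h : IsToeplitzGen A X' Y) (B : Matrix ρ (Fin m × J) k)
    {w : Fin m × J → k} {t : ρ → k} (hw : Matrix.vecMul w A = -Matrix.vecMul t B) :
    ∃ z : J ⊕ (Q ⊕ ρ) → k[X], (∀ c, X ^ (2 * m) ∣ Matrix.vecMul z (systemPoly X' Y B) c) ∧
      ShiftedDegreeLE (systemShift m) (m - 1) z ∧ ∀ r, (z (.inr (.inr r))).coeff 0 = t r := by
  set g : Q → k[X] := Matrix.vecMul (fun a => seqPoly fun i => w (i, a)) (leftPoly X') with hg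
  set u : Q → k[X] := fun q => g q /ₘ X ^ m
  have hgu : ∀ q, g q - g q %ₘ X ^ m = X ^ m * u q := fun q => by
    rw [sub_eq_iff_eq_add', modByMonic_add_div]
  have hlow : ∀ q l, m ≤ l → (g q %ₘ X ^ m).coeff l = 0 := fun q l hl => by
    refine coeff_eq_zero_of_degree_lt ((degree_modByMonic_lt _ (monic_X_pow m)).trans_le ?_)
    rw [degree_X_pow]
    exact_mod_cast hl
  have hu : ∀ q l, (u q).coeff l = (g q).coeff (l + m) := fun q l => by
    have h1 := congrArg (fun f => f.coeff (l + m)) (hgu q)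
    simp only [coeff_X_pow_mul, coeff_sub] at h1
    rw [← h1, hlow q _ (by omega), sub_zero]
  refine ⟨Sum.elim (fun a => seqPoly fun i => w (i, a))
    (Sum.elim (fun q => -(g q %ₘ X ^ m)) fun r => C (t r)), ?_, ?_, fun r => by simp⟩
  · rintro (q | b)
    · rw [vecMul_systemPoly_inl, two_mul, pow_add, Sum.elim_comp_inl, ← hg]
      refine mul_dvd_mul_left _ ?_
      simp only [Sum.elim_inr, Sum.elim_inl, ← sub_eq_add_neg, hgu]
      exact dvd_mul_right _ _
    · rw [vecMul_systemPoly_inr, Sum.elim_comp_inl, ← hg]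
      simp only [Sum.elim_inr, Sum.elim_inl, ← sub_eq_add_neg, hgu]
      have h3 : (fun q => X ^ m * u q) = (X ^ m : k[X]) • u := rfl
      rw [h3, Matrix.smul_vecMul, Pi.smul_apply, smul_eq_mul, ← mul_add, two_mul, pow_add]
      refine mul_dvd_mul_left _ (X_pow_dvd_iff.2 fun n hn => ?_)
      rw [coeff_add, h.coeff_vecMul w hg hu n hn b, hw, Pi.neg_apply, neg_add_eq_zero,
        finsetSum_coeff]
      refine Finset.sum_congr rfl fun r _ => ?_
      rw [coeff_C_mul, coeff_seqPoly, dif_pos hn]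
  · rintro (a | q | r) n hn
    · simp only [Sum.elim_inl, coeff_seqPoly] at hn
      have : n < m := by by_contra h1; simp [h1] at hn
      simp only [systemShift, Sum.elim_inl]
      omega
    · simp only [Sum.elim_inl, Sum.elim_inr, coeff_neg, neg_ne_zero] at hn
      have : n < m := by by_contra h1; exact hn (hlow q n (by omega))
      simp only [systemShift, Sum.elim_inl, Sum.elim_inr]
      omega
    · simp only [Sum.elim_inr, coeff_C] at hn
      have : n = 0 := by by_contra h1; simp [h1] at hn
      simp only [systemShift, Sum.elim_inr]
      omega

variable [DecidableEq J] [DecidableEq ρ]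

/-- From an order basis, a generalized inverse of the `t`-parts of the rows of low degree gives
the solution of the linear system. -/
theorem IsOrderBasis.solve {A : Matrix (Fin m × J) (Fin m × J) k}
    {X' Y : Matrix (Fin m × J) Q k} (h : IsToeplitzGen A X' Y) (hA : IsUnit A.det)
    (B : Matrix ρ (Fin m × J) k)
    {P : Matrix (J ⊕ (Q ⊕ ρ)) (J ⊕ (Q ⊕ ρ)) k[X]} {δ : J ⊕ (Q ⊕ ρ) → ℕ}
    (hP : IsOrderBasis (systemShift m) (systemPoly X' Y B) (2 * m) P δ)
    {T : Matrix (J ⊕ (Q ⊕ ρ)) ρ k} {W : Matrix (J ⊕ (Q ⊕ ρ)) (Fin m × J) k}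
    (hT : ∀ i r, T i r = if δ i ≤ m - 1 then (P i (.inr (.inr r))).coeff 0 else 0)
    (hW : ∀ i p, W i p = if δ i ≤ m - 1 then (P i (.inl p.2)).coeff p.1 else 0)
    {H : Matrix ρ (J ⊕ (Q ⊕ ρ)) k} (hH : T * H * T = T) : (0 - H * W) * A = B := by
  have hWA : W * A = -(T * B) := by
    ext i p
    by_cases hi : δ i ≤ m - 1
    · have := congrFun (h.vecMul_eq_of_dvd B (z := P i) (fun c => hP.dvd i c)
        fun j n hn => (hP.row_le i j n hn).trans hi) p
      simpa [Matrix.mul_apply, Matrix.vecMul, dotProduct, hT, hW, hi] using this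
    · simp [Matrix.mul_apply, hT, hW, hi]
  have hL : ∃ L : Matrix ρ (J ⊕ (Q ⊕ ρ)) k, L * T = 1 := by
    have : ∀ r : ρ, ∃ c : J ⊕ (Q ⊕ ρ) → k, ∀ r', ∑ i, c i * T i r' = (1 : Matrix ρ ρ k) r r' := by
      intro r
      have hw : Matrix.vecMul (-Matrix.vecMul (Pi.single r 1 : ρ → k) (B * A⁻¹)) A =
          -Matrix.vecMul (Pi.single r 1 : ρ → k) B := by
        rw [Matrix.neg_vecMul, Matrix.vecMul_vecMul, Matrix.mul_assoc,
          Matrix.nonsing_inv_mul A hA, Matrix.mul_one]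
      obtain ⟨z, hz, hdeg, ht⟩ := h.exists_dvd_of_vecMul_eq B hw
      obtain ⟨c, rfl, hc⟩ := hP.gen _ z hz hdeg
      refine ⟨fun i => (c i).coeff 0, fun r' => ?_⟩
      have := ht r'
      rw [Matrix.vecMul, dotProduct, finsetSum_coeff] at this
      have e : (1 : Matrix ρ ρ k) r r' = (Pi.single r 1 : ρ → k) r' := by
        simp [Matrix.one_apply, Pi.single_apply, eq_comm]
      rw [e, ← this]
      refine Finset.sum_congr rfl fun i _ => ?_
      rw [mul_coeff_zero, hT]
      split_ifs with hi
      · rfl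
      · have : (c i).coeff 0 = 0 := by
          by_contra hne
          exact hi ((Nat.le_add_left _ _).trans (hc i 0 hne))
        rw [this, zero_mul, mul_zero]
    choose c hc using this
    exact ⟨Matrix.of c, by ext r r'; exact hc r r'⟩
  obtain ⟨L, hL⟩ := hL
  have hHT : H * T = 1 := by
    rw [← Matrix.one_mul (H * T), ← hL, Matrix.mul_assoc, ← Matrix.mul_assoc T, hH]
  rw [Matrix.sub_mul, Matrix.zero_mul, Matrix.mul_assoc, hWA, Matrix.mul_neg, ← Matrix.mul_assoc,
    hHT, Matrix.one_mul, zero_sub, neg_neg]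

end Toeplitz

section

open Polynomial

variable {F : Type u} [Field F] {I : Type (u + 1)} {K : I → Type u} [∀ p, Field (K p)]
  [∀ p, Algebra F (K p)] {D : Set I} {S : Set (∀ p, K p)}

namespace Prog

theorem availPoly_leftPoly {m : ℕ} {J Q : Type} {X' : ∀ p, Matrix (Fin m × J) Q (K p)}
    (hX : AvailM D S X') (N : ℕ) : AvailPoly D S N fun p => leftPoly (X' p) := by
  intro a q n _
  simp only [leftPoly, Matrix.of_apply, coeff_revPoly]
  by_cases h : 0 < n ∧ n ≤ m
  · simpa only [dif_pos h] using hX _ q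
  · simpa only [dif_neg h] using Avail.zero

theorem availPoly_rightPoly {m : ℕ} {J Q : Type} {Y : ∀ p, Matrix (Fin m × J) Q (K p)}
    (hY : AvailM D S Y) (N : ℕ) : AvailPoly D S N fun p => rightPoly (Y p) := by
  intro q b n _
  simp only [rightPoly, Matrix.of_apply, coeff_seqPoly]
  by_cases h : n < m
  · simpa only [dif_pos h] using hY _ q
  · simpa only [dif_neg h] using Avail.zero

theorem availPoly_systemPoly {m : ℕ} {J Q ρ : Type} [Fintype J] [Fintype Q] [DecidableEq Q]
    [Fintype ρ] {X' Y : ∀ p, Matrix (Fin m × J) Q (K p)} {B : ∀ p, Matrix ρ (Fin m × J) (K p)}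
    {N : ℕ} (hX : AvailM D S X') (hY : AvailM D S Y) (hB : AvailM D S B)
    (hXY : AvailPoly D S N fun p => leftPoly (X' p) * rightPoly (Y p))
    (h1 : Avail D S fun _ => 1) :
    AvailPoly D S N fun p => systemPoly (X' p) (Y p) (B p) := by
  rintro (a | q | r) (q' | b) n hn <;> simp only [systemPoly, Matrix.of_apply, coeff_zero]
  · simp only [coeff_X_pow_mul']
    by_cases h : m ≤ n
    · simpa only [if_pos h] using availPoly_leftPoly hX N a q' (n - m) (by omega)
    · simpa only [if_neg h] using Avail.zero
  · exact hXY a b n hn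
  · by_cases h : q = q' ∧ n = m
    · simpa [h.1, h.2] using h1
    · refine Or.inl fun p _ => ?_
      by_cases hq : q = q'
      · simp only [if_pos hq, coeff_X_pow, if_neg fun hnm => h ⟨hq, hnm⟩]
      · simp only [if_neg hq, coeff_zero]
  · exact availPoly_rightPoly hY N q b n hn
  · exact Avail.zero
  · simp only [coeff_X_pow_mul', coeff_seqPoly]
    by_cases h : m ≤ n
    · by_cases h' : n - m < m
      · simpa only [if_pos h, dif_pos h'] using hB r _
      · simpa only [if_pos h, dif_neg h'] using Avail.zero
    · simpa only [if_neg h] using Avail.zero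

/-- Linear systems with a nonsingular coefficient matrix that is given by generators: an order basis
of `systemPoly`, then a generalized inverse to combine its rows of low degree. -/
theorem mul_inv_toeplitz {κ₀ τ : ℝ} (hκ₀ : 1 ≤ κ₀) (hτ : 2 ≤ τ)
    (hM₀ : ∀ e : ℕ, MulCost F (2 ^ e) (2 ^ e) (2 ^ e) (κ₀ * (2 ^ e) ^ τ)) {r E : ℕ}
    (hrE : r ≤ 2 ^ E) {κ σ : ℕ → ℝ}
    (hM : ∀ d, 1 ≤ d → MulCost F ((d + 1) * r) r ((d + 1) * r) (κ d))
    (hσ : ∀ d, 1 ≤ d → κ d + (d + 1) * ((d + 1) * r * r) ≤ σ d)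
    (hσ2 : ∀ d₁ d₂, 1 ≤ d₁ → 1 ≤ d₂ → σ d₁ + σ d₂ ≤ σ (d₁ + d₂))
    {m e : ℕ} (hm : 1 ≤ m) (hme : 2 * m ≤ 2 ^ e) {J Q ρ : Type} [Fintype J] [Fintype Q]
    [Fintype ρ] (hr : Fintype.card J + (Fintype.card Q + Fintype.card ρ) ≤ r)
    {A : ∀ p, Matrix (Fin m × J) (Fin m × J) (K p)} [DecidableEq J]
    {X' Y : ∀ p, Matrix (Fin m × J) Q (K p)} {B : ∀ p, Matrix ρ (Fin m × J) (K p)}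
    (hA : ∀ p ∈ D, IsUnit (A p).det) (hXY : ∀ p ∈ D, IsToeplitzGen (A p) (X' p) (Y p))
    (hX : AvailM D S X') (hY : AvailM D S Y) (hB : AvailM D S B) :
    Prog F (fun D S => AvailM D S fun p => B p * (A p)⁻¹) D S
      ((2 * e + 2) * σ (2 * m) + (2 * m + 1) * ((10 * E + 6) * (κ₀ * (2 ^ E) ^ τ))) := by
  classical
  set b : ℝ := (10 * E + 6) * (κ₀ * (2 ^ E) ^ τ) with hb
  set s := σ (2 * m) with hs
  have h2m : 1 ≤ 2 * m := by omega
  have hdense : (1 : ℝ) ≤ κ₀ * (2 ^ E) ^ τ := by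
    have : (1 : ℝ) ≤ (2 ^ E) ^ τ := Real.one_le_rpow (one_le_pow₀ (by norm_num)) (by linarith)
    nlinarith
  have hb0 : 0 ≤ b := by positivity
  have hσm := hσ _ h2m
  have hκ0 := (hM _ h2m).nonneg
  have hJ : (Fintype.card J : ℝ) ≤ r := by exact_mod_cast (by omega : Fintype.card J ≤ r)
  have hρ : (Fintype.card ρ : ℝ) ≤ r := by exact_mod_cast (by omega : Fintype.card ρ ≤ r)
  have hm0 : (0 : ℝ) ≤ m := by positivity
  -- besides the constant `1`, only the entries of `leftPoly * rightPoly` have to be computed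
  refine (polyMul (N := 2 * m) (hM _ h2m) (e₁ := m + 1) (e₂ := m)
    (Nat.mul_le_mul (by omega) (by omega)) (by omega) (Nat.mul_le_mul (by omega) (by omega))
    (availPoly_leftPoly hX _) (availPoly_rightPoly hY _) ?_ ?_).seq
    (c' := (2 * e + 1) * s + (2 * m + 1) * b) ?_ ?_
  · intro p _ i j n hn _
    rw [leftPoly, Matrix.of_apply, coeff_revPoly, dif_neg (by omega)]
  · intro p _ i j n hn _
    rw [rightPoly, Matrix.of_apply, coeff_seqPoly, dif_neg (by omega)]
  · have : ((2 * m : ℕ) : ℝ) * ((m + 1 : ℕ) * Fintype.card J * Fintype.card J) ≤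
        ((2 * m : ℕ) + 1) * (((2 * m : ℕ) + 1) * r * r) := by
      push_cast
      gcongr <;> linarith
    linarith
  intro D₁ S₁ hD₁ hS₁ hP
  suffices h : Prog F (fun D S => AvailM D S fun p => B p * (A p)⁻¹) D₁ S₁
      ((2 * e * s + 2 * m * b + ((10 * E + 3) * (κ₀ * (2 ^ E) ^ τ) + s)) + 1) from
    h.mono (by rw [hb]; nlinarith)
  refine .const 1 ?_
  set S₂ := insert (fun p => algebraMap F (K p) 1) S₁ with hS₂
  have hS₁₂ : S₁ ⊆ S₂ := Set.subset_insert _ _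
  have hone : Avail D₁ S₂ fun p => (1 : K p) :=
    (Avail.of_mem (Set.mem_insert _ _)).congr fun p _ => map_one _
  have hsys := availPoly_systemPoly (hX.mono hD₁ (hS₁.trans hS₁₂)) (hY.mono hD₁ (hS₁.trans hS₁₂))
    (hB.mono hD₁ (hS₁.trans hS₁₂)) (hP.mono subset_rfl hS₁₂) hone
  have hR : Fintype.card (J ⊕ (Q ⊕ ρ)) ≤ r := by simpa using hr
  have hT : Fintype.card (Q ⊕ J) ≤ r := by
    rw [Fintype.card_sum]
    omega
  have hbase := fun D S A δ₀ h => exists_isOrderBasis_one (K := K) hκ₀ hτ hM₀ (hR.trans hrE)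
    (hT.trans hrE) D S A δ₀ h
  refine (exists_isOrderBasis hR hT hbase hM hσ hσ2 e (2 * m) h2m hme D₁ S₂ _
    (systemShift m) hsys).seq
    (c' := (10 * E + 3) * (κ₀ * (2 ^ E) ^ τ) + s) (by push_cast; linarith) ?_
  rintro D₃ S₃ hD₃ hS₃ ⟨P, δ, hPb, hPa⟩
  -- the `t`-parts and the `w`-parts of the rows of low degree; the other rows are set to zero
  let T : ∀ p, Matrix (J ⊕ (Q ⊕ ρ)) ρ (K p) := fun p =>
    Matrix.of fun i t => if δ i ≤ m - 1 then (P p i (.inr (.inr t))).coeff 0 else 0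
  let W : ∀ p, Matrix (J ⊕ (Q ⊕ ρ)) (Fin m × J) (K p) := fun p =>
    Matrix.of fun i q => if δ i ≤ m - 1 then (P p i (.inl q.2)).coeff q.1 else 0
  have hTa : AvailM D₃ S₃ T := fun i t => by
    by_cases hi : δ i ≤ m - 1
    · simpa only [T, Matrix.of_apply, if_pos hi] using hPa i (.inr (.inr t)) 0 (by omega)
    · simpa only [T, Matrix.of_apply, if_neg hi] using Avail.zero
  have hWa : AvailM D₃ S₃ W := fun i q => by
    by_cases hi : δ i ≤ m - 1
    · simpa only [W, Matrix.of_apply, if_pos hi] using hPa i (.inl q.2) q.1 (by omega)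
    · simpa only [W, Matrix.of_apply, if_neg hi] using Avail.zero
  refine (exists_isProfile hκ₀ hτ hM₀ (E := E) (T := ρ) (by omega) E le_rfl _ (fun _ => 0)
    (hR.trans hrE) D₃ S₃ T hTa).seq (c' := s) (le_of_eq (by rw [Nat.sub_self]; ring)) ?_
  rintro D₄ S₄ hD₄ hS₄ ⟨piv, H, hH, hHa⟩
  refine (hM _ h2m I K D₄ S₄ _ _ _ H W ?_ hR ?_ hHa (hWa.mono hD₄ hS₄)).seq
    (c' := s - κ (2 * m)) (by linarith) ?_
  · exact le_trans (by omega) (Nat.le_mul_of_pos_left r (Nat.succ_pos _))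
  · rw [Fintype.card_prod, Fintype.card_fin]
    exact Nat.mul_le_mul (by omega) (by omega)
  intro D₅ S₅ hD₅ hS₅ hHW
  refine (subM (A := fun _ => 0) (fun _ _ => Avail.zero) hHW).imp ?_ ?_
  · rw [Fintype.card_prod, Fintype.card_fin]
    have : (Fintype.card ρ : ℝ) * ((m * Fintype.card J : ℕ) : ℝ) ≤
        ((2 * m : ℕ) + 1) * (((2 * m : ℕ) + 1) * r * r) := by
      push_cast
      calc (Fintype.card ρ : ℝ) * (m * Fintype.card J) ≤ r * (m * r) := by gcongr
        _ = 1 * (m * r * r) := by ring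
        _ ≤ (2 * m + 1) * ((2 * m + 1) * r * r) := by
          gcongr <;> linarith
    linarith
  · intro D₆ S₆ hD₆ hS₆ h
    refine h.congr fun p hp => ?_
    have hp4 := hD₅ (hD₆ hp)
    have hp1 := hD₃ (hD₄ hp4)
    have hp0 := hD₁ hp1
    have := (hPb p (hD₄ hp4)).solve (hXY p hp0) (hA p hp0) (B p) (T := T p) (W := W p)
      (fun _ _ => rfl) (fun _ _ => rfl) (hH p hp4).mul_mul
    rw [← this, Matrix.mul_assoc, Matrix.mul_nonsing_inv _ (hA p hp0), Matrix.mul_one]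

end Prog

end

/-! ### Explicit inversion -/

section BlockShift

variable {m s : ℕ} {k : Type*} [Field k]

theorem blockShift_mul {ι : Type*} (M : Matrix (Fin m × Fin s) ι k) (i : Fin m) (a : Fin s) (c : ι) :
    (blockShift k m s * M) (i, a) c =
      if h : 0 < (i : ℕ) then M (⟨i - 1, by omega⟩, a) c else 0 := by
  rw [Matrix.mul_apply]
  simp only [blockShift, Matrix.of_apply, ite_mul, one_mul, zero_mul]
  split_ifs with h
  · rw [Finset.sum_eq_single (⟨i - 1, by omega⟩, a)]
    · rw [if_pos ⟨by simp only; omega, rfl⟩]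
    · rintro ⟨j, b⟩ _ hne
      refine if_neg fun hj => hne (Prod.ext (Fin.ext ?_) hj.2.symm)
      have := hj.1
      simp only at this ⊢
      omega
    · simp
  · exact Finset.sum_eq_zero fun q _ => if_neg fun hq => h (by have := hq.1; omega)

theorem mul_blockShift {ι : Type*} (M : Matrix ι (Fin m × Fin s) k) (c : ι) (j : Fin m) (b : Fin s) :
    (M * blockShift k m s) c (j, b) =
      if h : (j : ℕ) + 1 < m then M c (⟨j + 1, h⟩, b) else 0 := by
  rw [Matrix.mul_apply]
  simp only [blockShift, Matrix.of_apply, mul_ite, mul_one, mul_zero]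
  split_ifs with h
  · rw [Finset.sum_eq_single (⟨j + 1, h⟩, b)]
    · simp
    · rintro ⟨i, a⟩ _ hne
      exact if_neg fun hj => hne (Prod.ext (Fin.ext hj.1) hj.2)
    · simp
  · exact Finset.sum_eq_zero fun q _ => if_neg fun hq => h (by have := hq.1; have := q.1.2; omega)

theorem isToeplitzGen_of_sub_eq {Q : Type*} [Fintype Q]
    {A : Matrix (Fin m × Fin s) (Fin m × Fin s) k} {X Y : Matrix (Fin m × Fin s) Q k}
    (h : A - blockShift k m s * A * (blockShift k m s).transpose = X * Y.transpose) :
    IsToeplitzGen A X Y := by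
  intro i j a b
  rw [← h, Matrix.sub_apply]
  have : blockShift k m s * A * (blockShift k m s).transpose =
      (blockShift k m s * (blockShift k m s * A).transpose).transpose := by
    rw [Matrix.transpose_mul, Matrix.transpose_transpose]
  rw [this, Matrix.transpose_apply, blockShift_mul]
  by_cases hj : 0 < (j : ℕ)
  · rw [dif_pos hj, Matrix.transpose_apply, blockShift_mul]
    by_cases hi : 0 < (i : ℕ)
    · rw [dif_pos hi, dif_pos ⟨hi, hj⟩]; abel
    · rw [dif_neg hi, dif_neg fun h => hi h.1]; abel
  · rw [dif_neg hj, dif_neg fun h => hj h.2]; abel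

/-- The last block column of the identity matrix. -/
def lastBlock (k : Type*) [Field k] (m s : ℕ) : Matrix (Fin m × Fin s) (Fin s) k :=
  Matrix.of fun p c => if (p.1 : ℕ) + 1 = m ∧ p.2 = c then 1 else 0

theorem blockShift_transpose_mul_self : (blockShift k m s).transpose * blockShift k m s =
    1 - lastBlock k m s * (lastBlock k m s).transpose := by
  ext ⟨i, a⟩ ⟨j, b⟩
  rw [mul_blockShift, Matrix.sub_apply, Matrix.mul_apply]
  simp only [Matrix.transpose_apply, lastBlock, Matrix.of_apply, Matrix.one_apply, mul_ite, mul_one,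
    mul_zero, blockShift, Prod.mk.injEq]
  by_cases hj : (j : ℕ) + 1 < m
  · rw [dif_pos hj]
    have : ∀ c : Fin s, (if (j : ℕ) + 1 = m ∧ b = c then
        (if (i : ℕ) + 1 = m ∧ a = c then (1 : k) else 0) else 0) = 0 :=
      fun c => if_neg (by omega)
    simp only [this, Finset.sum_const_zero, sub_zero]
    refine if_congr ?_ rfl rfl
    simp only [Fin.ext_iff]
    omega
  · have hjm : (j : ℕ) + 1 = m := by omega
    rw [dif_neg hj, Finset.sum_eq_single b]
    · have hij : ((i : ℕ) + 1 = m ∧ a = b) ↔ (i = j ∧ a = b) := by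
        rw [Fin.ext_iff]
        exact and_congr_left fun _ => by omega
      simp only [hjm, and_self, if_true, hij, sub_self]
    · intro c _ hc
      rw [if_neg fun h => hc h.2.symm]
    · simp

/-- The inverse of a matrix with Toeplitz-like structure has such a structure, too, with respect to
the commutator with `Z`. Since `Zᵀ * Z` differs from the identity in the last block, that block
contributes the second product. -/
theorem blockShift_mul_inv_sub {Q : Type*} [Fintype Q]
    {A : Matrix (Fin m × Fin s) (Fin m × Fin s) k} {X Y : Matrix (Fin m × Fin s) Q k}
    (h : A - blockShift k m s * A * (blockShift k m s).transpose = X * Y.transpose)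
    (hA : IsUnit A.det) :
    blockShift k m s * A⁻¹ - A⁻¹ * blockShift k m s =
      A⁻¹ * X * (Y.transpose * blockShift k m s * A⁻¹) -
        A⁻¹ * (blockShift k m s * A * lastBlock k m s) * ((lastBlock k m s).transpose * A⁻¹) := by
  set Z := blockShift k m s with hZ
  have h1 : X * Y.transpose * Z =
      A * Z - Z * A + Z * A * lastBlock k m s * (lastBlock k m s).transpose := by
    rw [← h, Matrix.sub_mul, Matrix.mul_assoc (Z * A), blockShift_transpose_mul_self,
      Matrix.mul_sub, Matrix.mul_one, Matrix.mul_assoc (Z * A)]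
    abel
  have h2 : A⁻¹ * X * (Y.transpose * Z * A⁻¹) = A⁻¹ * (X * Y.transpose * Z) * A⁻¹ := by
    simp only [Matrix.mul_assoc]
  have h3 : A⁻¹ * (A * Z) * A⁻¹ = Z * A⁻¹ := by
    rw [← Matrix.mul_assoc, Matrix.nonsing_inv_mul A hA, Matrix.one_mul]
  have h4 : A⁻¹ * (Z * A) * A⁻¹ = A⁻¹ * Z := by
    rw [Matrix.mul_assoc, Matrix.mul_assoc Z, Matrix.mul_nonsing_inv A hA, Matrix.mul_one]
  rw [h2, h1, Matrix.mul_add, Matrix.mul_sub, Matrix.add_mul, Matrix.sub_mul, h3, h4]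
  simp only [Matrix.mul_assoc]
  abel

end BlockShift

section

variable {F : Type u} [Field F] {I : Type (u + 1)} {K : I → Type u} [∀ p, Field (K p)]
  [∀ p, Algebra F (K p)] {D : Set I} {S : Set (∀ p, K p)}

namespace Prog

/-- Summation along the block diagonals. -/
theorem diagSum {m : ℕ} {J : Type} [Fintype J] {A G : ∀ p, Matrix (Fin m × J) (Fin m × J) (K p)}
    (h : ∀ p ∈ D, ∀ (i j : Fin m) (a b : J), A p (i, a) (j, b) =
      (if h : 0 < (i : ℕ) ∧ 0 < (j : ℕ) then
        A p (⟨i - 1, by omega⟩, a) (⟨j - 1, by omega⟩, b) else 0) + G p (i, a) (j, b))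
    (hG : AvailM D S G) :
    Prog F (fun D S => AvailM D S A) D S (m * (Fintype.card J * (m * Fintype.card J))) := by
  have key : ∀ l ≤ m, Prog F (fun D S => ∀ (i : Fin m) (a : J) (q : Fin m × J), (i : ℕ) < l →
      Avail D S fun p => A p (i, a) q) D S (l * (Fintype.card J * (m * Fintype.card J))) := by
    intro l
    induction l with
    | zero => exact fun _ => .halt (fun i _ _ hi => absurd hi (Nat.not_lt_zero _)) (by simp)
    | succ l ih =>
      intro hl
      refine (ih (by omega)).seq (c' := Fintype.card J * (m * Fintype.card J))
        (by push_cast; linarith) fun D' S' hD hS hprev => ?_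
      refine (avail_family (F := F) (fun (q : J × (Fin m × J)) p => A p (⟨l, hl⟩, q.1) q.2)
        (c := 1) ?_).imp ?_ ?_
      · rintro ⟨a, j, b⟩ D'' S'' hD' hS'
        have h1 : Avail D'' S'' fun p => if h : 0 < ((⟨l, hl⟩ : Fin m) : ℕ) ∧ 0 < (j : ℕ) then
            A p (⟨l - 1, by omega⟩, a) (⟨j - 1, by omega⟩, b) else 0 := by
          by_cases hlj : 0 < l ∧ 0 < (j : ℕ)
          · simpa only [dif_pos hlj] using
              (hprev ⟨l - 1, by omega⟩ a (⟨j - 1, by omega⟩, b) (by simp only; omega)).mono hD' hS'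
          · simpa only [dif_neg hlj] using Avail.zero
        refine (add_avail h1 ((hG (⟨l, hl⟩, a) (j, b)).mono (hD'.trans hD) (hS.trans hS'))).imp
          le_rfl fun D₃ S₃ hD₃ _ h3 => h3.congr fun p hp => ?_
        exact (h p (hD (hD' (hD₃ hp))) ⟨l, hl⟩ j a b).symm
      · simp
      · intro D'' S'' hD' hS' hl' i a q hi
        rcases Nat.lt_succ_iff_lt_or_eq.1 hi with hi | hi
        · exact (hprev i a q hi).mono hD' hS'
        · have := hl' (a, q)
          rwa [show (⟨l, hl⟩ : Fin m) = i from Fin.ext hi.symm] at this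
  exact (key m le_rfl).imp le_rfl fun _ _ _ _ h i q => h i.1 i.2 q i.1.2

/-- All entries of the inverse: two linear systems give generators of the inverse for the
displacement `Z * R - R * Z`, one product multiplies them, and the entries follow along the block
diagonals from the last block row. -/
theorem inv_toeplitz {κ₀ τ : ℝ} (hκ₀ : 1 ≤ κ₀) (hτ : 2 ≤ τ)
    (hM₀ : ∀ e : ℕ, MulCost F (2 ^ e) (2 ^ e) (2 ^ e) (κ₀ * (2 ^ e) ^ τ)) {r E : ℕ}
    (hrE : r ≤ 2 ^ E) {κ σ : ℕ → ℝ}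
    (hM : ∀ d, 1 ≤ d → MulCost F ((d + 1) * r) r ((d + 1) * r) (κ d))
    (hσ : ∀ d, 1 ≤ d → κ d + (d + 1) * ((d + 1) * r * r) ≤ σ d)
    (hσ2 : ∀ d₁ d₂, 1 ≤ d₁ → 1 ≤ d₂ → σ d₁ + σ d₂ ≤ σ (d₁ + d₂))
    {m e s : ℕ} (hm : 1 ≤ m) (hme : 2 * m ≤ 2 ^ e) {Q : Type} [Fintype Q]
    (hr : s + (Fintype.card Q + (Fintype.card Q + s)) ≤ r)
    {A : ∀ p, Matrix (Fin m × Fin s) (Fin m × Fin s) (K p)}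
    {X Y : ∀ p, Matrix (Fin m × Fin s) Q (K p)}
    (hA : ∀ p ∈ D, IsUnit (A p).det)
    (hXY : ∀ p ∈ D, A p - blockShift (K p) m s * A p * (blockShift (K p) m s).transpose =
      X p * (Y p).transpose)
    (hX : AvailM D S X) (hY : AvailM D S Y) :
    Prog F (fun D S => AvailM D S fun p => (A p)⁻¹) D S
      ((4 * e + 10) * σ (2 * m) + (4 * m + 3) * ((10 * E + 6) * (κ₀ * (2 ^ E) ^ τ))) := by
  classical
  set b : ℝ := (10 * E + 6) * (κ₀ * (2 ^ E) ^ τ) with hb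
  set σ' := σ (2 * m) with hs
  have h2m : 1 ≤ 2 * m := by omega
  have hdense : (1 : ℝ) ≤ κ₀ * (2 ^ E) ^ τ := by
    have : (1 : ℝ) ≤ (2 ^ E) ^ τ := Real.one_le_rpow (one_le_pow₀ (by norm_num)) (by linarith)
    nlinarith
  have hb1 : 1 ≤ b := by
    rw [hb]
    have : (0 : ℝ) ≤ E := by positivity
    nlinarith
  have hσm := hσ _ h2m
  have hκ0 := (hM _ h2m).nonneg
  have hκσ : κ (2 * m) ≤ σ' := by
    have : (0 : ℝ) ≤ ((2 * m : ℕ) + 1) * (((2 * m : ℕ) + 1) * r * r) := by positivity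
    linarith
  have hsr : (s : ℝ) ≤ r := by exact_mod_cast (by omega : s ≤ r)
  have hsq : (m : ℝ) * (s * (m * s)) ≤ σ' := by
    have : (m : ℝ) * (s * (m * s)) ≤ ((2 * m : ℕ) + 1) * (((2 * m : ℕ) + 1) * r * r) := by
      push_cast
      calc (m : ℝ) * (s * (m * s)) = m * (m * s * s) := by ring
        _ ≤ (2 * m + 1) * ((2 * m + 1) * r * r) := by gcongr <;> linarith
    linarith
  have hσ0 : 0 ≤ σ' := hκ0.trans hκσ
  have hT : ∀ p ∈ D, IsToeplitzGen (A p) (X p) (Y p) := fun p hp => isToeplitzGen_of_sub_eq (hXY p hp)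
  have hTt : ∀ p ∈ D, IsToeplitzGen (A p).transpose (Y p) (X p) := fun p hp =>
    isToeplitzGen_of_sub_eq (by
      have := congrArg Matrix.transpose (hXY p hp)
      simpa [Matrix.transpose_mul, Matrix.mul_assoc] using this)
  have hn : m * s ≤ (2 * m + 1) * r := Nat.mul_le_mul (by omega) (by omega)
  have hcard : Fintype.card (Fin m × Fin s) ≤ (2 * m + 1) * r := by simpa using hn
  -- the entries of `A`
  refine (hM _ h2m I K D S _ _ _ X (fun p => (Y p).transpose) hcard (by omega) hcard hX
    hY.transpose).seq (c' := (4 * e + 9) * σ' + (4 * m + 3) * b) (by linarith) ?_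
  intro D S hD hS hG
  replace hX := hX.mono hD hS
  replace hY := hY.mono hD hS
  replace hA := fun p (hp : p ∈ D) => hA p (hD hp)
  replace hXY := fun p (hp : p ∈ D) => hXY p (hD hp)
  replace hT := fun p (hp : p ∈ D) => hT p (hD hp)
  replace hTt := fun p (hp : p ∈ D) => hTt p (hD hp)
  refine (diagSum (fun p hp => hT p hp) hG).seq
    (c' := ((4 * e + 8) * σ' + (4 * m + 2) * b) + 1) (by rw [Fintype.card_fin]; linarith) ?_
  intro D S hD hS hAa
  replace hX := hX.mono hD hS
  replace hY := hY.mono hD hS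
  replace hA := fun p (hp : p ∈ D) => hA p (hD hp)
  replace hXY := fun p (hp : p ∈ D) => hXY p (hD hp)
  replace hT := fun p (hp : p ∈ D) => hT p (hD hp)
  replace hTt := fun p (hp : p ∈ D) => hTt p (hD hp)
  refine .const (-1) ?_
  have hneg : Avail D (insert (fun p => algebraMap F (K p) (-1)) S) fun p => (-1 : K p) :=
    (Avail.of_mem (Set.mem_insert _ _)).congr fun p _ => by simp
  replace hX := hX.mono subset_rfl (Set.subset_insert (fun p => algebraMap F (K p) (-1)) S)
  replace hY := hY.mono subset_rfl (Set.subset_insert (fun p => algebraMap F (K p) (-1)) S)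
  replace hAa := hAa.mono subset_rfl (Set.subset_insert (fun p => algebraMap F (K p) (-1)) S)
  revert hneg hX hY hAa
  generalize insert (fun p => algebraMap F (K p) (-1)) S = S
  intro hneg hX hY hAa
  -- the two systems `B₁ * A⁻¹` and `B₂ * (Aᵀ)⁻¹` that give the generators of the inverse
  let B₁ : ∀ p, Matrix (Q ⊕ Fin s) (Fin m × Fin s) (K p) := fun p =>
    Matrix.fromRows ((Y p).transpose * blockShift (K p) m s) (-(lastBlock (K p) m s).transpose)
  let B₂ : ∀ p, Matrix (Q ⊕ Fin s) (Fin m × Fin s) (K p) := fun p =>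
    Matrix.fromRows (X p).transpose (blockShift (K p) m s * A p * lastBlock (K p) m s).transpose
  have hB₁ : AvailM D S B₁ := by
    rintro (q | c) ⟨j, b⟩
    · simp only [B₁, Matrix.fromRows_apply_inl, mul_blockShift]
      by_cases hj : (j : ℕ) + 1 < m
      · simp only [dif_pos hj]
        exact hY _ q
      · simpa only [dif_neg hj] using Avail.zero
    · simp only [B₁, Matrix.fromRows_apply_inr, Matrix.neg_apply, Matrix.transpose_apply, lastBlock,
        Matrix.of_apply]
      by_cases hj : (j : ℕ) + 1 = m ∧ b = c
      · simpa only [if_pos hj] using hneg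
      · simpa only [if_neg hj, neg_zero] using Avail.zero
  have hB₂ : AvailM D S B₂ := by
    rintro (q | c) ⟨i, a⟩
    · exact hX (i, a) q
    · simp only [B₂, Matrix.fromRows_apply_inr, Matrix.transpose_apply, Matrix.mul_assoc,
        blockShift_mul]
      by_cases hi : 0 < (i : ℕ)
      · simp only [dif_pos hi]
        refine (hAa (⟨i - 1, by omega⟩, a) (⟨m - 1, by omega⟩, c)).congr fun p _ => ?_
        rw [Matrix.mul_apply, Finset.sum_eq_single (⟨m - 1, by omega⟩, c)]
        · simp only [lastBlock, Matrix.of_apply]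
          rw [if_pos ⟨by omega, trivial⟩, mul_one]
        · rintro ⟨j, b⟩ _ hne
          simp only [lastBlock, Matrix.of_apply]
          rw [if_neg, mul_zero]
          rintro ⟨h1, h2⟩
          exact hne (Prod.ext (Fin.ext (by simp only; omega)) h2)
        · simp
      · simpa only [dif_neg hi] using Avail.zero
  have hr' : Fintype.card (Fin s) + (Fintype.card Q + Fintype.card (Q ⊕ Fin s)) ≤ r := by
    simpa using hr
  have hρ : Fintype.card (Q ⊕ Fin s) ≤ r := by omega
  refine (mul_inv_toeplitz hκ₀ hτ hM₀ hrE hM hσ hσ2 hm hme hr' hA hT hX hY hB₁).seq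
    (c' := (2 * e + 6) * σ' + (2 * m + 1) * b) (by linarith) ?_
  intro D S hD hS hU₁
  replace hX := hX.mono hD hS
  replace hY := hY.mono hD hS
  replace hB₂ := hB₂.mono hD hS
  replace hA := fun p (hp : p ∈ D) => hA p (hD hp)
  replace hXY := fun p (hp : p ∈ D) => hXY p (hD hp)
  replace hTt := fun p (hp : p ∈ D) => hTt p (hD hp)
  refine (mul_inv_toeplitz hκ₀ hτ hM₀ hrE hM hσ hσ2 hm hme hr'
    (fun p hp => by rw [Matrix.det_transpose]; exact hA p hp) hTt hY hX hB₂).seq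
    (c' := 4 * σ') (by linarith) ?_
  intro D S hD hS hU₂
  replace hU₁ := hU₁.mono hD hS
  replace hA := fun p (hp : p ∈ D) => hA p (hD hp)
  replace hXY := fun p (hp : p ∈ D) => hXY p (hD hp)
  refine (hM _ h2m I K D S _ _ _ _ _ hcard hρ hcard hU₂.transpose hU₁).seq
    (c' := 2 * σ') (by linarith) ?_
  intro D S hD hS hV
  replace hU₁ := hU₁.mono hD hS
  replace hA := fun p (hp : p ∈ D) => hA p (hD hp)
  replace hXY := fun p (hp : p ∈ D) => hXY p (hD hp)
  have hV' : ∀ p ∈ D, (B₂ p * (A p).transpose⁻¹).transpose * (B₁ p * (A p)⁻¹) =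
      blockShift (K p) m s * (A p)⁻¹ - (A p)⁻¹ * blockShift (K p) m s := fun p hp => by
    rw [blockShift_mul_inv_sub (hXY p hp) (hA p hp), Matrix.transpose_mul,
      ← Matrix.transpose_nonsing_inv, Matrix.transpose_transpose]
    simp only [B₁, B₂]
    rw [Matrix.transpose_fromRows, Matrix.mul_fromCols, Matrix.fromRows_mul,
      Matrix.fromCols_mul_fromRows, Matrix.transpose_transpose, Matrix.transpose_transpose,
      Matrix.neg_mul, Matrix.mul_neg, ← sub_eq_add_neg]
  -- the last block row of the inverse is, up to the sign, part of the first solution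
  have hlast : ∀ p ∈ D, ∀ (c : Fin s) q, (0 - B₁ p * (A p)⁻¹ : Matrix (Q ⊕ Fin s) (Fin m × Fin s) (K p)) (Sum.inr c) q =
      (A p)⁻¹ (⟨m - 1, by omega⟩, c) q := fun p hp c q => by
    rw [Matrix.sub_apply, Matrix.zero_apply, zero_sub]
    simp only [B₁, Matrix.fromRows_mul, Matrix.fromRows_apply_inr, Matrix.neg_mul,
      Matrix.neg_apply, neg_neg]
    rw [Matrix.mul_apply, Finset.sum_eq_single (⟨m - 1, by omega⟩, c)]
    · simp only [lastBlock, Matrix.transpose_apply, Matrix.of_apply]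
      rw [if_pos ⟨by omega, trivial⟩, one_mul]
    · rintro ⟨j, b⟩ _ hne
      simp only [lastBlock, Matrix.transpose_apply, Matrix.of_apply]
      rw [if_neg, zero_mul]
      rintro ⟨h1, h2⟩
      exact hne (Prod.ext (Fin.ext (by simp only; omega)) h2)
    · simp
  refine (subM (A := fun _ => 0) (fun _ _ => Avail.zero) hU₁).seq (c' := σ') ?_ ?_
  · have : (Fintype.card (Q ⊕ Fin s) : ℝ) * Fintype.card (Fin m × Fin s) ≤
        ((2 * m : ℕ) + 1) * (((2 * m : ℕ) + 1) * r * r) := by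
      have h1 : (Fintype.card (Q ⊕ Fin s) : ℝ) ≤ r := by exact_mod_cast hρ
      have h2 : (Fintype.card (Fin m × Fin s) : ℝ) = m * s := by simp
      rw [h2]
      push_cast
      calc (Fintype.card (Q ⊕ Fin s) : ℝ) * (m * s) ≤ r * (m * r) := by gcongr
        _ = 1 * (m * r * r) := by ring
        _ ≤ (2 * m + 1) * ((2 * m + 1) * r * r) := by
          have : (0 : ℝ) ≤ m := by positivity
          gcongr <;> linarith
    linarith
  intro D S hD hS hN
  replace hV := hV.mono hD hS
  replace hV' := fun p (hp : p ∈ D) => hV' p (hD hp)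
  replace hlast := fun p (hp : p ∈ D) => hlast p (hD hp)
  -- in reversed order of the blocks, the entries of the inverse satisfy the recursion of `diagSum`
  let rv : Fin m × Fin s → Fin m × Fin s := fun q => (Fin.rev q.1, q.2)
  let G : ∀ p, Matrix (Fin m × Fin s) (Fin m × Fin s) (K p) := fun p =>
    Matrix.of fun x y => if h : 0 < (x.1 : ℕ) then
      ((B₂ p * (A p).transpose⁻¹).transpose * (B₁ p * (A p)⁻¹)) (⟨m - x.1, by omega⟩, x.2) (rv y)
    else (0 - B₁ p * (A p)⁻¹ : Matrix (Q ⊕ Fin s) (Fin m × Fin s) (K p)) (Sum.inr x.2) (rv y)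
  have hGa : AvailM D S G := by
    rintro ⟨i, a⟩ y
    by_cases hi : 0 < (i : ℕ)
    · simpa only [G, Matrix.of_apply, dif_pos hi] using hV _ _
    · simpa only [G, Matrix.of_apply, dif_neg hi] using hN _ _
  refine (diagSum (A := fun p => ((A p)⁻¹).submatrix rv rv) (G := G) ?_ hGa).imp ?_ ?_
  · intro p hp i j a b
    simp only [Matrix.submatrix_apply, G, Matrix.of_apply, rv]
    by_cases hi : 0 < (i : ℕ)
    · have e1 : (blockShift (K p) m s * (A p)⁻¹) (⟨m - i, by omega⟩, a) (Fin.rev j, b) =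
          (A p)⁻¹ (Fin.rev i, a) (Fin.rev j, b) := by
        rw [blockShift_mul, dif_pos (show 0 < m - (i : ℕ) by omega)]
        exact congrArg (fun l => (A p)⁻¹ (l, a) (Fin.rev j, b)) (Fin.ext (by
          simp only [Fin.val_rev]; omega))
      have e2 : ((A p)⁻¹ * blockShift (K p) m s) (⟨m - i, by omega⟩, a) (Fin.rev j, b) =
          if h : 0 < (i : ℕ) ∧ 0 < (j : ℕ) then
            (A p)⁻¹ (Fin.rev ⟨i - 1, by omega⟩, a) (Fin.rev ⟨j - 1, by omega⟩, b) else 0 := by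
        rw [mul_blockShift]
        by_cases hj : 0 < (j : ℕ)
        · have hj' : (Fin.rev j : ℕ) + 1 < m := by rw [Fin.val_rev]; omega
          rw [dif_pos hj', dif_pos (And.intro hi hj)]
          exact congrArg₂ (fun l l' => (A p)⁻¹ (l, a) (l', b))
            (Fin.ext (by simp only [Fin.val_rev]; omega))
            (Fin.ext (by simp only [Fin.val_rev]; omega))
        · have hj' : ¬ (Fin.rev j : ℕ) + 1 < m := by rw [Fin.val_rev]; omega
          rw [dif_neg hj', dif_neg fun h => hj h.2]
      rw [dif_pos hi, hV' p hp, Matrix.sub_apply, e1, e2]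
      abel
    · rw [dif_neg hi, dif_neg fun h => hi h.1, hlast p hp, zero_add]
      have e1 : ∀ h, (⟨m - 1, h⟩ : Fin m) = Fin.rev i := fun h => by
        ext; simp only [Fin.val_rev]; omega
      simp only [e1]
  · rw [Fintype.card_fin]
    linarith
  · intro D S _ _ h
    have := h.submatrix rv rv
    intro i j
    simpa [rv] using this i j

end Prog

end

/-! ### The four types of structure -/

section StructType

variable {k : Type*} [Field k] {m s : ℕ}

/-- Reversal of the order of the blocks. -/
def revBlocks (m s : ℕ) : (Fin m × Fin s) ≃ (Fin m × Fin s) :=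
  Fin.revPerm.prodCongr (Equiv.refl _)

theorem blockShift_transpose_eq_submatrix : (blockShift k m s).transpose =
    (blockShift k m s).submatrix (revBlocks m s) (revBlocks m s) := by
  ext ⟨i, a⟩ ⟨j, b⟩
  simp only [blockShift, revBlocks, Matrix.transpose_apply, Matrix.submatrix_apply,
    Matrix.of_apply, Equiv.prodCongr_apply, Prod.map_apply, Fin.revPerm_apply, Fin.val_rev,
    Equiv.refl_apply]
  refine if_congr (and_congr ?_ eq_comm) rfl rfl
  omega

/-- The permutation of the rows that turns a structure of type `t` into the Toeplitz type. -/
def rowPerm (t : StructType) (m s : ℕ) : (Fin m × Fin s) ≃ (Fin m × Fin s) :=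
  match t with
  | .toeplitz => Equiv.refl _
  | .toeplitzRev => revBlocks m s
  | .hankel => revBlocks m s
  | .hankelRev => Equiv.refl _

/-- The permutation of the columns that turns a structure of type `t` into the Toeplitz type. -/
def colPerm (t : StructType) (m s : ℕ) : (Fin m × Fin s) ≃ (Fin m × Fin s) :=
  match t with
  | .toeplitz => Equiv.refl _
  | .toeplitzRev => revBlocks m s
  | .hankel => Equiv.refl _
  | .hankelRev => revBlocks m s

theorem leftOp_eq_submatrix (t : StructType) : t.leftOp k m s =
    (blockShift k m s).submatrix (rowPerm t m s) (rowPerm t m s) := by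
  cases t
  · rfl
  · exact blockShift_transpose_eq_submatrix
  · exact blockShift_transpose_eq_submatrix
  · rfl

theorem rightOp_eq_submatrix (t : StructType) : t.rightOp k m s =
    (blockShift k m s).transpose.submatrix (colPerm t m s) (colPerm t m s) := by
  have h : blockShift k m s =
      (blockShift k m s).transpose.submatrix (revBlocks m s) (revBlocks m s) := by
    rw [← Matrix.transpose_submatrix, ← blockShift_transpose_eq_submatrix,
      Matrix.transpose_transpose]
  cases t
  · rfl
  · exact h
  · rfl
  · exact h

/-- All types of structure become the Toeplitz type when blocks of rows or columns are reversed. -/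
theorem toeplitz_of_displacement_eq {Q : Type*} [Fintype Q] (t : StructType)
    {A : Matrix (Fin m × Fin s) (Fin m × Fin s) k} {X Y : Matrix (Fin m × Fin s) Q k}
    (h : displacement t A = X * Y.transpose) :
    A.submatrix (rowPerm t m s).symm (colPerm t m s).symm -
      blockShift k m s * A.submatrix (rowPerm t m s).symm (colPerm t m s).symm *
        (blockShift k m s).transpose =
      X.submatrix (rowPerm t m s).symm id * (Y.submatrix (colPerm t m s).symm id).transpose := by
  have h1 : X.submatrix (rowPerm t m s).symm id * (Y.submatrix (colPerm t m s).symm id).transpose =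
      (X * Y.transpose).submatrix (rowPerm t m s).symm (colPerm t m s).symm := by
    rw [Matrix.transpose_submatrix]
    exact Matrix.submatrix_mul_equiv X Y.transpose _ (Equiv.refl Q) _
  have h2 : (t.leftOp k m s * A * t.rightOp k m s).submatrix (rowPerm t m s).symm
      (colPerm t m s).symm =
      blockShift k m s * A.submatrix (rowPerm t m s).symm (colPerm t m s).symm *
        (blockShift k m s).transpose := by
    rw [leftOp_eq_submatrix, rightOp_eq_submatrix, ← Matrix.submatrix_mul_equiv _ _ _
      (colPerm t m s).symm, ← Matrix.submatrix_mul_equiv _ _ _ (rowPerm t m s).symm]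
    simp only [Matrix.submatrix_submatrix, Equiv.self_comp_symm, Matrix.submatrix_id_id]
  rw [h1, ← h, displacement, Matrix.submatrix_sub, Pi.sub_apply, Pi.sub_apply, h2]

end StructType

/-- Inputs of the inversion problem over an extension field. -/
structure GenPoint (F : Type u) [Field F] (t : StructType) (m s a : ℕ) where
  /-- The extension field. -/
  K : Type u
  [field : Field K]
  [algebra : Algebra F K]
  /-- The matrix to be inverted. -/
  A : Matrix (Fin m × Fin s) (Fin m × Fin s) K
  /-- The left generator. -/
  X : Matrix (Fin m × Fin s) (Fin a × Fin s) K
  /-- The right generator. -/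
  Y : Matrix (Fin m × Fin s) (Fin a × Fin s) K
  isUnit : IsUnit A.det
  eq : displacement t A = X * Y.transpose

attribute [instance] GenPoint.field GenPoint.algebra

variable {F : Type u} [Field F]

/-- Inversion for all types of structure. The systems to be solved have `(2 * a + 2) * s` rows: `s`
for the solution, `a * s` for the generators, and `(a + 1) * s` right-hand sides. -/
theorem exists_invertsStructured {κ₀ τ : ℝ} (hκ₀ : 1 ≤ κ₀) (hτ : 2 ≤ τ)
    (hM₀ : ∀ e : ℕ, MulCost F (2 ^ e) (2 ^ e) (2 ^ e) (κ₀ * (2 ^ e) ^ τ)) {m e s a E : ℕ}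
    (hrE : (2 * a + 2) * s ≤ 2 ^ E) {κ σ : ℕ → ℝ}
    (hM : ∀ d, 1 ≤ d → MulCost F ((d + 1) * ((2 * a + 2) * s)) ((2 * a + 2) * s)
      ((d + 1) * ((2 * a + 2) * s)) (κ d))
    (hσ : ∀ d, 1 ≤ d → κ d + (d + 1) * ((d + 1) * ((2 * a + 2) * s : ℕ) * ((2 * a + 2) * s : ℕ)) ≤
      σ d)
    (hσ2 : ∀ d₁ d₂, 1 ≤ d₁ → 1 ≤ d₂ → σ d₁ + σ d₂ ≤ σ (d₁ + d₂))
    (hm : 1 ≤ m) (hme : 2 * m ≤ 2 ^ e) (t : StructType) :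
    ∃ T, InvertsStructured F t m s a T ∧ (T.cost : ℝ) ≤
      (4 * e + 10) * σ (2 * m) + (4 * m + 3) * ((10 * E + 6) * (κ₀ * (2 ^ E) ^ τ)) := by
  set f := rowPerm t m s
  set g := colPerm t m s
  let x : GenInput m s a → ∀ p : GenPoint F t m s a, p.K :=
    Sum.elim (fun q p => p.X q.1 q.2) (fun q p => p.Y q.1 q.2)
  have hX : AvailM Set.univ (Set.range x) fun p => p.X :=
    fun i j => Avail.of_mem ⟨Sum.inl (i, j), rfl⟩
  have hY : AvailM Set.univ (Set.range x) fun p => p.Y :=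
    fun i j => Avail.of_mem ⟨Sum.inr (i, j), rfl⟩
  have := Prog.inv_toeplitz hκ₀ hτ hM₀ hrE hM hσ hσ2 hm hme (Q := Fin a × Fin s) (s := s)
    (A := fun p => p.A.submatrix f.symm g.symm) (by simp; nlinarith)
    (fun p _ => (Matrix.isUnit_iff_isUnit_det _).1 ((Matrix.isUnit_submatrix_equiv _ _).2
      ((Matrix.isUnit_iff_isUnit_det _).2 p.isUnit)))
    (fun p _ => toeplitz_of_displacement_eq t p.eq) (hX.submatrix f.symm id)
    (hY.submatrix g.symm id)
  obtain ⟨T, hT, hr⟩ := Prog.exists_tree x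
    (fun (q : (Fin m × Fin s) × (Fin m × Fin s)) p => (p.A)⁻¹ q.1 q.2)
    (this.imp le_rfl fun _ _ _ _ h q => (h (g q.1) (f q.2)).congr fun p _ => by
      simp [Matrix.inv_submatrix_equiv])
  refine ⟨T, fun K _ _ A X Y hA hXY => ?_, hT⟩
  rw [← hr ⟨K, A, X, Y, hA, hXY⟩ (Set.mem_univ _)]
  congr 1
  funext q
  rcases q with q | q <;> rfl

/-! ### The running time -/

/-- Inversion with all parameters chosen, in terms of the cost of one rectangular product. The
sizes are doubled where they are not powers of `2`. -/
theorem exists_invertsStructured_le {C ε : ℝ} (hC : 1 ≤ C) (hε : 0 ≤ ε) (hε1 : ε ≤ 1)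
    (hM : ∀ n s : ℕ, 1 ≤ s → s ≤ n → MulCost F n s n (C * (n : ℝ) ^ (omegaSub F n s + ε)))
    {m s a : ℕ} (hm : 1 ≤ m) (hs : 1 ≤ s) (t : StructType) :
    ∃ (e E : ℕ) (T : _), 2 ^ e ≤ 4 * m ∧ 2 ^ E ≤ 2 * ((2 * a + 2) * s) ∧
      InvertsStructured F t m s a T ∧ (T.cost : ℝ) ≤
        ((4 * e + 10) * (192 * (2 * a + 2) ^ 3) + 7 * (10 * E + 6) * (4 * a + 4) ^ 4) * C *
          (((m * s : ℕ) : ℝ) ^ ε * rectBound F m s) := by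
  have hpow : ∀ n : ℕ, 1 ≤ n → ∃ e, n ≤ 2 ^ e ∧ 2 ^ e ≤ 2 * n := fun n hn =>
    ⟨Nat.clog 2 n, Nat.le_pow_clog one_lt_two n, by
      rcases hn.eq_or_lt with rfl | h
      · simp
      · have h1 := Nat.pow_pred_clog_lt_self one_lt_two h
        have h2 := Nat.clog_pos one_lt_two h
        obtain ⟨c, hc⟩ : ∃ c, Nat.clog 2 n = c + 1 := ⟨_, (Nat.succ_pred_eq_of_pos h2).symm⟩
        rw [hc] at h1 ⊢
        simp only [Nat.pred_succ] at h1
        rw [pow_succ]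
        omega⟩
  set g := 2 * a + 2 with hg
  have hgs : 1 ≤ g * s := Nat.mul_pos (by omega) hs
  obtain ⟨e, he1, he2⟩ := hpow (2 * m) (by omega)
  obtain ⟨E, hE1, hE2⟩ := hpow (g * s) hgs
  set h : ℕ → ℝ := fun d => ((d * s : ℕ) : ℝ) ^ (omegaSub F (d * s) s + ε) with hh
  have hsq : ∀ d : ℕ, 1 ≤ d → ((d * s : ℕ) : ℝ) * (d * s : ℕ) ≤ h d := fun d hd => by
    have hsn : s ≤ d * s := Nat.le_mul_of_pos_left s hd
    rw [← sq, ← Real.rpow_two]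
    exact Real.rpow_le_rpow_of_exponent_le (by exact_mod_cast hs.trans hsn)
      (by linarith [two_le_omegaSub (F := F) hs hsn])
  have hh0 : ∀ d : ℕ, 0 ≤ h d := fun d => by positivity
  -- for `n = 1` the logarithm in `ω_n` is `0`, but then the power does not depend on the exponent
  have hωself : ∀ n : ℕ, (n : ℝ) ^ (omegaSub F n n + ε) = (n : ℝ) ^ (omega F + ε) := fun n => by
    rcases Nat.lt_or_ge 1 n with h1 | h1
    · rw [omegaSub, Real.logb_self_eq_one (by exact_mod_cast h1)]
      rfl
    · interval_cases n
      · rw [Nat.cast_zero, omegaSub, Nat.cast_zero, Real.logb_zero,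
          Real.zero_rpow (by linarith [two_le_omegaRect (F := F) le_rfl]),
          Real.zero_rpow (by linarith [two_le_omega (F := F)])]
      · simp
  have hM₀ : ∀ e : ℕ, MulCost F (2 ^ e) (2 ^ e) (2 ^ e) (C * (2 ^ e) ^ (omega F + ε)) := fun e => by
    have := hM (2 ^ e) (2 ^ e) Nat.one_le_two_pow le_rfl
    rw [hωself] at this
    exact_mod_cast this
  have hg0 : (1 : ℝ) ≤ g := by exact_mod_cast (by omega : 1 ≤ g)
  have hrect : ∀ d : ℕ, 1 ≤ d →
      MulCost F ((d + 1) * (g * s)) (g * s) ((d + 1) * (g * s)) (8 * g ^ 3 * C * h d) := by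
    intro d hd
    have hsn : s ≤ d * s := Nat.le_mul_of_pos_left s hd
    have hsize : (d + 1) * (g * s) ≤ 2 * g * (d * s) :=
      calc (d + 1) * (g * s) ≤ (2 * d) * (g * s) := Nat.mul_le_mul_right _ (by omega)
        _ = 2 * g * (d * s) := by ring
    refine ((((hM (d * s) s hs hsn).inner g).rows (2 * g)).cols (2 * g)).mono hsize le_rfl hsize ?_
    have h1 := hsq d hd
    have h2 := hh0 d
    have h3 : (d * s : ℕ) * ((d * s : ℕ) : ℝ) ≤ C * h d := h1.trans (le_mul_of_one_le_left h2 hC)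
    calc (2 * g : ℕ) * ((2 * g : ℕ) * (g * (C * h d + (d * s : ℕ) * ((d * s : ℕ) : ℝ))))
        ≤ (2 * g : ℕ) * ((2 * g : ℕ) * (g * (C * h d + C * h d))) := by gcongr
      _ = 8 * g ^ 3 * C * h d := by push_cast; ring
  obtain ⟨T, hT, hc⟩ := exists_invertsStructured (σ := fun d => 12 * g ^ 3 * C * h d) hC
    (by linarith [two_le_omega (F := F)]) hM₀ hE1 hrect
    (fun d hd => by
      have h1 := hsq d hd
      have h2 := hh0 d
      have h3 : (d * s : ℕ) * ((d * s : ℕ) : ℝ) ≤ C * h d := h1.trans (le_mul_of_one_le_left h2 hC)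
      have hd1 : (1 : ℝ) ≤ d := by exact_mod_cast hd
      have h4 : ((d : ℝ) + 1) * ((d + 1) * (g * s : ℕ) * (g * s : ℕ)) ≤ 4 * g ^ 3 * (C * h d) :=
        calc ((d : ℝ) + 1) * ((d + 1) * (g * s : ℕ) * (g * s : ℕ))
            ≤ (2 * d) * (2 * d * (g * s : ℕ) * (g * s : ℕ)) := by
              gcongr <;> linarith
          _ = 4 * g ^ 2 * ((d * s : ℕ) * (d * s : ℕ)) := by push_cast; ring
          _ ≤ 4 * g ^ 3 * (C * h d) := by
              gcongr
              norm_num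
      linarith)
    (fun d₁ d₂ hd₁ hd₂ => by
      have h1 := rpow_omegaSub_mul_le (F := F) hε hs hd₁ (Nat.le_add_right d₁ d₂)
      have h2 := rpow_omegaSub_mul_le (F := F) hε hs hd₂ (Nat.le_add_left d₂ d₁)
      have hpos : (0 : ℝ) < (d₁ + d₂ : ℕ) := by exact_mod_cast (by omega : 0 < d₁ + d₂)
      have h3 : h d₁ + h d₂ ≤ h (d₁ + d₂) := by
        refine le_of_mul_le_mul_right ?_ hpos
        calc (h d₁ + h d₂) * (d₁ + d₂ : ℕ) = h d₁ * (d₁ + d₂ : ℕ) + h d₂ * (d₁ + d₂ : ℕ) := by ring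
          _ ≤ h (d₁ + d₂) * d₁ + h (d₁ + d₂) * d₂ := add_le_add h1 h2
          _ = h (d₁ + d₂) * (d₁ + d₂ : ℕ) := by push_cast; ring
      rw [← mul_add]
      exact mul_le_mul_of_nonneg_left h3 (by positivity))
    hm he1 t
  refine ⟨e, E, T, by omega, hE2, hT, hc.trans ?_⟩
  have hms : 0 < m * s := Nat.mul_pos hm hs
  have hN : (1 : ℝ) ≤ (m * s : ℕ) := by exact_mod_cast hms
  have hN0 : (0 : ℝ) < (m * s : ℕ) := by linarith
  set R := ((m * s : ℕ) : ℝ) ^ ε * rectBound F m s with hR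
  have hhm : h m = R := by
    simp only [hh, hR, rectBound]
    rw [Real.rpow_add hN0, mul_comm]
  have hσm : h (2 * m) ≤ 16 * R := by
    rw [← hhm]
    refine (rpow_omegaSub_two_mul_le hs hm).trans ?_
    refine mul_le_mul_of_nonneg_right ?_ (hh0 m)
    calc (2 : ℝ) ^ (3 + ε) ≤ 2 ^ (4 : ℝ) :=
          Real.rpow_le_rpow_of_exponent_le (by norm_num) (by linarith)
      _ = 16 := by norm_num
  have hs0 : (0 : ℝ) < s := by exact_mod_cast hs
  have hsR : m * (s : ℝ) ^ (omega F + ε) ≤ R := by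
    rw [Real.rpow_add hs0]
    calc m * ((s : ℝ) ^ omega F * (s : ℝ) ^ ε) = (s : ℝ) ^ ε * ((s : ℝ) ^ omega F * m) := by ring
      _ ≤ R := by
        refine mul_le_mul ?_ (rpow_omega_mul_le_rectBound hm hs) (by positivity) (by positivity)
        exact Real.rpow_le_rpow hs0.le (by exact_mod_cast Nat.le_mul_of_pos_left s hm) hε
  have hdense : (2 ^ E : ℝ) ^ (omega F + ε) ≤ (2 * g) ^ 4 * (s : ℝ) ^ (omega F + ε) := by
    have h1 : (2 ^ E : ℝ) ≤ (2 * g) * s := by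
      have : ((2 ^ E : ℕ) : ℝ) ≤ (2 * (g * s) : ℕ) := by exact_mod_cast hE2
      push_cast at this
      linarith
    calc (2 ^ E : ℝ) ^ (omega F + ε) ≤ ((2 * g) * s) ^ (omega F + ε) :=
          Real.rpow_le_rpow (by positivity) h1 (by linarith [two_le_omega (F := F)])
      _ = (2 * g) ^ (omega F + ε) * (s : ℝ) ^ (omega F + ε) :=
          Real.mul_rpow (by positivity) hs0.le
      _ ≤ (2 * g) ^ 4 * (s : ℝ) ^ (omega F + ε) := by
        refine mul_le_mul_of_nonneg_right ?_ (by positivity)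
        rw [← Real.rpow_natCast]
        refine Real.rpow_le_rpow_of_exponent_le (by linarith) ?_
        push_cast
        linarith [omega_le_three (F := F)]
  have hm1 : (1 : ℝ) ≤ m := by exact_mod_cast hm
  have hR0 : 0 ≤ R := hhm ▸ hh0 m
  calc (4 * e + 10) * (12 * g ^ 3 * C * h (2 * m)) +
        (4 * m + 3) * ((10 * E + 6) * (C * (2 ^ E) ^ (omega F + ε)))
      ≤ (4 * e + 10) * (12 * g ^ 3 * C * (16 * R)) +
        (7 * m) * ((10 * E + 6) * (C * ((2 * g) ^ 4 * (s : ℝ) ^ (omega F + ε)))) := by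
        gcongr
        linarith
    _ = (4 * e + 10) * (192 * g ^ 3) * C * R +
        7 * (10 * E + 6) * (2 * g) ^ 4 * C * (m * (s : ℝ) ^ (omega F + ε)) := by ring
    _ ≤ (4 * e + 10) * (192 * g ^ 3) * C * R + 7 * (10 * E + 6) * (2 * g) ^ 4 * C * R := by gcongr
    _ = _ := by
        rw [hg]
        push_cast
        ring

/-- A function that is `n ^ o(1)` is bounded by `C * n ^ ε` for all positive `n`. -/
theorem exists_le_mul_rpow {α : ℕ → ℕ}
    (hα : ∀ ε : ℝ, 0 < ε → ∀ᶠ n : ℕ in atTop, (α n : ℝ) ≤ (n : ℝ) ^ ε) {ε : ℝ} (hε : 0 < ε) :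
    ∃ C : ℝ, 1 ≤ C ∧ ∀ n : ℕ, 0 < n → (α n : ℝ) ≤ C * (n : ℝ) ^ ε := by
  obtain ⟨N, hN⟩ := eventually_atTop.1 (hα ε hε)
  refine ⟨1 + ∑ i ∈ Finset.range N, (α i : ℝ),
    by linarith [Finset.sum_nonneg fun i (_ : i ∈ Finset.range N) => (α i).cast_nonneg (α := ℝ)],
    fun n hn => ?_⟩
  have h1 : (1 : ℝ) ≤ (n : ℝ) ^ ε := Real.one_le_rpow (by exact_mod_cast hn) hε.le
  have h0 : (0 : ℝ) ≤ ∑ i ∈ Finset.range N, (α i : ℝ) := by positivity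
  rcases Nat.lt_or_ge n N with h | h
  · have := Finset.single_le_sum (fun i (_ : i ∈ Finset.range N) => (α i).cast_nonneg (α := ℝ))
      (Finset.mem_range.2 h)
    nlinarith
  · nlinarith [hN n h]

/-- Logarithms are bounded by powers. -/
theorem natCast_le_div_mul_rpow {ε : ℝ} (hε : 0 < ε) (e : ℕ) :
    (e : ℝ) ≤ 1 / (ε * Real.log 2) * (2 ^ e : ℝ) ^ ε := by
  have h2 : 0 < Real.log 2 := Real.log_pos one_lt_two
  have := Real.log_le_rpow_div (x := (2 : ℝ) ^ e) (by positivity) hε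
  rw [Real.log_pow] at this
  rw [div_mul_eq_mul_div, one_mul, le_div_iff₀ (by positivity)]
  rw [le_div_iff₀ hε] at this
  linarith

/-- The loss factors of the cost, with `x = n ^ δ`: the logarithms `e` and `E` contribute `x ^ 2`,
the length `a` of the generators contributes `x`. -/
theorem cost_polynomial_le {e E a L B x : ℝ} (hx : 1 ≤ x) (hL : 0 ≤ L)
    (he : e ≤ 4 * L * x ^ 2) (hE : E ≤ 2 * B * L * x ^ 2) (ha : 0 ≤ a)
    (ha' : 2 * a + 2 ≤ B * x) :
    ((4 * e + 10) * (192 * (2 * a + 2) ^ 3) + 7 * (10 * E + 6) * (4 * a + 4) ^ 4) * x ≤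
      ((16 * L + 10) * (192 * B ^ 3) + 7 * (20 * B * L + 6) * (2 * B) ^ 4) * x ^ 7 := by
  have hx0 : 0 ≤ x := by linarith
  have hB : 0 ≤ B := nonneg_of_mul_nonneg_left (by linarith) (by linarith : 0 < x)
  have hx2 : 1 ≤ x ^ 2 := one_le_pow₀ hx
  have e1 : 4 * e + 10 ≤ (16 * L + 10) * x ^ 2 := by linarith
  have e2 : 10 * E + 6 ≤ (20 * B * L + 6) * x ^ 2 := by linarith
  have e3 : 4 * a + 4 ≤ 2 * B * x := by linarith
  have e4 : (2 * a + 2) ^ 3 ≤ (B * x) ^ 3 := pow_le_pow_left₀ (by linarith) ha' 3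
  have e5 : (4 * a + 4) ^ 4 ≤ (2 * B * x) ^ 4 := pow_le_pow_left₀ (by linarith) e3 4
  have e6 : (4 * e + 10) * (192 * (2 * a + 2) ^ 3) ≤
      ((16 * L + 10) * x ^ 2) * (192 * (B * x) ^ 3) :=
    mul_le_mul e1 (by linarith) (by positivity) (by positivity)
  have e7 : 7 * (10 * E + 6) * (4 * a + 4) ^ 4 ≤
      7 * ((20 * B * L + 6) * x ^ 2) * (2 * B * x) ^ 4 :=
    mul_le_mul (by linarith) e5 (by positivity) (by positivity)
  have hxx : x ^ 6 ≤ x ^ 7 := pow_le_pow_right₀ hx (by norm_num)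
  calc ((4 * e + 10) * (192 * (2 * a + 2) ^ 3) + 7 * (10 * E + 6) * (4 * a + 4) ^ 4) * x
      ≤ (((16 * L + 10) * x ^ 2) * (192 * (B * x) ^ 3) +
          7 * ((20 * B * L + 6) * x ^ 2) * (2 * B * x) ^ 4) * x :=
        mul_le_mul_of_nonneg_right (add_le_add e6 e7) hx0
    _ = ((16 * L + 10) * (192 * B ^ 3)) * x ^ 6 +
          (7 * (20 * B * L + 6) * (2 * B) ^ 4) * x ^ 7 := by ring
    _ ≤ ((16 * L + 10) * (192 * B ^ 3)) * x ^ 7 +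
          (7 * (20 * B * L + 6) * (2 * B) ^ 4) * x ^ 7 := by
        have := mul_le_mul_of_nonneg_left hxx
          (by positivity : 0 ≤ (16 * L + 10) * (192 * B ^ 3))
        linarith
    _ = _ := by ring

/-- Nonsingular block matrices with generators of length `n ^ o(1)` can be inverted in time
`n ^ (ω_s + o(1))`. -/
theorem exists_invertsStructured_le_rectBound {α : ℕ → ℕ}
    (hα : ∀ ε : ℝ, 0 < ε → ∀ᶠ n : ℕ in atTop, (α n : ℝ) ≤ (n : ℝ) ^ ε) (t : StructType) {ε : ℝ}
    (hε : 0 < ε) : ∃ C : ℝ, ∀ m s : ℕ, 0 < m → 0 < s →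
      ∃ T, InvertsStructured F t m s (α (m * s)) T ∧
        (T.cost : ℝ) ≤ C * ((m * s : ℕ) : ℝ) ^ ε * rectBound F m s := by
  -- the loss is at most `n ^ (7 * δ)`
  set δ := min (ε / 7) 1 with hδ
  have hδ0 : 0 < δ := lt_min (by positivity) one_pos
  have hδ1 : δ ≤ 1 := min_le_right _ _
  obtain ⟨C, hC1, hC⟩ := exists_mulCost_omegaSub (F := F) hδ0
  obtain ⟨C', hC'1, hC'⟩ := exists_le_mul_rpow hα hδ0
  set L := 1 / (δ * Real.log 2) with hL
  have hL0 : 0 ≤ L := by have := Real.log_pos one_lt_two; positivity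
  set B := 2 * C' + 2 with hB
  refine ⟨((16 * L + 10) * (192 * B ^ 3) + 7 * (20 * B * L + 6) * (2 * B) ^ 4) * C,
    fun m s hm hs => ?_⟩
  obtain ⟨e, E, T, he, hE, hT, hcost⟩ := exists_invertsStructured_le (a := α (m * s)) hC1 hδ0.le hδ1
    hC hm hs t
  refine ⟨T, hT, hcost.trans ?_⟩
  have hms : 0 < m * s := Nat.mul_pos hm hs
  have hN : (1 : ℝ) ≤ (m * s : ℕ) := by exact_mod_cast hms
  have hR : 0 ≤ rectBound F m s := by unfold rectBound; positivity
  have ha := hC' (m * s) hms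
  set N : ℝ := ((m * s : ℕ) : ℝ) with hNdef
  set a := α (m * s)
  set x := N ^ δ with hx
  have hx1 : 1 ≤ x := Real.one_le_rpow hN hδ0.le
  have hg : (2 * a + 2 : ℝ) ≤ B * x := by rw [hB]; nlinarith
  have hx7 : x ^ 7 ≤ N ^ ε := by
    rw [hx, ← Real.rpow_natCast, ← Real.rpow_mul (by linarith)]
    refine Real.rpow_le_rpow_of_exponent_le hN ?_
    have := min_le_left (ε / 7) 1
    push_cast
    linarith
  have hm1 : (1 : ℝ) ≤ m := by exact_mod_cast hm
  have hs1 : (1 : ℝ) ≤ s := by exact_mod_cast hs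
  have hNms : N = m * s := by rw [hNdef]; push_cast; ring
  have hroot : ∀ y : ℝ, 1 ≤ y → y ^ δ ≤ y := fun y hy => by
    simpa using Real.rpow_le_rpow_of_exponent_le hy hδ1
  have he' : (e : ℝ) ≤ 4 * L * x ^ 2 := by
    have h1 : (2 ^ e : ℝ) ≤ 4 * N := by
      have : ((2 ^ e : ℕ) : ℝ) ≤ (4 * m : ℕ) := by exact_mod_cast he
      push_cast at this
      nlinarith
    have h2 : (2 ^ e : ℝ) ^ δ ≤ 4 * x := by
      refine (Real.rpow_le_rpow (by positivity) h1 hδ0.le).trans ?_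
      rw [Real.mul_rpow (by norm_num) (by linarith)]
      exact mul_le_mul_of_nonneg_right (hroot 4 (by norm_num)) (by positivity)
    calc (e : ℝ) ≤ L * (2 ^ e : ℝ) ^ δ := natCast_le_div_mul_rpow hδ0 e
      _ ≤ L * (4 * x) := by gcongr
      _ = 4 * L * x * 1 := by ring
      _ ≤ 4 * L * x * x := by gcongr
      _ = 4 * L * x ^ 2 := by ring
  have hE' : (E : ℝ) ≤ 2 * B * L * x ^ 2 := by
    have h1 : (2 ^ E : ℝ) ≤ 2 * (B * x) * N := by
      have h0 : ((2 ^ E : ℕ) : ℝ) ≤ (2 * ((2 * a + 2) * s) : ℕ) := by exact_mod_cast hE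
      push_cast at h0
      have h3 : (s : ℝ) ≤ N := by nlinarith
      calc (2 ^ E : ℝ) ≤ 2 * ((2 * a + 2) * s) := h0
        _ ≤ 2 * ((B * x) * N) := by gcongr
        _ = _ := by ring
    have hxN : x ≤ N := hroot N hN
    have hB1 : 1 ≤ 2 * B := by rw [hB]; linarith
    have h2 : (2 ^ E : ℝ) ^ δ ≤ 2 * B * x ^ 2 := by
      have h3 : (2 ^ E : ℝ) ≤ 2 * B * (N * N) := by
        refine h1.trans ?_
        rw [mul_assoc, mul_assoc, mul_assoc]
        gcongr
      refine (Real.rpow_le_rpow (by positivity) h3 hδ0.le).trans ?_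
      rw [Real.mul_rpow (by linarith) (by positivity),
        Real.mul_rpow (x := N) (by linarith) (by linarith), sq]
      exact mul_le_mul_of_nonneg_right (hroot _ hB1) (mul_self_nonneg x)
    calc (E : ℝ) ≤ L * (2 ^ E : ℝ) ^ δ := natCast_le_div_mul_rpow hδ0 E
      _ ≤ L * (2 * B * x ^ 2) := by gcongr
      _ = _ := by ring
  have hpoly := cost_polynomial_le hx1 hL0 he' hE' a.cast_nonneg hg
  calc ((4 * e + 10) * (192 * (2 * a + 2) ^ 3) + 7 * (10 * E + 6) * (4 * a + 4) ^ 4 : ℝ) * C *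
        (x * rectBound F m s)
      = (((4 * e + 10) * (192 * (2 * a + 2) ^ 3) + 7 * (10 * E + 6) * (4 * a + 4) ^ 4 : ℝ) * x) *
        C * rectBound F m s := by ring
    _ ≤ (((16 * L + 10) * (192 * B ^ 3) + 7 * (20 * B * L + 6) * (2 * B) ^ 4) * N ^ ε) *
        C * rectBound F m s := by
        have hB0 : 0 ≤ B := by rw [hB]; linarith
        refine mul_le_mul_of_nonneg_right (mul_le_mul_of_nonneg_right (hpoly.trans ?_)
          (by linarith)) hR
        exact mul_le_mul_of_nonneg_left hx7 (by positivity)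
    _ = _ := by ring

/-- A tree of least cost serves all exponents at once. -/
theorem exists_minimal_invertsStructured {t : StructType} {m s a : ℕ}
    (h : ∃ T, InvertsStructured F t m s a T) :
    ∃ T, InvertsStructured F t m s a T ∧
      ∀ T', InvertsStructured F t m s a T' → T.cost ≤ T'.cost := by
  classical
  have h' : ∃ n, ∃ T, InvertsStructured F t m s a T ∧ T.cost = n := h.imp' CompTree.cost
    fun T hT => ⟨T, hT, rfl⟩
  obtain ⟨T, hT, hTn⟩ := Nat.find_spec h'
  exact ⟨T, hT, fun T' hT' => hTn ▸ Nat.find_min' h' ⟨T', hT', rfl⟩⟩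

end StructInv

open StructInv in
theorem mainTheorem1 (F : Type*) [Field F] (α : ℕ → ℕ)
    (hα : ∀ ε : ℝ, 0 < ε → ∀ᶠ n : ℕ in atTop, (α n : ℝ) ≤ (n : ℝ) ^ ε) (t : StructType) :
    (∃ T : ∀ m s : ℕ, CompTree F (GenInput m s (α (m * s)))
        ((Fin m × Fin s) × (Fin m × Fin s)),
      (∀ m s : ℕ, InvertsStructured F t m s (α (m * s)) (T m s)) ∧
      HatO (fun _ _ => True) (fun m s => ((T m s).cost : ℝ)) (threeTermBound F) ∧
      HatO (fun _ _ => True) (fun m s => ((T m s).cost : ℝ)) (rectBound F) ∧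
      HatO (fun m s => (s : ℝ) < ((m * s : ℕ) : ℝ) ^ dualExponent F)
        (fun m s => ((T m s).cost : ℝ)) (fun m s => ((m * s : ℕ) : ℝ) ^ 2)) ∧
    HatO (fun _ _ => True) (threeTermBound F) (rectBound F) ∧
    HatO (fun _ _ => True) (rectBound F) (threeTermBound F) := by
  have hrect : ∀ m s : ℕ, 0 ≤ rectBound F m s := fun m s => by unfold rectBound; positivity
  have hle : ∀ m s : ℕ, rectBound F m s ≤ threeTermBound F m s := fun m s => by
    have h1 : 0 ≤ (s : ℝ) ^ omega F * m := by positivity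
    have h2 : (0 : ℝ) ≤ ((m * s : ℕ) : ℝ) ^ 2 := by positivity
    unfold rectBound threeTermBound
    linarith
  have hone : ∀ (m s : ℕ) (ε : ℝ), 0 < m → 0 < s → 0 < ε → 1 ≤ ((m * s : ℕ) : ℝ) ^ ε :=
    fun m s ε hm hs hε =>
      Real.one_le_rpow (by exact_mod_cast Nat.mul_pos hm hs) hε.le
  have hex : ∀ m s : ℕ, ∃ T, InvertsStructured F t m s (α (m * s)) T := by
    intro m s
    -- without blocks or with empty blocks there is nothing to output
    rcases Nat.eq_zero_or_pos m with rfl | hm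
    · exact ⟨.halt fun q => q.1.1.elim0, fun K _ _ A X Y _ _ =>
        congrArg some (funext fun q => q.1.1.elim0)⟩
    rcases Nat.eq_zero_or_pos s with rfl | hs
    · exact ⟨.halt fun q => q.1.2.elim0, fun K _ _ A X Y _ _ =>
        congrArg some (funext fun q => q.1.2.elim0)⟩
    obtain ⟨C, hC⟩ := exists_invertsStructured_le_rectBound (F := F) hα t one_pos
    obtain ⟨T, hT, -⟩ := hC m s hm hs
    exact ⟨T, hT⟩
  choose T hT hmin using fun m s => exists_minimal_invertsStructured (hex m s)
  have hcost : ∀ ε : ℝ, 0 < ε → ∃ C : ℝ, 0 ≤ C ∧ ∀ m s : ℕ, 0 < m → 0 < s →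
      ((T m s).cost : ℝ) ≤ C * ((m * s : ℕ) : ℝ) ^ ε * rectBound F m s := by
    intro ε hε
    obtain ⟨C, hC⟩ := exists_invertsStructured_le_rectBound (F := F) hα t hε
    refine ⟨max C 0, le_max_right _ _, fun m s hm hs => ?_⟩
    obtain ⟨T', hT', hc⟩ := hC m s hm hs
    refine le_trans (by exact_mod_cast hmin m s T' hT') (hc.trans ?_)
    have := hrect m s
    gcongr
    exact le_max_left _ _
  refine ⟨⟨T, hT, ?_, ?_, ?_⟩, ?_, ?_⟩
  · intro ε hε
    obtain ⟨C, hC0, hC⟩ := hcost ε hε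
    refine ⟨C, fun m s hm hs _ => (hC m s hm hs).trans ?_⟩
    exact mul_le_mul_of_nonneg_left (hle m s) (by positivity)
  · intro ε hε
    obtain ⟨C, -, hC⟩ := hcost ε hε
    exact ⟨C, fun m s hm hs _ => hC m s hm hs⟩
  · intro ε hε
    obtain ⟨C, -, hC⟩ := hcost ε hε
    refine ⟨C, fun m s hm hs hlt => ?_⟩
    have := hC m s hm hs
    rwa [rectBound, omegaSub_eq_two hm hs hlt, Real.rpow_two] at this
  · intro ε hε
    refine ⟨3, fun m s hm hs _ => ?_⟩
    have h1 := rpow_omega_mul_le_rectBound (F := F) hm hs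
    have h2 := sq_le_rectBound (F := F) hm hs
    have h3 : threeTermBound F m s ≤ 3 * rectBound F m s := by
      unfold threeTermBound
      change _ + rectBound F m s + _ ≤ _
      linarith
    refine h3.trans ?_
    have := hone m s ε hm hs hε
    have := hrect m s
    nlinarith
  · intro ε hε
    refine ⟨1, fun m s hm hs _ => (hle m s).trans ?_⟩
    have h1 := hone m s ε hm hs hε
    have h2 := (hrect m s).trans (hle m s)
    nlinarith

end
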